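/- Conventions. Superfields are smooth functions of two real variables (space, time) and one odd variable, with component fields valued in a real Grassmann algebra with $N$ further odd generators ($N\ge 0$ arbitrary). Write $\mathcal D=\partial_\theta+\theta\partial_x$ and $\mathbb D=\partial_\varrho+\varrho\partial_y$. Real powers and logarithms of an even (bosonic) superfield with positive body are defined by Taylor expansion around the body, and so is substitution of superfields into superfields. Let $\Omega\subseteq\mathbb R^2$ be open and let $U(x,\theta,t)$ be a smooth even superfield over $\Omega$ with positive body which satisfies the SUSY Harry Dym equation $$U_t=\tfrac14U_{3x}U^3-\tfrac38(\mathcal DU_{2x})(\mathcal DU)U^2 .$$ A reciprocal transformation for $U$ is a smooth change of variables $y=y(x,\theta,t)$ (even), $\varrho=\varrho(x,\theta,t)$ (odd), $\tau=t$, with injective underlying map $(x,t)\mapsto(\text{body of }y,\,t)$ and with $\partial_xy$ and $\partial_\theta\varrho$ invertible, such that on all smooth superfields of the new variables $$\mathcal D=U^{-1/2}\,\mathbb D,$$ $$\partial_t=\partial_\tau+\Big(-\tfrac14U_{2x}U+\tfrac18U_x^2+\tfrac14(\mathcal DU_x)(\mathcal DU)\Big)\partial_y-\tfrac18(\mathcal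 DU_{2x})U^{3/2}\,\mathbb D .$$ 1. If $\Omega$ is convex, a reciprocal transformation for $U$ exists. 2. For every reciprocal transformation for $U$, the image $V$ of $\Omega$ in the $(y,\tau)$-plane is open, and there is a smooth superfield $S$ over $V$ with $S(y,\varrho,\tau)=U(x,\theta,t)$. Every such $S$ is even with positive body, and: (a) in the new variables the formula for $\partial_t$ reads $$\partial_t=\partial_\tau+\tfrac18\Big(-2\tfrac{S_{2y}}{S}+3\tfrac{S_y^2}{S^2}+\tfrac{(\mathbb DS_y)(\mathbb DS)}{S^2}\Big)\partial_y+\tfrac1{16}\Big(-2\tfrac{(\mathbb DS_{2y})}{S}+5\tfrac{(\mathbb DS_y)S_y}{S^2}+3\tfrac{(\mathbb DS)S_{2y}}{S^2}-6\tfrac{(\mathbb DS)S_y^2}{S^3}\Big)\mathbb D,$$ that is, the two coefficients here equal the corresponding coefficients in terms of $U$ above; (b) $S$ satisfies $$S_\tau=\tfrac1{16}\Big(4S_{3y}-12\tfrac{S_{2y}S_y}{S}+6\tfrac{S_y^3}{S^2}-3\tfrac{(\mathbb DS_y)(\mathbb DS)S_y}{S^2}\Big);\qquad(*)$$ (c)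 $\Psi=-\mathbb D\log S$ satisfies the SUSY MKdV equation $$\Psi_\tau=\tfrac14\Psi_{3y}-\tfrac3{16}(\mathbb D\Psi)\,[\Psi(\mathbb D\Psi)]_y;$$ (d) if $\Omega$ is convex, there is a smooth odd superfield $\Lambda$ over $V$ such that $\mathbb D\Lambda$ has positive body, $S=(\mathbb D\Lambda)^{-2}$, and $\Lambda$ satisfies the SUSY Schwarzian KdV equation $$\Lambda_\tau=\tfrac14\Big(\Lambda_{3y}-3\tfrac{\Lambda_{2y}(\mathbb D\Lambda_y)}{\mathbb D\Lambda}\Big).\qquad(**)$$ 3. Let $V\subseteq\mathbb R^2$ be open and $\Lambda$ a smooth odd superfield over $V$ such that $\mathbb D\Lambda$ has positive body. Then $S=(\mathbb D\Lambda)^{-2}$ satisfies $(*)$ if and only if $\mathbb D$ annihilates the difference of the two sides of $(**)$. If $\Lambda$ satisfies $(**)$, then $\Psi=2\mathbb D\log(\mathbb D\Lambda)$ satisfies the SUSY MKdV equation. -/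

import Mathlib

open scoped ContDiff Nat

noncomputable section

namespace SusyHD

/-- The real Grassmann algebra with `N + 1` anticommuting generators.  The generator with index `0`
is the odd coordinate of superspace (called `θ` in the old and `ϱ` in the new variables); the other
`N` generators are the odd constants over which the component fields are defined. -/
abbrev Gr (N : ℕ) : Type := ExteriorAlgebra ℝ (Fin (N + 1) → ℝ)

/-- The basis of the Grassmann algebra by ordered products of generators. -/
def grBasis (N : ℕ) : Module.Basis (Finset (Fin (N + 1))) ℝ (Gr N) :=
  (Pi.basisFun ℝ (Fin (N + 1))).ExteriorAlgebra

/-- The left regular representation, on coordinate vectors.  It is only used to put a norm on the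
finite-dimensional algebra `Gr N`; smoothness and derivatives do not depend on the norm. -/
def regRep (N : ℕ) :
    Gr N →ₐ[ℝ] ((Finset (Fin (N + 1)) → ℝ) →L[ℝ] (Finset (Fin (N + 1)) → ℝ)) :=
  ((Module.End.toContinuousLinearMap (𝕜 := ℝ) (Finset (Fin (N + 1)) → ℝ)).toAlgHom.comp
    (LinearEquiv.conjAlgEquiv ℝ (grBasis N).equivFun).toAlgHom).comp (Algebra.lmul ℝ (Gr N))

theorem regRep_injective (N : ℕ) : Function.Injective (regRep N) := by
  have h : Function.Injective (Algebra.lmul ℝ (Gr N)) := by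
    intro a b hab
    have := congrArg (fun f : Module.End ℝ (Gr N) => f 1) hab
    simpa using this
  exact ((Module.End.toContinuousLinearMap (𝕜 := ℝ) (Finset (Fin (N + 1)) → ℝ)).injective.comp
    (LinearEquiv.conjAlgEquiv ℝ (grBasis N).equivFun).injective).comp h

instance (N : ℕ) : NormedRing (Gr N) :=
  NormedRing.induced (Gr N) _ (regRep N) (regRep_injective N)

instance (N : ℕ) : NormedAlgebra ℝ (Gr N) :=
  NormedAlgebra.induced ℝ (Gr N) _ (regRep N)

instance (N : ℕ) : FiniteDimensional ℝ (Gr N) :=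
  Module.Finite.of_basis (grBasis N)

variable {N : ℕ}

/-- Bosonic elements. -/
def IsEven (a : Gr N) : Prop :=
  a ∈ CliffordAlgebra.evenOdd (0 : QuadraticForm ℝ (Fin (N + 1) → ℝ)) 0

/-- Fermionic elements. -/
def IsOdd (a : Gr N) : Prop :=
  a ∈ CliffordAlgebra.evenOdd (0 : QuadraticForm ℝ (Fin (N + 1) → ℝ)) 1

/-- The body: the real number obtained by setting all generators to zero. -/
def body (a : Gr N) : ℝ := ExteriorAlgebra.algebraMapInv a

/-- The soul, i.e. the nilpotent part. -/
def soul (a : Gr N) : Gr N := a - algebraMap ℝ (Gr N) (body a)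

/-- The odd coordinate. -/
def theta : Gr N := ExteriorAlgebra.ι ℝ (Pi.single 0 1)

/-- The left derivative with respect to the odd coordinate: if `a = a₀ + θ a₁` where `a₀`, `a₁` do
not contain `θ`, then this is `a₁`. -/
def dTheta (a : Gr N) : Gr N :=
  CliffordAlgebra.contractLeft (Q := (0 : QuadraticForm ℝ (Fin (N + 1) → ℝ)))
    (LinearMap.proj 0 : (Fin (N + 1) → ℝ) →ₗ[ℝ] ℝ) a

/-- Substitution of the odd element `r` for the odd coordinate: `a₀ + θ a₁ ↦ a₀ + r a₁`. -/
def substTheta (r a : Gr N) : Gr N := a + (r - theta) * dTheta a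

/-- The value of a smooth real function `f` at an even element `a`, by the (terminating) Taylor
expansion around the body of `a`.  All powers of the soul from the `N + 2`nd on vanish. -/
def gEval (f : ℝ → ℝ) (a : Gr N) : Gr N :=
  ∑ k ∈ Finset.range (N + 2), (iteratedDeriv k f (body a) / (k ! : ℝ)) • soul a ^ k

/-- Real powers of an even element with positive body. -/
def gPow (a : Gr N) (r : ℝ) : Gr N := gEval (fun s => s ^ r) a

/-- Logarithm of an even element with positive body. -/
def gLog (a : Gr N) : Gr N := gEval Real.log a

/-- Superfields in one even space variable (first component), time (second component) and one odd
variable (the generator `theta` of the Grassmann algebra). -/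
abbrev SField (N : ℕ) : Type := ℝ × ℝ → Gr N

/-- Derivative in the even space variable (`∂_x` or `∂_y`). -/
def dX (F : SField N) : SField N := fun p => fderiv ℝ F p (1, 0)

/-- Derivative in time (`∂_t` or `∂_τ`). -/
def dT (F : SField N) : SField N := fun p => fderiv ℝ F p (0, 1)

/-- The superderivative `∂_θ + θ ∂_x` (or `∂_ϱ + ϱ ∂_y`). -/
def sD (F : SField N) : SField N := fun p => dTheta (F p) + theta * dX F p

/-- The map of even variables `(x, t) ↦ (body of y, t)` underlying a change of variables
`(x, θ, t) ↦ (y, ϱ, t)`. -/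
def bodyMap (Y : SField N) : ℝ × ℝ → ℝ × ℝ := fun p => (body (Y p), p.2)

/-- The superfield `F(y, ϱ, τ)` expressed in the old variables: `F(Y(x,θ,t), R(x,θ,t), t)`.
The even argument `Y` is inserted by Taylor expansion around its body. -/
def pull (Y R : SField N) (F : SField N) : SField N := fun p =>
  ∑ k ∈ Finset.range (N + 2),
    ((k ! : ℝ)⁻¹) • (soul (Y p) ^ k * substTheta (R p) ((dX^[k] F) (bodyMap Y p)))

/-- A smooth invertible change of variables `y = Y(x,θ,t)`, `ϱ = R(x,θ,t)`, `τ = t` on the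
superdomain over `Ω`: `Y` even, `R` odd, the underlying map injective, and the even and odd diagonal
entries of the Jacobian invertible. -/
structure IsSuperChange (Ω : Set (ℝ × ℝ)) (Y R : SField N) : Prop where
  smoothY : ContDiffOn ℝ ∞ Y Ω
  smoothR : ContDiffOn ℝ ∞ R Ω
  evenY : ∀ p ∈ Ω, IsEven (Y p)
  oddR : ∀ p ∈ Ω, IsOdd (R p)
  inj : Set.InjOn (bodyMap Y) Ω
  nondegY : ∀ p ∈ Ω, body (dX Y p) ≠ 0
  nondegR : ∀ p ∈ Ω, body (dTheta (R p)) ≠ 0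

/-- The supersymmetric Harry Dym equation `U_t = ¼ U_{3x} U³ - ⅜ (𝒟U_{2x}) (𝒟U) U²` on `Ω`. -/
def SusyHarryDym (Ω : Set (ℝ × ℝ)) (U : SField N) : Prop := ∀ p ∈ Ω,
  dT U p = (1 / 4 : ℝ) • (dX (dX (dX U)) p * U p ^ 3)
    - (3 / 8 : ℝ) • (sD (dX (dX U)) p * sD U p * U p ^ 2)

/-- The supersymmetric MKdV equation `Ψ_τ = ¼ Ψ_{3y} - (3/16) (𝔻Ψ) [Ψ (𝔻Ψ)]_y` on `V`. -/
def SusyMKdV (V : Set (ℝ × ℝ)) (P : SField N) : Prop := ∀ q ∈ V,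
  dT P q = (1 / 4 : ℝ) • dX (dX (dX P)) q
    - (3 / 16 : ℝ) • (sD P q * dX (fun z => P z * sD P z) q)

/-- The equation `S_τ = (1/16) (4 S_{3y} - 12 S_{2y} S_y / S + 6 S_y³ / S²
- 3 (𝔻S_y) (𝔻S) S_y / S²)` on `V`. -/
def SusySEquation (V : Set (ℝ × ℝ)) (S : SField N) : Prop := ∀ q ∈ V,
  dT S q = (1 / 16 : ℝ) • ((4 : ℝ) • dX (dX (dX S)) q
    - (12 : ℝ) • (dX (dX S) q * dX S q * gPow (S q) (-1))
    + (6 : ℝ) • (dX S q ^ 3 * gPow (S q) (-2))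
    - (3 : ℝ) • (sD (dX S) q * sD S q * dX S q * gPow (S q) (-2)))

/-- Right-hand side `¼ (Λ_{3y} - 3 Λ_{2y} (𝔻Λ_y) / (𝔻Λ))` of the supersymmetric Schwarzian KdV
equation. -/
def schwarzianRHS (L : SField N) : SField N := fun q =>
  (1 / 4 : ℝ) • (dX (dX (dX L)) q
    - (3 : ℝ) • (dX (dX L) q * sD (dX L) q * gPow (sD L q) (-1)))

/-- The supersymmetric Schwarzian KdV equation on `V`. -/
def SusySchwarzianKdV (V : Set (ℝ × ℝ)) (L : SField N) : Prop := ∀ q ∈ V,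
  dT L q = schwarzianRHS L q

/-- `-¼ U_{2x} U + ⅛ U_x² + ¼ (𝒟U_x) (𝒟U)`, the coefficient of `∂_y` in `∂_t`, in old variables. -/
def coefY (U : SField N) : SField N := fun p =>
  -((1 / 4 : ℝ) • (dX (dX U) p * U p)) + (1 / 8 : ℝ) • dX U p ^ 2
    + (1 / 4 : ℝ) • (sD (dX U) p * sD U p)

/-- `-⅛ (𝒟U_{2x}) U^{3/2}`, the coefficient of `𝔻` in `∂_t`, in old variables. -/
def coefD (U : SField N) : SField N := fun p =>
  -((1 / 8 : ℝ) • (sD (dX (dX U)) p * gPow (U p) (3 / 2)))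

/-- `⅛ (-2 S_{2y}/S + 3 S_y²/S² + (𝔻S_y)(𝔻S)/S²)`, the coefficient of `∂_y` in `∂_t`, in new
variables. -/
def coefY' (S : SField N) : SField N := fun q =>
  (1 / 8 : ℝ) • (-((2 : ℝ) • (dX (dX S) q * gPow (S q) (-1)))
    + (3 : ℝ) • (dX S q ^ 2 * gPow (S q) (-2))
    + sD (dX S) q * sD S q * gPow (S q) (-2))

/-- `(1/16) (-2 (𝔻S_{2y})/S + 5 (𝔻S_y) S_y/S² + 3 (𝔻S) S_{2y}/S² - 6 (𝔻S) S_y²/S³)`, the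
coefficient of `𝔻` in `∂_t`, in new variables. -/
def coefD' (S : SField N) : SField N := fun q =>
  (1 / 16 : ℝ) • (-((2 : ℝ) • (sD (dX (dX S)) q * gPow (S q) (-1)))
    + (5 : ℝ) • (sD (dX S) q * dX S q * gPow (S q) (-2))
    + (3 : ℝ) • (sD S q * dX (dX S) q * gPow (S q) (-2))
    - (6 : ℝ) • (sD S q * dX S q ^ 2 * gPow (S q) (-3)))

/-- The reciprocal transformation attached to `U` over `Ω`: an invertible change of variables for
which, as operators on all smooth superfields `F` of the new variables,
`𝒟 = U^{-1/2} 𝔻` and `∂_t = ∂_τ + coefY U ∂_y + coefD U 𝔻`. -/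
structure IsReciprocal (Ω : Set (ℝ × ℝ)) (U Y R : SField N) : Prop
    extends IsSuperChange Ω Y R where
  liouville : ∀ F : SField N, ContDiffOn ℝ ∞ F (bodyMap Y '' Ω) → ∀ p ∈ Ω,
    sD (pull Y R F) p = gPow (U p) (-1 / 2) * pull Y R (sD F) p
  time : ∀ F : SField N, ContDiffOn ℝ ∞ F (bodyMap Y '' Ω) → ∀ p ∈ Ω,
    dT (pull Y R F) p = pull Y R (dT F) p + coefY U p * pull Y R (dX F) p
      + coefD U p * pull Y R (sD F) p

end SusyHD

end

/-!
The proof separates the algebra of superfields from their analysis.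

*Algebra.*  The smooth superfields over an open set form a supercommutative algebra with an odd
derivation `D` (the superderivative, with `D² = ∂_y`) and a commuting even derivation `T` (the time
derivative); this is the class `SuperDiffAlg`.  All identities between the equations are proved in
such an algebra.  The key is to pass to the logarithm `l = log S` (`IsLog`), which makes every
equation polynomial.  The coefficient of `∂_y` in the transformed time derivative becomes
`a(l) = ⅛ (-2 l_yy + l_y² + (D l_y)(D l))`, and that of `D` is `½ D a(l)`.  For a solution `U` of the
Harry Dym equation, `w = U^{-1/2}` is a conserved density, `T w = D(coefD U)` (`IsHarryDym.T_w`).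
Transported to the new variables, this law is an evolution equation for `S^{-1/2}`, and division by
`S^{-1/2}` turns it into the equation for `l` that is equivalent to `(*)` for `S`
(`IsTransformation.log_equation`, `IsLog.sEquation_iff`).  Differentiation of the equation for `l`
gives the MKdV equation for `-D l` (`IsLog.mkdv`).  If `S = (D Λ)⁻²`, then `l = -2 log (D Λ)`, and the
same equation for `l` is the superderivative of the Schwarzian equation for `Λ`
(`IsLog.schwarzian_iff`).

*Substitution.*  A change of variables acts on superfields by a Taylor expansion around the body,
which is multiplicative and obeys the chain rule (`pull_mul`, `dDir_pull`, `dTheta_pull`).  It is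
bijective on smooth superfields (`IsSuperChange.pull_injective`, `IsSuperChange.exists_pull_eq`):
along the filtration by the number of generators its leading term is composition with the
underlying map, a diffeomorphism onto its open image, followed by an invertible substitution for the
odd variable.  So identities between superfields may be checked in either set of variables.

*Integration.*  Over a convex domain the system `D f = h`, `T f = g` is solvable as soon as
`D g = T h` (`exists_sD_eq_dT_eq`).  Applied to `ϱ` with `D ϱ = w`, `ϱ_t = coefD U`, and then to `y` with
`D y = w ϱ`, `y_t = coefY U + coefD U ϱ`, this gives the reciprocal transformation.  Applied to
`λ` with `D λ = w²` in the old variables, it gives the potential `Λ` with `D Λ = S^{-1/2}` as the image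
of `λ` in the new ones.
-/

noncomputable section

namespace SusyHD

variable {N : ℕ}

/-! ### The Grassmann algebra -/

/-- The grade involution: the identity on even and minus the identity on odd elements. -/
def gradeInv (N : ℕ) : Gr N →ₐ[ℝ] Gr N := CliffordAlgebra.involute

/-- The body as an algebra homomorphism. -/
def bodyHom (N : ℕ) : Gr N →ₐ[ℝ] ℝ := ExteriorAlgebra.algebraMapInv

theorem body_eq (a : Gr N) : body a = bodyHom N a := rfl

/-- The derivative with respect to the odd coordinate as a linear map. -/
def dThetaL (N : ℕ) : Gr N →ₗ[ℝ] Gr N :=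
  CliffordAlgebra.contractLeft (Q := (0 : QuadraticForm ℝ (Fin (N + 1) → ℝ)))
    (LinearMap.proj 0 : (Fin (N + 1) → ℝ) →ₗ[ℝ] ℝ)

theorem dTheta_eq (a : Gr N) : dTheta a = dThetaL N a := rfl

@[simp] theorem gradeInv_gradeInv (a : Gr N) : gradeInv N (gradeInv N a) = a :=
  CliffordAlgebra.involute_involute a

@[simp] theorem gradeInv_ι (v : Fin (N + 1) → ℝ) :
    gradeInv N (ExteriorAlgebra.ι ℝ v) = -ExteriorAlgebra.ι ℝ v :=
  CliffordAlgebra.involute_ι v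

@[simp] theorem bodyHom_ι (v : Fin (N + 1) → ℝ) : bodyHom N (ExteriorAlgebra.ι ℝ v) = 0 := by
  simp [bodyHom, ExteriorAlgebra.algebraMapInv]

@[simp] theorem gradeInv_theta : gradeInv N theta = -theta := gradeInv_ι _

@[simp] theorem bodyHom_theta : bodyHom N theta = 0 := bodyHom_ι _

/-- Induction on elements of the Grassmann algebra by left multiplication with generators. -/
theorem gr_induction {P : Gr N → Prop} (h0 : ∀ r : ℝ, P (algebraMap ℝ (Gr N) r))
    (hadd : ∀ a b, P a → P b → P (a + b))
    (hmul : ∀ v a, P a → P (ExteriorAlgebra.ι ℝ v * a)) (a : Gr N) : P a :=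
  CliffordAlgebra.left_induction (Q := (0 : QuadraticForm ℝ (Fin (N + 1) → ℝ))) h0 hadd
    (fun x m hx => hmul m x hx) a

theorem ι_mul_comm (v : Fin (N + 1) → ℝ) (a : Gr N) :
    ExteriorAlgebra.ι ℝ v * a = gradeInv N a * ExteriorAlgebra.ι ℝ v := by
  induction a using gr_induction with
  | h0 r => rw [AlgHom.commutes, Algebra.commutes]
  | hadd a b ha hb => rw [mul_add, map_add, add_mul, ha, hb]
  | hmul w a ha =>
    have h : ExteriorAlgebra.ι ℝ v * ExteriorAlgebra.ι ℝ w
        = -(ExteriorAlgebra.ι ℝ w * ExteriorAlgebra.ι ℝ v) :=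
      eq_neg_of_add_eq_zero_left (ExteriorAlgebra.ι_add_mul_swap v w)
    rw [← mul_assoc, h, neg_mul, mul_assoc, ha, map_mul, gradeInv_ι, neg_mul, neg_mul, mul_assoc]

/-- Twice the even and twice the odd part of an element. -/
theorem isEven_add_gradeInv_and_isOdd_sub_gradeInv (b : Gr N) :
    IsEven (b + gradeInv N b) ∧ IsOdd (b - gradeInv N b) := by
  induction b using gr_induction with
  | h0 r =>
    rw [AlgHom.commutes, sub_self]
    exact ⟨Submodule.add_mem _ (SetLike.algebraMap_mem_graded _ _)
      (SetLike.algebraMap_mem_graded _ _), Submodule.zero_mem _⟩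
  | hadd a b ha hb =>
    rw [map_add, add_add_add_comm, add_sub_add_comm]
    exact ⟨Submodule.add_mem _ ha.1 hb.1, Submodule.add_mem _ ha.2 hb.2⟩
  | hmul v b hb =>
    rw [map_mul, gradeInv_ι, neg_mul, ← sub_eq_add_neg, sub_neg_eq_add, ← mul_sub, ← mul_add]
    have hv := CliffordAlgebra.ι_mem_evenOdd_one (0 : QuadraticForm ℝ (Fin (N + 1) → ℝ)) v
    exact ⟨(SetLike.mul_mem_graded hv hb.2 : _ ∈ CliffordAlgebra.evenOdd _ (1 + 1)),
      (SetLike.mul_mem_graded hv hb.1 : _ ∈ CliffordAlgebra.evenOdd _ (1 + 0))⟩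

theorem isEven_iff {a : Gr N} : IsEven a ↔ gradeInv N a = a := by
  refine ⟨fun h => CliffordAlgebra.involute_eq_of_mem_even h, fun h => ?_⟩
  have h2 := (isEven_add_gradeInv_and_isOdd_sub_gradeInv a).1
  rw [h, ← two_smul ℝ] at h2
  have := Submodule.smul_mem _ (2⁻¹ : ℝ) h2
  rwa [inv_smul_smul₀ two_ne_zero] at this

theorem isOdd_iff {a : Gr N} : IsOdd a ↔ gradeInv N a = -a := by
  refine ⟨fun h => CliffordAlgebra.involute_eq_of_mem_odd h, fun h => ?_⟩
  have h2 := (isEven_add_gradeInv_and_isOdd_sub_gradeInv a).2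
  rw [h, sub_neg_eq_add, ← two_smul ℝ] at h2
  have := Submodule.smul_mem _ (2⁻¹ : ℝ) h2
  rwa [inv_smul_smul₀ two_ne_zero] at this

/-- Even elements are central. -/
theorem IsEven.comm {a : Gr N} (ha : IsEven a) (b : Gr N) : a * b = b * a := by
  revert b
  refine CliffordAlgebra.even_induction (Q := (0 : QuadraticForm ℝ (Fin (N + 1) → ℝ)))
    (motive := fun a _ => ∀ b : Gr N, a * b = b * a) ?_ ?_ ?_ a ha
  · exact fun r b => Algebra.commutes r b
  · intro x y _ _ hx hy b
    rw [add_mul, mul_add, hx, hy]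
  · intro v w x _ hx b
    have hv := ι_mul_comm (N := N) v
    have hw := ι_mul_comm (N := N) w
    change ExteriorAlgebra.ι ℝ v * ExteriorAlgebra.ι ℝ w * x * b
      = b * (ExteriorAlgebra.ι ℝ v * ExteriorAlgebra.ι ℝ w * x)
    rw [mul_assoc _ x b, hx, ← mul_assoc, mul_assoc _ _ b, hw, ← mul_assoc, hv, gradeInv_gradeInv,
      mul_assoc, mul_assoc, mul_assoc]

/-- Moving an odd element past an arbitrary one applies the grade involution to the latter. -/
theorem IsOdd.mul_comm {a : Gr N} (ha : IsOdd a) (b : Gr N) : a * b = gradeInv N b * a := by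
  revert b
  refine CliffordAlgebra.odd_induction (Q := (0 : QuadraticForm ℝ (Fin (N + 1) → ℝ)))
    (P := fun a _ => ∀ b : Gr N, a * b = gradeInv N b * a) ?_ ?_ ?_ a ha
  · exact fun v b => ι_mul_comm v b
  · intro x y _ _ hx hy b
    rw [add_mul, mul_add, hx, hy]
  · intro v w x _ hx b
    have hv := ι_mul_comm (N := N) v
    have hw := ι_mul_comm (N := N) w
    change ExteriorAlgebra.ι ℝ v * ExteriorAlgebra.ι ℝ w * x * b
      = gradeInv N b * (ExteriorAlgebra.ι ℝ v * ExteriorAlgebra.ι ℝ w * x)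
    rw [mul_assoc _ x b, hx, ← mul_assoc, mul_assoc _ _ (gradeInv N b), hw, ← mul_assoc, hv,
      gradeInv_gradeInv, mul_assoc, mul_assoc, mul_assoc]

theorem IsOdd.anticomm {a b : Gr N} (ha : IsOdd a) (hb : IsOdd b) : a * b = -(b * a) := by
  rw [ha.mul_comm, isOdd_iff.1 hb, neg_mul]

theorem IsOdd.mul_self {a : Gr N} (ha : IsOdd a) : a * a = 0 := by
  have h : (2 : ℝ) • (a * a) = 0 := by
    rw [two_smul]; nth_rw 1 [ha.anticomm ha]; exact neg_add_cancel _
  exact (smul_eq_zero.1 h).resolve_left two_ne_zero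

theorem isOdd_theta : IsOdd (theta : Gr N) := isOdd_iff.2 gradeInv_theta

@[simp] theorem theta_mul_theta : (theta : Gr N) * theta = 0 := isOdd_theta.mul_self

@[simp] theorem dTheta_theta : dTheta (theta : Gr N) = 1 := by
  have := CliffordAlgebra.contractLeft_ι (0 : QuadraticForm ℝ (Fin (N + 1) → ℝ))
    (LinearMap.proj 0 : (Fin (N + 1) → ℝ) →ₗ[ℝ] ℝ) (Pi.single 0 1)
  simp only [LinearMap.proj_apply, Pi.single_eq_same, map_one] at this
  exact this

@[simp] theorem dTheta_algebraMap (r : ℝ) : dTheta (algebraMap ℝ (Gr N) r) = 0 :=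
  CliffordAlgebra.contractLeft_algebraMap _ _ r

@[simp] theorem dTheta_one : dTheta (1 : Gr N) = 0 := by simpa using dTheta_algebraMap (N := N) 1

@[simp] theorem dTheta_dTheta (a : Gr N) : dTheta (dTheta a) = 0 :=
  CliffordAlgebra.contractLeft_contractLeft _ a

theorem dTheta_ι_mul (v : Fin (N + 1) → ℝ) (a : Gr N) :
    dTheta (ExteriorAlgebra.ι ℝ v * a) = v 0 • a - ExteriorAlgebra.ι ℝ v * dTheta a :=
  CliffordAlgebra.contractLeft_ι_mul _ v a

theorem dTheta_add (a b : Gr N) : dTheta (a + b) = dTheta a + dTheta b := (dThetaL N).map_add a b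
theorem dTheta_sub (a b : Gr N) : dTheta (a - b) = dTheta a - dTheta b := (dThetaL N).map_sub a b
theorem dTheta_neg (a : Gr N) : dTheta (-a) = -dTheta a := (dThetaL N).map_neg a
theorem dTheta_smul (r : ℝ) (a : Gr N) : dTheta (r • a) = r • dTheta a := (dThetaL N).map_smul r a
@[simp] theorem dTheta_zero : dTheta (0 : Gr N) = 0 := (dThetaL N).map_zero

/-- `∂_θ` is an odd derivation. -/
theorem dTheta_mul (a b : Gr N) :
    dTheta (a * b) = dTheta a * b + gradeInv N a * dTheta b := by
  induction a using gr_induction with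
  | h0 r => rw [AlgHom.commutes, dTheta_algebraMap, zero_mul, zero_add, ← Algebra.smul_def,
      ← Algebra.smul_def, dTheta_smul]
  | hadd x y hx hy => simp only [add_mul, dTheta_add, map_add, hx, hy]; abel
  | hmul v x hx =>
    rw [mul_assoc, dTheta_ι_mul, hx, dTheta_ι_mul, map_mul, gradeInv_ι, mul_add, sub_mul,
      smul_mul_assoc]
    simp only [neg_mul, mul_assoc]
    abel

theorem gradeInv_dTheta (a : Gr N) : gradeInv N (dTheta a) = -dTheta (gradeInv N a) := by
  induction a using gr_induction with
  | h0 r => simp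
  | hadd x y hx hy => simp only [map_add, dTheta_add, hx, hy]; abel
  | hmul v x hx =>
    rw [dTheta_ι_mul, map_mul, gradeInv_ι, neg_mul, dTheta_neg, dTheta_ι_mul, map_sub, map_smul,
      map_mul, hx, gradeInv_ι]
    simp

theorem IsOdd.dTheta {a : Gr N} (ha : IsOdd a) : IsEven (dTheta a) := by
  rw [isEven_iff, gradeInv_dTheta, isOdd_iff.1 ha, dTheta_neg, neg_neg]

theorem isEven_algebraMap (r : ℝ) : IsEven (algebraMap ℝ (Gr N) r) := by
  rw [isEven_iff, AlgHom.commutes]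

theorem IsEven.sub {a b : Gr N} (ha : IsEven a) (hb : IsEven b) : IsEven (a - b) :=
  Submodule.sub_mem _ ha hb
theorem IsEven.smul {a : Gr N} (ha : IsEven a) (r : ℝ) : IsEven (r • a) :=
  Submodule.smul_mem _ r ha
theorem IsEven.pow {a : Gr N} (ha : IsEven a) (k : ℕ) : IsEven (a ^ k) := by
  rw [isEven_iff, map_pow, isEven_iff.1 ha]
theorem IsOdd.add {a b : Gr N} (ha : IsOdd a) (hb : IsOdd b) : IsOdd (a + b) :=
  Submodule.add_mem _ ha hb
theorem IsOdd.sub {a b : Gr N} (ha : IsOdd a) (hb : IsOdd b) : IsOdd (a - b) :=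
  Submodule.sub_mem _ ha hb
theorem IsOdd.mul_even {a b : Gr N} (ha : IsOdd a) (hb : IsEven b) : IsOdd (a * b) := by
  rw [isOdd_iff, map_mul, isOdd_iff.1 ha, isEven_iff.1 hb, neg_mul]

/-! ### The filtration by powers of the ideal of nilpotent elements -/

/-- The linear span of products with at least `k` generators. -/
def nilFil (N k : ℕ) : Submodule ℝ (Gr N) :=
  LinearMap.range (ExteriorAlgebra.ι ℝ : (Fin (N + 1) → ℝ) →ₗ[ℝ] Gr N) ^ k * ⊤

theorem nilFil_zero : nilFil N 0 = ⊤ := by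
  rw [nilFil, pow_zero, one_mul]

/-- There are only `N + 1` generators, so longer products vanish. -/
theorem nilFil_eq_bot {k : ℕ} (hk : N + 2 ≤ k) : nilFil N k = ⊥ := by
  have h : LinearMap.range (ExteriorAlgebra.ι ℝ : (Fin (N + 1) → ℝ) →ₗ[ℝ] Gr N) ^ k = ⊥ := by
    rw [← Submodule.finrank_eq_zero (R := ℝ)]
    have := exteriorPower.finrank_eq (R := ℝ) (M := Fin (N + 1) → ℝ) (n := k)
    rw [Module.finrank_fin_fun, Nat.choose_eq_zero_of_lt (by omega)] at this
    exact this
  rw [nilFil, h, Submodule.bot_mul]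

theorem nilFil_succ (k : ℕ) :
    nilFil N (k + 1)
      = LinearMap.range (ExteriorAlgebra.ι ℝ : (Fin (N + 1) → ℝ) →ₗ[ℝ] Gr N) * nilFil N k := by
  rw [nilFil, nilFil, pow_succ', mul_assoc]

theorem ι_mul_mem_nilFil {k : ℕ} {a : Gr N} (v : Fin (N + 1) → ℝ) (ha : a ∈ nilFil N k) :
    ExteriorAlgebra.ι ℝ v * a ∈ nilFil N (k + 1) := by
  rw [nilFil_succ]
  exact Submodule.mul_mem_mul ⟨v, rfl⟩ ha

@[elab_as_elim]
theorem nilFil_induction {k : ℕ} {P : ∀ a, a ∈ nilFil N (k + 1) → Prop}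
    (hadd : ∀ a b ha hb, P a ha → P b hb → P (a + b) (Submodule.add_mem _ ha hb))
    (hmul : ∀ v a, ∀ ha : a ∈ nilFil N k, P (ExteriorAlgebra.ι ℝ v * a) (ι_mul_mem_nilFil v ha))
    {a : Gr N} (ha : a ∈ nilFil N (k + 1)) : P a ha := by
  have ha' := ha
  rw [nilFil_succ] at ha'
  suffices h : ∃ h, P a h from h.2
  induction ha' using Submodule.mul_induction_on' with
  | mem_mul_mem x hx y hy => obtain ⟨v, rfl⟩ := hx; exact ⟨_, hmul v y hy⟩
  | add x hx y hy h1 h2 =>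
    rw [← nilFil_succ] at hx hy
    exact ⟨_, hadd x y _ _ (h1 hx).2 (h2 hy).2⟩

theorem mul_mem_nilFil_left {k : ℕ} {a : Gr N} (b : Gr N) (ha : a ∈ nilFil N k) :
    b * a ∈ nilFil N k := by
  induction k generalizing a b with
  | zero => rw [nilFil_zero]; trivial
  | succ k ih =>
    induction ha using nilFil_induction with
    | hadd a b _ _ ha hb => rw [mul_add]; exact Submodule.add_mem _ ha hb
    | hmul v a ha =>
      have : b * ExteriorAlgebra.ι ℝ v = ExteriorAlgebra.ι ℝ v * gradeInv N b := by
        rw [ι_mul_comm, gradeInv_gradeInv]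
      rw [← mul_assoc, this, mul_assoc]
      exact ι_mul_mem_nilFil v (ih _ ha)

theorem mul_mem_nilFil {k l : ℕ} {a b : Gr N} (ha : a ∈ nilFil N k) (hb : b ∈ nilFil N l) :
    a * b ∈ nilFil N (k + l) := by
  induction k generalizing a with
  | zero => rw [zero_add]; exact mul_mem_nilFil_left a hb
  | succ k ih =>
    induction ha using nilFil_induction with
    | hadd a b _ _ ha hb => rw [add_mul]; exact Submodule.add_mem _ ha hb
    | hmul v a ha => rw [mul_assoc, add_right_comm]; exact ι_mul_mem_nilFil v (ih ha)

theorem nilFil_antitone : Antitone (nilFil N) := by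
  refine antitone_nat_of_succ_le fun k a ha => ?_
  induction ha using nilFil_induction with
  | hadd a b _ _ ha hb => exact Submodule.add_mem _ ha hb
  | hmul v a ha => exact mul_mem_nilFil_left _ ha

theorem pow_mem_nilFil {k : ℕ} {a : Gr N} (ha : a ∈ nilFil N k) (n : ℕ) :
    a ^ n ∈ nilFil N (k * n) := by
  induction n with
  | zero => rw [mul_zero, nilFil_zero]; trivial
  | succ n ih => rw [pow_succ, Nat.mul_succ]; exact mul_mem_nilFil ih ha

/-- Differentiation removes at most one generator. -/
theorem dTheta_mem_nilFil {k : ℕ} {a : Gr N} (ha : a ∈ nilFil N (k + 1)) :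
    dTheta a ∈ nilFil N k := by
  induction k generalizing a with
  | zero => rw [nilFil_zero]; trivial
  | succ k ih =>
    induction ha using nilFil_induction with
    | hadd a b _ _ ha hb => rw [dTheta_add]; exact Submodule.add_mem _ ha hb
    | hmul v a ha =>
      rw [dTheta_ι_mul]
      exact Submodule.sub_mem _ (Submodule.smul_mem _ _ ha) (ι_mul_mem_nilFil v (ih ha))

theorem soul_mem_nilFil (a : Gr N) : soul a ∈ nilFil N 1 := by
  induction a using gr_induction with
  | h0 r => simp [soul, body_eq]
  | hadd a b ha hb =>
    have : soul (a + b) = soul a + soul b := by simp only [soul, body_eq, map_add]; abel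
    rw [this]; exact Submodule.add_mem _ ha hb
  | hmul v a _ =>
    have : soul (ExteriorAlgebra.ι ℝ v * a) = ExteriorAlgebra.ι ℝ v * a := by
      simp [soul, body_eq]
    rw [this]
    exact ι_mul_mem_nilFil v (by rw [nilFil_zero]; trivial)

/-- The soul of an even element consists of products of at least two generators.  Hence each further
term of a Taylor expansion around the body raises the filtration by two. -/
theorem IsEven.soul_mem_nilFil {a : Gr N} (ha : IsEven a) : soul a ∈ nilFil N 2 := by
  refine CliffordAlgebra.even_induction (Q := (0 : QuadraticForm ℝ (Fin (N + 1) → ℝ)))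
    (motive := fun (a : Gr N) _ => soul a ∈ nilFil N 2) ?_ ?_ ?_ a ha
  · intro r
    have : soul (algebraMap ℝ (Gr N) r) = 0 := by simp [soul, body_eq]
    exact this ▸ Submodule.zero_mem _
  · intro a b _ _ ha hb
    have : soul (a + b) = soul a + soul b := by simp only [soul, body_eq, map_add]; abel
    rw [this]; exact Submodule.add_mem _ ha hb
  · intro v w a _ _
    change soul (ExteriorAlgebra.ι ℝ v * ExteriorAlgebra.ι ℝ w * a : Gr N) ∈ _
    have : soul (ExteriorAlgebra.ι ℝ v * ExteriorAlgebra.ι ℝ w * a)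
        = ExteriorAlgebra.ι ℝ v * (ExteriorAlgebra.ι ℝ w * a) := by
      simp [soul, body_eq, mul_assoc]
    rw [this]
    exact ι_mul_mem_nilFil v (ι_mul_mem_nilFil w (by rw [nilFil_zero]; trivial))

theorem IsOdd.mem_nilFil {a : Gr N} (ha : IsOdd a) : a ∈ nilFil N 1 := by
  refine CliffordAlgebra.odd_induction (Q := (0 : QuadraticForm ℝ (Fin (N + 1) → ℝ)))
    (P := fun (a : Gr N) _ => a ∈ nilFil N 1) ?_ ?_ ?_ a ha
  · intro v
    have := ι_mul_mem_nilFil (k := 0) (a := (1 : Gr N)) v (by rw [nilFil_zero]; trivial)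
    rwa [mul_one] at this
  · exact fun a b _ _ ha hb => Submodule.add_mem _ ha hb
  · exact fun v w a _ ha => mul_mem_nilFil_left _ ha

theorem IsOdd.bodyHom_eq_zero {a : Gr N} (ha : IsOdd a) : bodyHom N a = 0 := by
  refine nilFil_induction (k := 0) (P := fun a _ => bodyHom N a = 0) ?_ ?_ ha.mem_nilFil
  · intro a b _ _ ha hb
    rw [map_add, ha, hb, add_zero]
  · intro v a _
    rw [map_mul, bodyHom_ι, zero_mul]

theorem isEven_soul {a : Gr N} (ha : IsEven a) : IsEven (soul a) := ha.sub (isEven_algebraMap _)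

theorem IsEven.soul_pow_eq_zero {a : Gr N} (ha : IsEven a) : soul a ^ (N + 1) = 0 := by
  have := pow_mem_nilFil ha.soul_mem_nilFil (N + 1)
  rwa [nilFil_eq_bot (by omega), Submodule.mem_bot] at this

@[simp] theorem bodyHom_soul (a : Gr N) : bodyHom N (soul a) = 0 := by
  simp [soul, body_eq]

theorem body_add_soul (a : Gr N) : algebraMap ℝ (Gr N) (body a) + soul a = a :=
  add_sub_cancel _ _

/-- An element with nonzero body is a unit, since its soul is nilpotent. -/
theorem isUnit_of_body_ne_zero {a : Gr N} (ha : body a ≠ 0) : IsUnit a := by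
  rw [← body_add_soul a]
  refine IsNilpotent.isUnit_add_left_of_commute ⟨N + 2, ?_⟩ ((isUnit_iff_ne_zero.2 ha).map _)
    (Algebra.commutes _ _).symm
  have := pow_mem_nilFil (soul_mem_nilFil a) (N + 2)
  rwa [nilFil_eq_bot (by omega), Submodule.mem_bot] at this

/-! ### Substitution for the odd coordinate -/

theorem substTheta_add (r a b : Gr N) : substTheta r (a + b) = substTheta r a + substTheta r b := by
  simp only [substTheta, dTheta_add, mul_add]; abel

theorem substTheta_smul (r a : Gr N) (c : ℝ) : substTheta r (c • a) = c • substTheta r a := by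
  simp only [substTheta, dTheta_smul, mul_smul_comm, smul_add]

/-- Substitution of an odd element for the odd coordinate is multiplicative. -/
theorem substTheta_mul {r : Gr N} (hr : IsOdd r) (a b : Gr N) :
    substTheta r (a * b) = substTheta r a * substTheta r b := by
  have hd : IsOdd (r - theta) := hr.sub isOdd_theta
  simp only [substTheta, dTheta_mul]
  have h1 : a * ((r - theta) * dTheta b) = (r - theta) * (gradeInv N a * dTheta b) := by
    rw [← mul_assoc, ← mul_assoc, hd.mul_comm, gradeInv_gradeInv]
  have h2 : (r - theta) * dTheta a * ((r - theta) * dTheta b) = 0 := by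
    rw [hd.mul_comm, mul_assoc, ← mul_assoc (r - theta), hd.mul_self, zero_mul, mul_zero]
  rw [add_mul a, mul_add a, mul_add _ b, h1, h2]
  simp only [mul_add, mul_assoc, add_zero]
  abel

/-- `dTheta a` does not contain the odd coordinate. -/
theorem substTheta_dTheta (r a : Gr N) : substTheta r (dTheta a) = dTheta a := by
  simp [substTheta]

theorem substTheta_theta (r : Gr N) : substTheta r theta = r := by simp [substTheta]

theorem dTheta_substTheta (r a : Gr N) :
    dTheta (substTheta r a) = dTheta r * dTheta a := by
  rw [substTheta, dTheta_add, dTheta_mul, dTheta_dTheta, dTheta_sub, dTheta_theta, sub_mul]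
  simp

theorem gradeInv_substTheta {r : Gr N} (hr : IsOdd r) (a : Gr N) :
    gradeInv N (substTheta r a) = substTheta r (gradeInv N a) := by
  simp only [substTheta, map_add, map_mul, map_sub, isOdd_iff.1 hr, gradeInv_theta,
    gradeInv_dTheta]
  simp only [sub_neg_eq_add, neg_add_eq_sub, mul_neg, ← neg_mul, neg_sub]

theorem substTheta_mem_nilFil {r : Gr N} (hr : IsOdd r) {k : ℕ} {a : Gr N} (ha : a ∈ nilFil N k) :
    substTheta r a ∈ nilFil N k := by
  refine Submodule.add_mem _ ha ?_
  rcases k with _ | k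
  · rw [nilFil_zero]; trivial
  · have := mul_mem_nilFil (hr.sub isOdd_theta).mem_nilFil (dTheta_mem_nilFil ha)
    rwa [add_comm 1] at this

theorem bodyHom_substTheta {r : Gr N} (hr : IsOdd r) (a : Gr N) :
    bodyHom N (substTheta r a) = bodyHom N a := by
  rw [substTheta, map_add, map_mul, (hr.sub isOdd_theta).bodyHom_eq_zero, zero_mul, add_zero]

/-! ### Derivatives of superfields -/

/-- The derivative of a superfield in a direction of the even variables. -/
def dDir (v : ℝ × ℝ) (F : SField N) : SField N := fun p => fderiv ℝ F p v

theorem dX_eq_dDir : (dX : SField N → SField N) = dDir (1, 0) := rfl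

theorem dT_eq_dDir : (dT : SField N → SField N) = dDir (0, 1) := rfl

section
variable {V : Set (ℝ × ℝ)} {F G : SField N} {q : ℝ × ℝ}

theorem diffAt (hV : IsOpen V) (hF : ContDiffOn ℝ ∞ F V) (hq : q ∈ V) :
    DifferentiableAt ℝ F q :=
  (hF.contDiffAt (hV.mem_nhds hq)).differentiableAt (by simp)

theorem contDiffOn_dDir (hV : IsOpen V) (hF : ContDiffOn ℝ ∞ F V) (v : ℝ × ℝ) :
    ContDiffOn ℝ ∞ (dDir v F) V :=
  (hF.fderiv_of_isOpen hV (by simp)).clm_apply contDiffOn_const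

theorem contDiffOn_dX (hV : IsOpen V) (hF : ContDiffOn ℝ ∞ F V) : ContDiffOn ℝ ∞ (dX F) V :=
  contDiffOn_dDir hV hF (1, 0)

theorem contDiffOn_dT (hV : IsOpen V) (hF : ContDiffOn ℝ ∞ F V) : ContDiffOn ℝ ∞ (dT F) V :=
  contDiffOn_dDir hV hF (0, 1)

theorem contDiffOn_linear {E E' : Type*} [NormedAddCommGroup E] [NormedSpace ℝ E]
    [NormedAddCommGroup E'] [NormedSpace ℝ E'] {s : Set E'} {F : E' → Gr N}
    (l : Gr N →ₗ[ℝ] E) (hF : ContDiffOn ℝ ∞ F s) : ContDiffOn ℝ ∞ (fun q => l (F q)) s :=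
  (LinearMap.toContinuousLinearMap l).contDiff.comp_contDiffOn hF

theorem contDiffOn_dTheta (hF : ContDiffOn ℝ ∞ F V) : ContDiffOn ℝ ∞ (fun q => dTheta (F q)) V :=
  contDiffOn_linear (dThetaL N) hF

theorem contDiffOn_gradeInv (hF : ContDiffOn ℝ ∞ F V) :
    ContDiffOn ℝ ∞ (fun q => gradeInv N (F q)) V :=
  contDiffOn_linear (gradeInv N).toLinearMap hF

theorem contDiffOn_body (hF : ContDiffOn ℝ ∞ F V) : ContDiffOn ℝ ∞ (fun q => body (F q)) V :=
  contDiffOn_linear (bodyHom N).toLinearMap hF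

theorem contDiffOn_soul (hF : ContDiffOn ℝ ∞ F V) : ContDiffOn ℝ ∞ (fun q => soul (F q)) V :=
  contDiffOn_linear (LinearMap.id - (Algebra.linearMap ℝ (Gr N)).comp (bodyHom N).toLinearMap) hF

theorem contDiffOn_sD (hV : IsOpen V) (hF : ContDiffOn ℝ ∞ F V) : ContDiffOn ℝ ∞ (sD F) V :=
  (contDiffOn_dTheta hF).add (contDiffOn_const.mul (contDiffOn_dDir hV hF (1, 0)))

theorem dDir_linear (l : Gr N →ₗ[ℝ] Gr N) (hF : DifferentiableAt ℝ F q) (v : ℝ × ℝ) :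
    dDir v (fun z => l (F z)) q = l (dDir v F q) := by
  have := ((LinearMap.toContinuousLinearMap l).hasFDerivAt.comp q hF.hasFDerivAt).fderiv
  exact congrArg (fun f => f v) this

theorem dDir_dTheta (hF : DifferentiableAt ℝ F q) (v : ℝ × ℝ) :
    dDir v (fun z => dTheta (F z)) q = dTheta (dDir v F q) := dDir_linear (dThetaL N) hF v

theorem dDir_gradeInv (hF : DifferentiableAt ℝ F q) (v : ℝ × ℝ) :
    dDir v (fun z => gradeInv N (F z)) q = gradeInv N (dDir v F q) :=
  dDir_linear (gradeInv N).toLinearMap hF v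

theorem fderiv_body (hF : DifferentiableAt ℝ F q) (v : ℝ × ℝ) :
    fderiv ℝ (fun z => body (F z)) q v = body (dDir v F q) := by
  have := ((LinearMap.toContinuousLinearMap (bodyHom N).toLinearMap).hasFDerivAt.comp q
    hF.hasFDerivAt).fderiv
  exact congrArg (fun f => f v) this

theorem dDir_add (hF : DifferentiableAt ℝ F q) (hG : DifferentiableAt ℝ G q) (v : ℝ × ℝ) :
    dDir v (fun z => F z + G z) q = dDir v F q + dDir v G q := by
  simp only [dDir, fderiv_fun_add hF hG, add_apply]

theorem dDir_smul (c : ℝ) (hF : DifferentiableAt ℝ F q) (v : ℝ × ℝ) :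
    dDir v (fun z => c • F z) q = c • dDir v F q := by
  simp only [dDir, fderiv_fun_const_smul hF, smul_apply]

theorem dDir_mul (hF : DifferentiableAt ℝ F q) (hG : DifferentiableAt ℝ G q) (v : ℝ × ℝ) :
    dDir v (fun z => F z * G z) q = dDir v F q * G q + F q * dDir v G q := by
  simp only [dDir, fderiv_fun_mul' hF hG, add_apply,
    smul_apply, smul_eq_mul, MulOpposite.smul_eq_mul_unop,
    MulOpposite.unop_op]
  rw [add_comm]

theorem dDir_congr (hV : IsOpen V) (h : Set.EqOn F G V) (hq : q ∈ V) (v : ℝ × ℝ) :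
    dDir v F q = dDir v G q := by
  simp only [dDir, (h.eventuallyEq_of_mem (hV.mem_nhds hq)).fderiv_eq]

theorem sD_congr (hV : IsOpen V) (h : Set.EqOn F G V) (hq : q ∈ V) : sD F q = sD G q := by
  simp only [sD, h hq, dX_eq_dDir, dDir_congr hV h hq]

/-- Symmetry of second derivatives. -/
theorem dDir_comm (hV : IsOpen V) (hF : ContDiffOn ℝ ∞ F V) (hq : q ∈ V) (v w : ℝ × ℝ) :
    dDir v (dDir w F) q = dDir w (dDir v F) q := by
  have h2 : ContDiffAt ℝ ∞ F q := hF.contDiffAt (hV.mem_nhds hq)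
  have hs : IsSymmSndFDerivAt ℝ F q := h2.isSymmSndFDerivAt (by
    rw [minSmoothness_of_isRCLikeNormedField]; exact WithTop.coe_le_coe.2 (le_top (a := (2 : ℕ∞))))
  have hd : DifferentiableAt ℝ (fderiv ℝ F) q :=
    (h2.fderiv_right (m := ∞) (by simp)).differentiableAt (by simp)
  have key : ∀ a b : ℝ × ℝ, dDir a (dDir b F) q = fderiv ℝ (fderiv ℝ F) q a b := by
    intro a b
    have := (hd.hasFDerivAt.clm_apply (hasFDerivAt_const b q)).fderiv
    refine (congrArg (fun f => f a) this).trans ?_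
    simp
  rw [key, key, hs]

/-- The superderivative is an odd derivation. -/
theorem sD_mul (hF : DifferentiableAt ℝ F q) (hG : DifferentiableAt ℝ G q) :
    sD (fun z => F z * G z) q = sD F q * G q + gradeInv N (F q) * sD G q := by
  simp only [sD, dX_eq_dDir, dDir_mul hF hG, dTheta_mul, mul_add, add_mul]
  rw [← mul_assoc theta (F q), isOdd_theta.mul_comm (F q)]
  simp only [mul_assoc]
  abel

/-- The superderivative is a square root of the space derivative. -/
theorem sD_sD (hV : IsOpen V) (hF : ContDiffOn ℝ ∞ F V) (hq : q ∈ V) : sD (sD F) q = dX F q := by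
  have h1 := diffAt hV hF hq
  have h2 := diffAt hV (contDiffOn_dTheta hF) hq
  have h3 := diffAt hV (contDiffOn_dDir hV hF (1, 0)) hq
  have h4 : dDir (1, 0) (sD F) q
      = dTheta (dDir (1, 0) F q) + theta * dDir (1, 0) (dDir (1, 0) F) q := by
    have := dDir_add h2 ((differentiableAt_const (theta : Gr N)).mul h3) (1, 0)
    rw [dDir_dTheta h1] at this
    refine this.trans ?_
    have := dDir_mul (differentiableAt_const (theta : Gr N)) h3 (1, 0)
    rw [show dDir (1, 0) (fun _ => (theta : Gr N)) q = 0 by simp [dDir], zero_mul, zero_add] at this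
    exact congrArg _ this
  change dTheta (sD F q) + theta * dDir (1, 0) (sD F) q = _
  rw [h4, mul_add, ← mul_assoc, theta_mul_theta, zero_mul, add_zero]
  simp only [sD, dX_eq_dDir, dTheta_add, dTheta_mul, dTheta_dTheta, dTheta_theta, gradeInv_theta]
  simp

theorem sD_dDir (hV : IsOpen V) (hF : ContDiffOn ℝ ∞ F V) (hq : q ∈ V) (v : ℝ × ℝ) :
    sD (dDir v F) q = dDir v (sD F) q := by
  have h1 := diffAt hV hF hq
  have h2 := diffAt hV (contDiffOn_dTheta hF) hq
  have h3 := diffAt hV (contDiffOn_dDir hV hF (1, 0)) hq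
  have h4 : dDir v (sD F) q
      = dTheta (dDir v F q) + theta * dDir v (dDir (1, 0) F) q := by
    have := dDir_add h2 ((differentiableAt_const (theta : Gr N)).mul h3) v
    rw [dDir_dTheta h1] at this
    refine this.trans ?_
    have := dDir_mul (differentiableAt_const (theta : Gr N)) h3 v
    rw [show dDir v (fun _ => (theta : Gr N)) q = 0 by simp [dDir], zero_mul, zero_add] at this
    exact congrArg _ this
  rw [h4, dDir_comm hV hF hq]
  rfl

theorem gradeInv_sD (hF : DifferentiableAt ℝ F q) :
    gradeInv N (sD F q) = -sD (fun z => gradeInv N (F z)) q := by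
  simp only [sD, dX_eq_dDir, dDir_gradeInv hF, map_add, map_mul, gradeInv_dTheta, gradeInv_theta]
  simp only [neg_mul, neg_add_rev]
  abel

end

/-! ### Super differential algebras -/

/-- A supercommutative algebra with an odd derivation `D` and an even derivation `T` commuting
with it.  The grading is given by the grade involution `inv`.  The space derivative is `D ∘ D`. -/
class SuperDiffAlg (A : Type*) [Ring A] [Algebra ℝ A] where
  inv : A →ₐ[ℝ] A
  D : A →ₗ[ℝ] A
  T : A →ₗ[ℝ] A
  inv_inv : ∀ a, inv (inv a) = a
  D_mul : ∀ a b, D (a * b) = D a * b + inv a * D b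
  T_mul : ∀ a b, T (a * b) = T a * b + a * T b
  inv_D : ∀ a, inv (D a) = -D (inv a)
  inv_T : ∀ a, inv (T a) = T (inv a)
  T_D : ∀ a, T (D a) = D (T a)
  even_comm : ∀ a b, inv a = a → a * b = b * a
  odd_comm : ∀ a b, inv a = -a → a * b = inv b * a

/-- The functions on an open set that are restrictions of superfields smooth there.  Superfields
are functions on the whole plane with arbitrary values outside the set, which the restriction
forgets. -/
def smoothSubalgebra (N : ℕ) (V : TopologicalSpace.Opens (ℝ × ℝ)) : Subalgebra ℝ (V → Gr N) where
  carrier := {f | ∃ F : SField N, ContDiffOn ℝ ∞ F V ∧ ∀ q : V, F q = f q}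
  mul_mem' := by
    rintro f g ⟨F, hF, hf⟩ ⟨G, hG, hg⟩
    exact ⟨fun q => F q * G q, hF.mul hG, fun q => by simp [hf, hg]⟩
  add_mem' := by
    rintro f g ⟨F, hF, hf⟩ ⟨G, hG, hg⟩
    exact ⟨fun q => F q + G q, hF.add hG, fun q => by simp [hf, hg]⟩
  algebraMap_mem' := fun r => ⟨fun _ => algebraMap ℝ (Gr N) r, contDiffOn_const, fun _ => rfl⟩

/-- The algebra of smooth superfields over an open set.  It is a type synonym, so that instances on
functions and subalgebras do not interfere with its own. -/
def SmoothField (N : ℕ) (V : TopologicalSpace.Opens (ℝ × ℝ)) : Type := smoothSubalgebra N V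

instance (V : TopologicalSpace.Opens (ℝ × ℝ)) : Ring (SmoothField N V) :=
  inferInstanceAs (Ring (smoothSubalgebra N V))

instance (V : TopologicalSpace.Opens (ℝ × ℝ)) : Algebra ℝ (SmoothField N V) :=
  inferInstanceAs (Algebra ℝ (smoothSubalgebra N V))

namespace SmoothField
variable {V : TopologicalSpace.Opens (ℝ × ℝ)} {F G : SField N}

/-- The restriction to `V` of a superfield that is smooth there. -/
def res (F : SField N) (hF : ContDiffOn ℝ ∞ F V) : SmoothField N V :=
  ⟨fun q => F q, F, hF, fun _ => rfl⟩

/-- A superfield on the whole plane that restricts to the given one. -/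
def ext (f : SmoothField N V) : SField N := f.2.choose

theorem contDiffOn_ext (f : SmoothField N V) : ContDiffOn ℝ ∞ (ext f) V := f.2.choose_spec.1

theorem ext_apply (f : SmoothField N V) (q : V) : ext f q = f.1 q := f.2.choose_spec.2 q

theorem res_ext (f : SmoothField N V) : res (ext f) (contDiffOn_ext f) = f :=
  Subtype.ext (funext (ext_apply f))

theorem res_eq_res {hF : ContDiffOn ℝ ∞ F V} {hG : ContDiffOn ℝ ∞ G V} :
    res F hF = res G hG ↔ ∀ q ∈ V, F q = G q := by
  refine Subtype.ext_iff.trans ?_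
  rw [funext_iff, Subtype.forall]
  rfl

theorem ext_res (hF : ContDiffOn ℝ ∞ F V) : Set.EqOn (ext (res F hF)) F V := fun q hq =>
  ext_apply (res F hF) ⟨q, hq⟩

theorem res_surj (f : SmoothField N V) : ∃ F hF, f = res F hF := ⟨_, _, (res_ext f).symm⟩

/-- The time derivative on smooth superfields. -/
def T₀ : SmoothField N V → SmoothField N V := fun f =>
  res (dT (ext f)) (contDiffOn_dT V.isOpen (contDiffOn_ext f))

theorem T₀_res (hF : ContDiffOn ℝ ∞ F V) :
    T₀ (res F hF) = res (dT F) (contDiffOn_dT V.isOpen hF) :=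
  res_eq_res.2 fun _ hq => dDir_congr V.isOpen (ext_res hF) hq _

/-- The superderivative on smooth superfields. -/
def D₀ : SmoothField N V → SmoothField N V := fun f =>
  res (sD (ext f)) (contDiffOn_sD V.isOpen (contDiffOn_ext f))

theorem D₀_res (hF : ContDiffOn ℝ ∞ F V) : D₀ (res F hF) = res (sD F) (contDiffOn_sD V.isOpen hF) :=
  res_eq_res.2 fun _ hq => sD_congr V.isOpen (ext_res hF) hq

/-- The grade involution on smooth superfields. -/
def inv₀ : SmoothField N V →ₐ[ℝ] SmoothField N V where
  toFun f := ⟨fun q => gradeInv N (f.1 q), _, contDiffOn_gradeInv (contDiffOn_ext f), fun q => by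
    rw [ext_apply]⟩
  map_one' := Subtype.ext (funext fun _ => map_one (gradeInv N))
  map_zero' := Subtype.ext (funext fun _ => map_zero (gradeInv N))
  map_mul' f g := Subtype.ext (funext fun q => map_mul (gradeInv N) (f.1 q) (g.1 q))
  map_add' f g := Subtype.ext (funext fun q => map_add (gradeInv N) (f.1 q) (g.1 q))
  commutes' r := Subtype.ext (funext fun _ => (gradeInv N).commutes r)

theorem inv₀_apply (f : SmoothField N V) (q : V) : (inv₀ f).1 q = gradeInv N (f.1 q) := rfl

theorem inv₀_inv₀ (f : SmoothField N V) : inv₀ (inv₀ f) = f := by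
  refine Subtype.ext (funext fun q => ?_)
  rw [inv₀_apply, inv₀_apply, gradeInv_gradeInv]

theorem mul_comm_of_inv₀_eq {f g : SmoothField N V} (h : inv₀ f = f) : f * g = g * f := by
  refine Subtype.ext (funext fun q => (isEven_iff.2 ?_).comm (g.1 q))
  rw [← inv₀_apply, h]

theorem mul_comm_of_inv₀_eq_neg {f g : SmoothField N V} (h : inv₀ f = -f) :
    f * g = inv₀ g * f := by
  refine Subtype.ext (funext fun q => (isOdd_iff.2 ?_).mul_comm (g.1 q))
  rw [← inv₀_apply, h]
  rfl

theorem inv₀_res (hF : ContDiffOn ℝ ∞ F V) :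
    inv₀ (res F hF) = res (fun q => gradeInv N (F q)) (contDiffOn_gradeInv hF) :=
  Subtype.ext rfl

theorem res_mul (hF : ContDiffOn ℝ ∞ F V) (hG : ContDiffOn ℝ ∞ G V) :
    res F hF * res G hG = res (fun q => F q * G q) (hF.mul hG) := rfl

theorem res_add (hF : ContDiffOn ℝ ∞ F V) (hG : ContDiffOn ℝ ∞ G V) :
    res F hF + res G hG = res (fun q => F q + G q) (hF.add hG) := rfl

theorem res_neg (hF : ContDiffOn ℝ ∞ F V) : -res F hF = res (fun q => -F q) hF.neg := rfl

theorem res_smul (c : ℝ) (hF : ContDiffOn ℝ ∞ F V) :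
    c • res F hF = res (fun q => c • F q) (hF.const_smul c) := rfl

instance : SuperDiffAlg (SmoothField N V) where
  inv := inv₀
  D :=
    { toFun := D₀
      map_add' := by
        intro f g
        obtain ⟨F, hF, rfl⟩ := res_surj f
        obtain ⟨G, hG, rfl⟩ := res_surj g
        rw [res_add, D₀_res, D₀_res, D₀_res, res_add]
        refine res_eq_res.2 fun q hq => ?_
        simp only [sD, dX_eq_dDir, dDir_add (diffAt V.isOpen hF hq) (diffAt V.isOpen hG hq),
          dTheta_add, mul_add]
        abel
      map_smul' := by
        intro c f
        obtain ⟨F, hF, rfl⟩ := res_surj f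
        rw [res_smul, D₀_res, D₀_res, RingHom.id_apply, res_smul]
        refine res_eq_res.2 fun q hq => ?_
        simp only [sD, dX_eq_dDir, dDir_smul c (diffAt V.isOpen hF hq), dTheta_smul, mul_smul_comm,
          smul_add] }
  T :=
    { toFun := T₀
      map_add' := by
        intro f g
        obtain ⟨F, hF, rfl⟩ := res_surj f
        obtain ⟨G, hG, rfl⟩ := res_surj g
        rw [res_add, T₀_res, T₀_res, T₀_res, res_add]
        exact res_eq_res.2 fun q hq => dDir_add (diffAt V.isOpen hF hq) (diffAt V.isOpen hG hq) _
      map_smul' := by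
        intro c f
        obtain ⟨F, hF, rfl⟩ := res_surj f
        rw [res_smul, T₀_res, T₀_res, RingHom.id_apply, res_smul]
        exact res_eq_res.2 fun q hq => dDir_smul c (diffAt V.isOpen hF hq) _ }
  inv_inv := inv₀_inv₀
  D_mul f g := by
    obtain ⟨F, hF, rfl⟩ := res_surj f
    obtain ⟨G, hG, rfl⟩ := res_surj g
    change D₀ _ = D₀ _ * _ + _ * D₀ _
    rw [res_mul, D₀_res, D₀_res, D₀_res, inv₀_res, res_mul, res_mul, res_add]
    exact res_eq_res.2 fun q hq => sD_mul (diffAt V.isOpen hF hq) (diffAt V.isOpen hG hq)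
  T_mul f g := by
    obtain ⟨F, hF, rfl⟩ := res_surj f
    obtain ⟨G, hG, rfl⟩ := res_surj g
    change T₀ _ = T₀ _ * _ + _ * T₀ _
    rw [res_mul, T₀_res, T₀_res, T₀_res, res_mul, res_mul, res_add]
    exact res_eq_res.2 fun q hq => dDir_mul (diffAt V.isOpen hF hq) (diffAt V.isOpen hG hq) _
  inv_D f := by
    obtain ⟨F, hF, rfl⟩ := res_surj f
    change inv₀ (D₀ _) = -D₀ _
    rw [D₀_res, inv₀_res, inv₀_res, D₀_res, res_neg]
    exact res_eq_res.2 fun q hq => gradeInv_sD (diffAt V.isOpen hF hq)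
  inv_T f := by
    obtain ⟨F, hF, rfl⟩ := res_surj f
    change inv₀ (T₀ _) = T₀ _
    rw [T₀_res, inv₀_res, inv₀_res, T₀_res]
    exact res_eq_res.2 fun q hq => (dDir_gradeInv (diffAt V.isOpen hF hq) _).symm
  T_D f := by
    obtain ⟨F, hF, rfl⟩ := res_surj f
    change T₀ (D₀ _) = D₀ (T₀ _)
    rw [T₀_res, D₀_res, T₀_res, D₀_res]
    exact res_eq_res.2 fun q hq => (sD_dDir V.isOpen hF hq _).symm
  even_comm _ _ h := mul_comm_of_inv₀_eq h
  odd_comm _ _ h := mul_comm_of_inv₀_eq_neg h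

open SuperDiffAlg

theorem D_res (hF : ContDiffOn ℝ ∞ F V) : D (res F hF) = res (sD F) (contDiffOn_sD V.isOpen hF) :=
  D₀_res hF

theorem T_res (hF : ContDiffOn ℝ ∞ F V) :
    T (res F hF) = res (dT F) (contDiffOn_dT V.isOpen hF) := T₀_res hF

theorem res_dX (hF : ContDiffOn ℝ ∞ F V) :
    res (dX F) (contDiffOn_dX V.isOpen hF) = D (D (res F hF)) := by
  rw [D_res, D_res]
  exact res_eq_res.2 fun q hq => (sD_sD V.isOpen hF hq).symm

theorem inv_res_eq_self (hF : ContDiffOn ℝ ∞ F V) :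
    inv (res F hF) = res F hF ↔ ∀ q ∈ V, IsEven (F q) := by
  simp only [isEven_iff]
  change inv₀ (res F hF) = _ ↔ _
  rw [inv₀_res, res_eq_res]

theorem inv_res_eq_neg (hF : ContDiffOn ℝ ∞ F V) :
    inv (res F hF) = -res F hF ↔ ∀ q ∈ V, IsOdd (F q) := by
  simp only [isOdd_iff]
  change inv₀ (res F hF) = _ ↔ _
  rw [inv₀_res, res_neg, res_eq_res]

end SmoothField

namespace SuperDiffAlg
variable {A : Type*} [Ring A] [Algebra ℝ A] [SuperDiffAlg A] {a b l s w : A}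

theorem even_D_D (h : inv a = a) : inv (D (D a)) = D (D a) := by
  rw [inv_D, inv_D, map_neg, neg_neg, h]

theorem odd_D (h : inv a = a) : inv (D a) = -D a := by rw [inv_D, h]

theorem even_D (h : inv a = -a) : inv (D a) = D a := by rw [inv_D, h, map_neg, neg_neg]

theorem odd_mul_self (h : inv a = -a) : a * a = 0 := by
  have h1 := odd_comm a a h
  rw [h, neg_mul] at h1
  have : (2 : ℝ) • (a * a) = 0 := by rw [two_smul]; nth_rw 1 [h1]; exact neg_add_cancel _
  exact (smul_eq_zero.1 this).resolve_left two_ne_zero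

theorem odd_anticomm (h : inv a = -a) (h' : inv b = -b) : a * b = -(b * a) := by
  rw [odd_comm a b h, h', neg_mul]

theorem D_mul_even (h : inv a = a) (b : A) : D (a * b) = D a * b + a * D b := by rw [D_mul, h]

theorem D_mul_odd (h : inv a = -a) (b : A) : D (a * b) = D a * b - a * D b := by
  rw [D_mul, h, neg_mul, sub_eq_add_neg]

theorem D_D_mul (a b : A) : D (D (a * b)) = D (D a) * b + a * D (D b) := by
  rw [D_mul, map_add, D_mul, D_mul, inv_inv, inv_D, neg_mul]
  abel

/-- The center of a super differential algebra, as a ring of commuting scalars.  It contains the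
even elements.  Differential polynomials in even and odd elements are compared by writing the even
factors as scalars: what remains is linear in monomials of odd elements. -/
def Scalars (A : Type*) [Ring A] [Algebra ℝ A] : Type _ := Subalgebra.center ℝ A

instance : CommRing (Scalars A) := inferInstanceAs (CommRing (Subalgebra.center ℝ A))

instance : Algebra (Scalars A) A :=
  RingHom.toAlgebra' (Subalgebra.center ℝ A).val.toRingHom fun e a =>
    (Subalgebra.mem_center_iff.1 e.2 a).symm

/-- An even element acts on the algebra as a scalar. -/
theorem exists_center (h : inv a = a) : ∃ e : Scalars A, a = e • (1 : A) :=
  ⟨(⟨a, Subalgebra.mem_center_iff.2 fun b => (even_comm a b h).symm⟩ : Subalgebra.center ℝ A),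
    (mul_one a).symm⟩

theorem smul_one_inj {A : Type*} [Ring A] [Algebra ℝ A] {e f : Scalars A}
    (h : e • (1 : A) = f • (1 : A)) : e = f := by
  rw [Algebra.smul_def, Algebra.smul_def, mul_one, mul_one] at h
  exact Subtype.ext h

theorem even_mul (ha : inv a = a) (hb : inv b = b) : inv (a * b) = a * b := by
  rw [map_mul, ha, hb]

theorem mul_even_left (hs : inv s = s) (a b : A) : a * (s * b) = s * (a * b) := by
  rw [← mul_assoc, ← even_comm s a hs, mul_assoc]

/-- `l` is a logarithm of `s` as far as derivatives are concerned.  If `l` is the logarithm of an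
even superfield, then `r • l` stands in this relation to its `r`-th power. -/
structure IsLog (l s : A) : Prop where
  even : inv l = l
  even_exp : inv s = s
  D_exp : D s = s * D l
  T_exp : T s = s * T l

namespace IsLog
variable {i f g h : A}

theorem D_mul (hl : IsLog l s) (f : A) : D (s * f) = s * (D l * f + D f) := by
  rw [D_mul_even hl.even_exp, hl.D_exp, mul_add, mul_assoc]

/-- Conjugation of `∂_y` by `s` adds `∂_y l`. -/
theorem D_D_mul (hl : IsLog l s) (f : A) : D (D (s * f)) = s * (D (D l) * f + D (D f)) := by
  rw [SuperDiffAlg.D_D_mul, hl.D_exp, hl.D_mul, odd_mul_self (odd_D hl.even), zero_add, mul_add,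
    mul_assoc]

theorem D2 (hl : IsLog l s) : D (D s) = s * D (D l) := by
  have := hl.D_D_mul 1
  have h1 : D (1 : A) = 0 := by simpa using SuperDiffAlg.D_mul (1 : A) 1
  rwa [h1, map_zero, mul_one, mul_one, add_zero] at this

theorem D3 (hl : IsLog l s) : D (D (D s)) = s * (D l * D (D l) + D (D (D l))) := by
  rw [hl.D2, hl.D_mul]

theorem D4 (hl : IsLog l s) :
    D (D (D (D s))) = s * (D (D l) * D (D l) + D (D (D (D l)))) := by
  rw [hl.D2, hl.D_D_mul]

theorem D5 (hl : IsLog l s) : D (D (D (D (D s)))) = s * (D l * (D (D l) * D (D l))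
    + D l * D (D (D (D l))) + (2 : ℝ) • (D (D l) * D (D (D l))) + D (D (D (D (D l))))) := by
  have h2 := even_D_D hl.even
  rw [hl.D4, hl.D_mul, map_add, D_mul_even h2, even_comm _ (D (D (D l))) h2, two_smul]
  simp only [mul_add]
  abel

theorem D6 (hl : IsLog l s) : D (D (D (D (D (D s))))) = s * (D (D l) * (D (D l) * D (D l))
    + (3 : ℝ) • (D (D l) * D (D (D (D l)))) + D (D (D (D (D (D l)))))) := by
  have h2 := even_D_D hl.even
  rw [hl.D4, hl.D_D_mul, map_add, map_add, SuperDiffAlg.D_D_mul,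
    show (3 : ℝ) = 2 + 1 by norm_num, add_smul, two_smul, one_smul]
  simp only [mul_add, even_comm _ (D (D (D (D l)))) h2]
  abel

theorem cancel_one (hl : IsLog l s) (hi : s * i = 1) (f : A) : s * f * i = f := by
  rw [even_comm s f hl.even_exp, mul_assoc, hi, mul_one]

theorem cancel_two (hl : IsLog l s) (hi : s * i = 1) (f g : A) :
    s * f * (s * g) * (i * i) = f * g := by
  rw [mul_even_left hl.even_exp, mul_assoc s f g, ← mul_assoc _ i i, hl.cancel_one hi,
    hl.cancel_one hi]

end IsLog

/-- The coefficient of `∂_y` in `∂_t` in the new variables, in terms of `l = log S`. -/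
def aCoef (l : A) : A :=
  (1 / 8 : ℝ) • (-((2 : ℝ) • D (D (D (D l)))) + D (D l) * D (D l) + D (D (D l)) * D l)

theorem even_aCoef (h : inv l = l) : inv (aCoef l) = aCoef l := by
  have h1 := odd_D h
  have h2 := even_D h1
  have h3 := odd_D h2
  have h4 := even_D h3
  simp only [aCoef, map_smul, map_add, map_neg, map_mul, h1, h2, h3, h4, neg_mul_neg]

theorem D_aCoef (h : inv l = l) : D (aCoef l) = (1 / 8 : ℝ) •
    (-((2 : ℝ) • D (D (D (D (D l))))) + D (D l) * D (D (D l)) + D (D (D (D l))) * D l) := by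
  have h1 := odd_D h
  have h2 := even_D h1
  have h3 := odd_D h2
  have h4 := even_D h3
  simp only [aCoef, map_smul, map_add, map_neg, D_mul_even h2, D_mul_odd h3,
    even_comm _ (D (D (D l))) h2]
  obtain ⟨e2, he2⟩ := exists_center h2
  obtain ⟨e4, he4⟩ := exists_center h4
  generalize hx5 : D (D (D (D (D l)))) = x5
  generalize hx4 : D (D (D (D l))) = x4 at *
  generalize hx3 : D (D (D l)) = x3 at *
  generalize hx2 : D (D l) = x2 at *
  generalize hx1 : D l = x1 at *
  -- The derivatives of `l` are now independent variables, the even ones scalars.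
  subst he2 he4
  -- The factor clears the denominators of all rational coefficients.
  refine smul_right_injective A (show (16 : ℝ) ≠ 0 by norm_num) ?_
  simp only [smul_mul_assoc, mul_smul_comm, one_mul, mul_one, smul_add, smul_neg, smul_sub,
    smul_smul]
  norm_num [ofNat_smul_eq_nsmul ℝ, -nsmul_eq_mul]
  module

namespace IsLog
variable {i : A}

theorem even_inv (hl : IsLog l s) (hi : s * i = 1) : inv i = i := by
  have h := congrArg inv hi
  rw [map_mul, map_one, hl.even_exp] at h
  rw [← hl.cancel_one hi (inv i), h, one_mul]

theorem exists_center_pair (hl : IsLog l s) (hi : s * i = 1) :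
    ∃ e e' : Scalars A, s = e • (1 : A) ∧ i = e' • (1 : A) ∧ e * e' = 1 := by
  obtain ⟨e, he⟩ := exists_center hl.even_exp
  obtain ⟨e', he'⟩ := exists_center (hl.even_inv hi)
  refine ⟨e, e', he, he', Subtype.ext ?_⟩
  rw [he, he', Algebra.smul_def, Algebra.smul_def, mul_one, mul_one] at hi
  exact hi

theorem cancel_three (hl : IsLog l s) (hi : s * i = 1) (f g h : A) :
    s * f * (s * g) * (s * h) * (i * i * i) = f * g * h := by
  obtain ⟨e, e', rfl, rfl, he⟩ := hl.exists_center_pair hi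
  simp only [smul_mul_assoc, mul_smul_comm, one_mul, mul_one, smul_smul]
  match_scalars
  linear_combination ((e * e') ^ 2 + e * e' + 1) * he

theorem cancel_two_one (hl : IsLog l s) (hi : s * i = 1) (f g : A) :
    s * f * (s * g) * i = s * (f * g) := by
  rw [mul_even_left hl.even_exp, hl.cancel_one hi, mul_assoc]

theorem cancel_three_two (hl : IsLog l s) (hi : s * i = 1) (f g h : A) :
    s * f * (s * g) * (s * h) * (i * i) = s * (f * g * h) := by
  obtain ⟨e, e', rfl, rfl, he⟩ := hl.exists_center_pair hi
  simp only [smul_mul_assoc, mul_smul_comm, one_mul, mul_one, smul_smul]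
  match_scalars
  linear_combination e * (e * e' + 1) * he

/-- The coefficient of `∂_y` in terms of `S` is a polynomial in the derivatives of `log S`. -/
theorem aCoef_eq (hl : IsLog l s) (hi : s * i = 1) :
    (1 / 8 : ℝ) • (-((2 : ℝ) • (D (D (D (D s))) * i)) + (3 : ℝ) • (D (D s) ^ 2 * (i * i))
      + D (D (D s)) * D s * (i * i)) = aCoef l := by
  have h1 := odd_D hl.even
  have h2 := even_D h1
  have h4 := even_D_D h2
  rw [sq, hl.D4, hl.D3, hl.D2, hl.D_exp, hl.cancel_one hi, hl.cancel_two hi, hl.cancel_two hi,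
    add_mul, mul_assoc, even_comm _ (D l) h2, ← mul_assoc, odd_mul_self h1, zero_mul, zero_add,
    aCoef]
  module

/-- The coefficient of `𝔻` is half the superderivative of the coefficient of `∂_y`. -/
theorem D_aCoef_eq (hl : IsLog l s) (hi : s * i = 1) :
    (1 / 16 : ℝ) • (-((2 : ℝ) • (D (D (D (D (D s)))) * i))
      + (5 : ℝ) • (D (D (D s)) * D (D s) * (i * i)) + (3 : ℝ) • (D s * D (D (D (D s))) * (i * i))
      - (6 : ℝ) • (D s * D (D s) ^ 2 * (i * i * i))) = (1 / 2 : ℝ) • D (aCoef l) := by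
  have h1 := odd_D hl.even
  have h2 := even_D h1
  have h4 := even_D_D h2
  rw [sq, ← mul_assoc (D s), hl.D5, hl.D4, hl.D3, hl.D2, hl.D_exp, hl.cancel_one hi,
    hl.cancel_two hi, hl.cancel_two hi, hl.cancel_three hi, D_aCoef hl.even]
  obtain ⟨e2, he2⟩ := exists_center h2
  obtain ⟨e4, he4⟩ := exists_center h4
  generalize D (D (D (D (D l)))) = x5
  generalize D (D (D (D l))) = x4 at *
  generalize D (D (D l)) = x3 at *
  generalize D (D l) = x2 at *
  generalize D l = x1 at *
  subst he2 he4
  refine smul_right_injective A (show (16 : ℝ) ≠ 0 by norm_num) ?_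
  simp only [smul_mul_assoc, mul_smul_comm, one_mul, mul_one, smul_add, smul_neg, smul_sub,
    smul_smul, mul_add]
  norm_num [ofNat_smul_eq_nsmul ℝ, -nsmul_eq_mul]
  module

/-- Division by `S` turns the equation for `S` into one for `log S`. -/
theorem sEquation_iff (hl : IsLog l s) (hi : s * i = 1) :
    T s = (1 / 16 : ℝ) • ((4 : ℝ) • D (D (D (D (D (D s)))))
      - (12 : ℝ) • (D (D (D (D s))) * D (D s) * i) + (6 : ℝ) • (D (D s) ^ 3 * (i * i))
      - (3 : ℝ) • (D (D (D s)) * D s * D (D s) * (i * i))) ↔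
    T l = (1 / 16 : ℝ) • ((4 : ℝ) • D (D (D (D (D (D l)))))
      - (2 : ℝ) • (D (D l) * (D (D l) * D (D l))) - (3 : ℝ) • (D (D (D l)) * (D l * D (D l)))) := by
  have h1 := odd_D hl.even
  have h2 := even_D h1
  have h4 := even_D_D h2
  have hs := hl.even_exp
  have hinj : ∀ f g : A, s * f = s * g ↔ f = g := fun f g =>
    ⟨fun h => by rw [← hl.cancel_one hi f, h, hl.cancel_one hi], fun h => by rw [h]⟩
  rw [hl.T_exp, ← hinj (T l)]
  refine Eq.congr_right ?_
  rw [pow_three, ← mul_assoc (D (D s)), hl.D6, hl.D4, hl.D3, hl.D2, hl.D_exp,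
    hl.cancel_two_one hi, hl.cancel_three_two hi, hl.cancel_three_two hi]
  simp only [← mul_smul_comm, ← mul_add, ← mul_sub]
  congr 1
  have o1 := odd_mul_self h1
  obtain ⟨e2, he2⟩ := exists_center h2
  obtain ⟨e4, he4⟩ := exists_center h4
  generalize D (D (D (D (D (D l))))) = x6
  generalize D (D (D (D l))) = x4 at *
  generalize D (D (D l)) = x3 at *
  generalize D (D l) = x2 at *
  generalize D l = x1 at *
  subst he2 he4
  refine smul_right_injective A (show (16 : ℝ) ≠ 0 by norm_num) ?_
  simp only [smul_mul_assoc, mul_smul_comm, mul_one, smul_add, smul_sub, smul_smul, add_mul,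
    mul_add, o1, smul_zero]
  norm_num [ofNat_smul_eq_nsmul ℝ, -nsmul_eq_mul]
  module

/-- The equation for `log S` implies the modified equation for `-𝔻 log S`. -/
theorem mkdv (hl : inv l = l)
    (h : T l = (1 / 16 : ℝ) • ((4 : ℝ) • D (D (D (D (D (D l)))))
      - (2 : ℝ) • (D (D l) * (D (D l) * D (D l)))
      - (3 : ℝ) • (D (D (D l)) * (D l * D (D l))))) :
    T (-D l) = (1 / 4 : ℝ) • D (D (D (D (D (D (-D l))))))
      - (3 / 16 : ℝ) • (D (-D l) * D (D (-D l * D (-D l)))) := by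
  have h1 := odd_D hl
  have h2 := even_D h1
  have h3 := odd_D h2
  have h4 := even_D h3
  have o3 := odd_mul_self h3
  simp only [map_neg, T_D, h, neg_mul_neg, map_smul, map_sub,
    D_mul_even h2, D_mul_odd h1, D_mul_odd h3]
  have o31 := odd_anticomm h3 h1
  have o313 : D (D (D l)) * (D l * D (D (D l))) = 0 := by
    rw [← mul_assoc, o31, neg_mul, mul_assoc, o3, mul_zero, neg_zero]
  obtain ⟨e2, he2⟩ := exists_center h2
  obtain ⟨e4, he4⟩ := exists_center h4
  generalize D (D (D (D (D (D (D l)))))) = x7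
  generalize D (D (D (D l))) = x4 at *
  generalize D (D (D l)) = x3 at *
  generalize D (D l) = x2 at *
  generalize D l = x1 at *
  subst he2 he4
  refine smul_right_injective A (show (16 : ℝ) ≠ 0 by norm_num) ?_
  simp only [smul_mul_assoc, mul_smul_comm, one_mul, mul_one, smul_add, smul_neg,
    smul_sub, smul_smul, mul_add, neg_mul, mul_sub, o313, sub_zero]
  norm_num [ofNat_smul_eq_nsmul ℝ, -nsmul_eq_mul]
  module

/-- If the flow of `L = log S` along the transformed time derivative is `-2` times the
superderivative of the coefficient of `𝔻`, then `L` satisfies the logarithmic form of the equation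
for `S`. -/
theorem log_equation (hl : inv l = l)
    (h : T l + aCoef l * D (D l) + (1 / 2 : ℝ) • (D (aCoef l) * D l) = -D (D (aCoef l))) :
    T l = (1 / 16 : ℝ) • ((4 : ℝ) • D (D (D (D (D (D l)))))
      - (2 : ℝ) • (D (D l) * (D (D l) * D (D l)))
      - (3 : ℝ) • (D (D (D l)) * (D l * D (D l)))) := by
  have h1 := odd_D hl
  have h2 := even_D h1
  have h3 := odd_D h2
  have h4 := even_D h3
  have o1 := odd_mul_self h1
  have o3 := odd_mul_self h3
  have o31 := odd_anticomm h3 h1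
  rw [← eq_sub_iff_add_eq, ← eq_sub_iff_add_eq] at h
  rw [h, D_aCoef hl, aCoef]
  simp only [map_smul, map_add, map_neg, D_mul_even h2, D_mul_even h4, smul_mul_assoc]
  obtain ⟨e2, he2⟩ := exists_center h2
  obtain ⟨e4, he4⟩ := exists_center h4
  generalize D (D (D (D (D (D l))))) = x6
  generalize D (D (D (D (D l)))) = x5
  generalize D (D (D (D l))) = x4 at *
  generalize D (D (D l)) = x3 at *
  generalize D (D l) = x2 at *
  generalize D l = x1 at *
  subst he2 he4
  refine smul_right_injective A (show (16 : ℝ) ≠ 0 by norm_num) ?_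
  simp only [smul_mul_assoc, mul_smul_comm, one_mul, mul_one, smul_add, smul_neg, smul_sub,
    smul_smul, add_mul, neg_mul, o1, o3, o31, smul_zero, add_zero, zero_add]
  norm_num [ofNat_smul_eq_nsmul ℝ, -nsmul_eq_mul]
  module

/-- The superderivative of the right-hand side of the Schwarzian equation, for `a = 𝔻Λ` with
logarithm `m`. -/
theorem D_schwarzian (hm : IsLog l a) (hi : a * i = 1) :
    D ((1 / 4 : ℝ) • (D (D (D (D (D a)))) - (3 : ℝ) • (D (D (D a)) * D (D a) * i)))
      = a * ((1 / 4 : ℝ) • (D (D (D (D (D (D l))))) - (2 : ℝ) • (D (D l) * (D (D l) * D (D l)))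
        + (3 : ℝ) • (D l * (D (D l) * D (D (D l)))))) := by
  have h1 := odd_D hm.even
  have h2 := even_D h1
  have h3 := odd_D h2
  have h4 := even_D h3
  rw [hm.D5, hm.D3, hm.D2, hm.cancel_two_one hi]
  simp only [← mul_smul_comm, ← mul_sub]
  rw [hm.D_mul]
  congr 1
  simp only [add_mul, mul_add, map_smul, map_sub, map_add, D_mul_even h2, D_mul_odd h1,
    D_mul_odd h3, mul_assoc]
  have o1 : ∀ x, D l * (D l * x) = 0 := fun x => by rw [← mul_assoc, odd_mul_self h1, zero_mul]
  have o3 := odd_mul_self h3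
  have o31 := odd_anticomm h3 h1
  obtain ⟨e2, he2⟩ := exists_center h2
  obtain ⟨e4, he4⟩ := exists_center h4
  generalize D (D (D (D (D (D l))))) = x6
  generalize D (D (D (D (D l)))) = x5
  generalize D (D (D (D l))) = x4 at *
  generalize D (D (D l)) = x3 at *
  generalize D (D l) = x2 at *
  generalize D l = x1 at *
  subst he2 he4
  have o11 : x1 * x1 = 0 := by simpa using o1 1
  refine smul_right_injective A (show (16 : ℝ) ≠ 0 by norm_num) ?_
  simp only [smul_mul_assoc, mul_smul_comm, one_mul, mul_one, smul_add, smul_sub,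
    smul_smul, mul_add, mul_sub, o3, o11, smul_zero, add_zero,
    zero_add]
  norm_num [ofNat_smul_eq_nsmul ℝ, -nsmul_eq_mul]
  module

/-- The logarithmic form of the equation for `S` is equivalent to the superderivative of the
Schwarzian equation, for `a = 𝔻Λ` with `log S = -2 log a`. -/
theorem schwarzian_iff (hm : IsLog l a) (hi : a * i = 1) (hl : s = (-2 : ℝ) • l) :
    T a = D ((1 / 4 : ℝ) • (D (D (D (D (D a)))) - (3 : ℝ) • (D (D (D a)) * D (D a) * i))) ↔
    T s = (1 / 16 : ℝ) • ((4 : ℝ) • D (D (D (D (D (D s)))))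
      - (2 : ℝ) • (D (D s) * (D (D s) * D (D s)))
      - (3 : ℝ) • (D (D (D s)) * (D s * D (D s)))) := by
  have h1 := odd_D hm.even
  have h2 := even_D h1
  have h3 := odd_D h2
  have o31 := odd_anticomm h3 h1
  have hinj : ∀ f g : A, a * f = a * g ↔ f = g := fun f g =>
    ⟨fun h => by rw [← hm.cancel_one hi f, h, hm.cancel_one hi], fun h => by rw [h]⟩
  rw [hm.D_schwarzian hi, hm.T_exp, hinj, hl]
  simp only [map_smul]
  rw [← (smul_right_injective A (show (-2 : ℝ) ≠ 0 by norm_num)).eq_iff]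
  refine Eq.congr_right ?_
  obtain ⟨e2, he2⟩ := exists_center h2
  generalize D (D (D (D (D (D l))))) = x6
  generalize D (D (D l)) = x3 at *
  generalize D (D l) = x2 at *
  generalize D l = x1 at *
  subst he2
  refine smul_right_injective A (show (16 : ℝ) ≠ 0 by norm_num) ?_
  simp only [smul_mul_assoc, mul_smul_comm, one_mul, mul_one, smul_add, smul_neg, smul_sub,
    smul_smul, neg_mul, mul_neg, o31]
  norm_num [ofNat_smul_eq_nsmul ℝ, -nsmul_eq_mul]
  module

end IsLog

section Transformation
variable {B : Type*} [Ring B] [Algebra ℝ B] [SuperDiffAlg B]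

theorem IsLog.mul {l m s t : B} (h : IsLog l s) (h' : IsLog m t) : IsLog (l + m) (s * t) where
  even := by rw [map_add, h.even, h'.even]
  even_exp := even_mul h.even_exp h'.even_exp
  D_exp := by
    rw [h.D_mul, h'.D_exp, map_add, ← even_comm t (D l) h'.even_exp, ← mul_add, mul_assoc]
  T_exp := by
    rw [T_mul, h.T_exp, h'.T_exp, map_add, mul_assoc, ← even_comm t (T l) h'.even_exp, ← mul_add,
      ← mul_add, mul_assoc]

/-- The coefficient of `∂_y` in the old variables. -/
def oldCoefY (u : B) : B :=
  -((1 / 4 : ℝ) • (D (D (D (D u))) * u)) + (1 / 8 : ℝ) • D (D u) ^ 2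
    + (1 / 4 : ℝ) • (D (D (D u)) * D u)

theorem even_oldCoefY {u : B} (h : inv u = u) : inv (oldCoefY u) = oldCoefY u := by
  have h1 := odd_D h
  have h2 := even_D h1
  have h3 := odd_D h2
  have h4 := even_D h3
  simp only [oldCoefY, map_smul, map_add, map_neg, map_mul, map_pow, h, h1, h2, h3, h4, neg_mul_neg]

theorem D_oldCoefY {u : B} (h : inv u = u) :
    D (oldCoefY u) = -((1 / 4 : ℝ) • (D (D (D (D (D u)))) * u)) := by
  have h1 := odd_D h
  have h2 := even_D h1
  have h3 := odd_D h2
  have h4 := even_D h3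
  simp only [oldCoefY, map_smul, map_add, map_neg, sq, D_mul_even h2, D_mul_even h4, D_mul_odd h3]
  obtain ⟨e2, he2⟩ := exists_center h2
  obtain ⟨e4, he4⟩ := exists_center h4
  generalize D (D (D (D (D u)))) = x5
  generalize D (D (D (D u))) = x4 at *
  generalize D (D (D u)) = x3 at *
  generalize D (D u) = x2 at *
  generalize D u = x1 at *
  subst he2 he4
  refine smul_right_injective B (show (16 : ℝ) ≠ 0 by norm_num) ?_
  simp only [smul_mul_assoc, mul_smul_comm, one_mul, mul_one, smul_add, smul_neg, smul_sub,
    smul_smul]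
  norm_num [ofNat_smul_eq_nsmul ℝ, -nsmul_eq_mul]
  module

/-- A solution `u` of the Harry Dym equation together with `log u`, `u⁻¹` and `u^{-1/2}`. -/
structure IsHarryDym (l u i w : B) : Prop where
  log : IsLog l u
  log_w : IsLog ((-1 / 2 : ℝ) • l) w
  mul_inv : u * i = 1
  w_mul_w : w * w = i
  eqn : T u = (1 / 4 : ℝ) • (D (D (D (D (D (D u))))) * u ^ 3)
    - (3 / 8 : ℝ) • (D (D (D (D (D u)))) * D u * u ^ 2)

/-- The coefficient of `𝔻` in the old variables, with `u^{3/2}` written as `u² u^{-1/2}`. -/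
def oldCoefD (u w : B) : B := -((1 / 8 : ℝ) • (D (D (D (D (D u)))) * (u * u * w)))

namespace IsHarryDym
variable {l u i w : B}

theorem odd_oldCoefD (h : IsHarryDym l u i w) : inv (oldCoefD u w) = -oldCoefD u w := by
  have h5 := odd_D (even_D_D (even_D_D h.log.even_exp))
  simp only [oldCoefD, map_smul, map_neg, map_mul, h.log.even_exp, h.log_w.even_exp, h5, neg_mul,
    smul_neg]

/-- The two coefficients are related as they must be for `∂_t` to commute with `𝒟`. -/
theorem D_oldCoefY (h : IsHarryDym l u i w) :
    D (oldCoefY u) = (2 : ℝ) • (w * oldCoefD u w) := by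
  rw [SuperDiffAlg.D_oldCoefY h.log.even_exp, oldCoefD]
  obtain ⟨e, e', he, he', hee⟩ := h.log.exists_center_pair h.mul_inv
  obtain ⟨f, hf⟩ := exists_center h.log_w.even_exp
  have hw := h.w_mul_w
  generalize D (D (D (D (D u)))) = x5
  subst hf he he'
  have hff : f * f = e' := smul_one_inj (A := B) (by
    rw [← hw, smul_mul_assoc, one_mul, smul_smul])
  refine smul_right_injective B (show (16 : ℝ) ≠ 0 by norm_num) ?_
  simp only [smul_mul_assoc, mul_smul_comm, one_mul, mul_one, smul_neg, smul_smul, mul_neg]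
  norm_num [ofNat_smul_eq_nsmul ℝ, -nsmul_eq_mul]
  match_scalars
  linear_combination -4 * e ^ 2 * hff - 4 * e * hee

/-- The conservation law of the Harry Dym equation with density `u^{-1/2}`. -/
theorem T_w (h : IsHarryDym l u i w) : T w = D (oldCoefD u w) := by
  have h4 := even_D_D (even_D_D h.log.even_exp)
  have h5 := odd_D h4
  have hp := (h.log.mul h.log).mul h.log_w
  have hT := h.eqn
  rw [h.log.T_exp] at hT
  have hT' := h.log.cancel_one h.mul_inv (T l)
  rw [hT] at hT'
  rw [h.log_w.T_exp, oldCoefD, map_neg, map_smul, map_smul, D_mul_odd h5, hp.D_exp, map_add,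
    map_add, map_smul, ← hT', h.log.D_exp, pow_three, sq]
  simp only [smul_mul_assoc, mul_smul_comm, sub_mul, smul_sub, smul_smul, mul_sub, mul_add]
  obtain ⟨e, e', he, he', hee⟩ := h.log.exists_center_pair h.mul_inv
  obtain ⟨f, hf⟩ := exists_center h.log_w.even_exp
  generalize D (D (D (D (D (D u))))) = x6
  generalize D (D (D (D (D u)))) = x5
  generalize D l = x1
  subst hf he he'
  refine smul_right_injective B (show (16 : ℝ) ≠ 0 by norm_num) ?_
  simp only [smul_mul_assoc, mul_smul_comm, one_mul, mul_one, smul_add, smul_neg, smul_sub,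
    smul_smul]
  norm_num [ofNat_smul_eq_nsmul ℝ, -nsmul_eq_mul]
  match_scalars
  · linear_combination -2 * e ^ 2 * f * hee
  · linear_combination 3 * e ^ 2 * f * hee

variable {r : B}

/-- Integrability of the system `𝒟ϱ = w`, `ϱ_t = oldCoefD`, `𝒟y = w ϱ`,
`y_t = oldCoefY + oldCoefD ϱ` for `y`. -/
theorem integrable_y (h : IsHarryDym l u i w) (hDr : D r = w)
    (hTr : T r = oldCoefD u w) :
    D (oldCoefY u + oldCoefD u w * r) = T (w * r) := by
  rw [map_add, h.D_oldCoefY, D_mul_odd h.odd_oldCoefD, T_mul, hDr, hTr, h.T_w,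
    ← even_comm w _ h.log_w.even_exp, two_smul]
  abel

end IsHarryDym

/-- A homomorphism of super differential algebras up to the change of derivations that belongs to
the reciprocal transformation of a solution of the Harry Dym equation.  Here `l` is `log S` and `a`
is `S^{-1/2}`. -/
structure IsTransformation (Φ : A →ₐ[ℝ] B) (l s a : A) (i w : B) : Prop where
  inj : Function.Injective Φ
  log : IsLog l s
  log_a : IsLog ((-1 / 2 : ℝ) • l) a
  map_a : Φ a = w
  sol : IsHarryDym (Φ l) (Φ s) i w
  inv_map : ∀ f, inv (Φ f) = Φ (inv f)
  D_map : ∀ f, D (Φ f) = w * Φ (D f)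
  T_map : ∀ f, T (Φ f)
    = Φ (T f) + oldCoefY (Φ s) * Φ (D (D f)) + oldCoefD (Φ s) w * Φ (D f)

namespace IsTransformation
variable {Φ : A →ₐ[ℝ] B} {l s a : A} {i w : B}

theorem w_mul_left_inj (h : IsTransformation Φ l s a i w) {f g : B} (hfg : w * f = w * g) :
    f = g := by
  have h1 := h.sol.mul_inv
  rw [← h.sol.w_mul_w] at h1
  rw [← one_mul f, ← one_mul g, ← h1]
  simp only [mul_assoc, hfg]

/-- The coefficient of `∂_y` in terms of the new variables. -/
theorem map_aCoef (h : IsTransformation Φ l s a i w) : Φ (aCoef l) = oldCoefY (Φ s) := by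
  have h1 := odd_D h.log.even
  have h2 := even_D h1
  have h3 := odd_D h2
  have h4 := even_D h3
  have o1 : Φ (D l) * Φ (D l) = 0 := by rw [← map_mul, odd_mul_self h1, map_zero]
  have o31 : Φ (D (D (D l))) * Φ (D l) = -(Φ (D l) * Φ (D (D (D l)))) := by
    rw [← map_mul, odd_anticomm h3 h1, map_neg, map_mul]
  have c2 : inv (Φ (D (D l))) = Φ (D (D l)) := by rw [h.inv_map, h2]
  have c4 : inv (Φ (D (D (D (D l))))) = Φ (D (D (D (D l)))) := by rw [h.inv_map, h4]
  have hDw : D w = (-1 / 2 : ℝ) • (w * (w * Φ (D l))) := by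
    rw [h.sol.log_w.D_exp, map_smul, h.D_map, mul_smul_comm]
  obtain ⟨e, e', he, he', hee⟩ := h.sol.log.exists_center_pair h.sol.mul_inv
  obtain ⟨f, hf⟩ := exists_center h.sol.log_w.even_exp
  obtain ⟨e2, he2⟩ := exists_center c2
  obtain ⟨e4, he4⟩ := exists_center c4
  have hff : f * f = e' := smul_one_inj (A := B) (by
    rw [← he', ← h.sol.w_mul_w, hf, smul_mul_assoc, one_mul, smul_smul])
  have hfe : f * (f * e) = 1 := by rw [← mul_assoc, hff, mul_comm, hee]
  have d1 : D (Φ s) = Φ s * (w * Φ (D l)) := by rw [h.sol.log.D_exp, h.D_map]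
  have d2 : D (D (Φ s)) = Φ (D (D l)) := by
    rw [d1, h.sol.log.D_mul, h.D_map, D_mul_even h.sol.log_w.even_exp, hDw, h.D_map, hf, he]
    simp only [smul_mul_assoc, mul_smul_comm, one_mul, smul_smul, o1,
      smul_zero, zero_add, mul_assoc]
    rw [hfe, one_smul]
  have d3 : D (D (D (Φ s))) = w * Φ (D (D (D l))) := by rw [d2, h.D_map]
  have d4 : D (D (D (D (Φ s)))) = (-1 / 2 : ℝ) • (w * (w * (Φ (D l) * Φ (D (D (D l))))))
      + w * (w * Φ (D (D (D (D l))))) := by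
    rw [d3, D_mul_even h.sol.log_w.even_exp, hDw, h.D_map]
    simp only [smul_mul_assoc, mul_assoc]
  rw [oldCoefY, d4, d3, d2, d1, aCoef]
  simp only [map_add, map_smul, map_neg, map_mul, sq]
  simp only [add_mul, smul_mul_assoc]
  rw [o31, he, hf, he2, he4]
  refine smul_right_injective B (show (16 : ℝ) ≠ 0 by norm_num) ?_
  simp only [smul_mul_assoc, mul_smul_comm, one_mul, mul_one, smul_add, smul_neg, smul_smul, o31]
  norm_num [ofNat_smul_eq_nsmul ℝ, -nsmul_eq_mul]
  match_scalars
  · linear_combination 4 * e4 * hfe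
  · linear_combination 2 * hfe

/-- The coefficient of `𝔻` in terms of the new variables. -/
theorem map_D_aCoef (h : IsTransformation Φ l s a i w) :
    Φ ((1 / 2 : ℝ) • D (aCoef l)) = oldCoefD (Φ s) w := by
  have h1 := h.sol.D_oldCoefY
  rw [← h.map_aCoef, h.D_map, ← mul_smul_comm] at h1
  rw [map_smul, h.w_mul_left_inj h1, smul_smul]
  norm_num

/-- The transformed time derivative, with its coefficients in the new variables. -/
theorem T_map' (h : IsTransformation Φ l s a i w) (f : A) :
    T (Φ f) = Φ (T f + aCoef l * D (D f) + (1 / 2 : ℝ) • D (aCoef l) * D f) := by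
  rw [h.T_map, ← h.map_aCoef, ← h.map_D_aCoef]
  simp only [map_add, map_mul]

/-- The flow of `S^{-1/2}` along the transformed time derivative. -/
theorem flow_a (h : IsTransformation Φ l s a i w) :
    T a + aCoef l * D (D a) + (1 / 2 : ℝ) • D (aCoef l) * D a
      = a * D ((1 / 2 : ℝ) • D (aCoef l)) := by
  apply h.inj
  rw [← h.T_map', h.map_a, h.sol.T_w, ← h.map_D_aCoef, h.D_map, map_mul, h.map_a]

/-- The logarithm of the transformed solution satisfies the logarithmic form of the equation for
`S`: this is the conservation law for `u^{-1/2}`, read in the new variables. -/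
theorem log_equation (h : IsTransformation Φ l s a i w) :
    T l = (1 / 16 : ℝ) • ((4 : ℝ) • D (D (D (D (D (D l)))))
      - (2 : ℝ) • (D (D l) * (D (D l) * D (D l)))
      - (3 : ℝ) • (D (D (D l)) * (D l * D (D l)))) := by
  apply IsLog.log_equation h.log.even
  have h1 := h.flow_a
  rw [h.log_a.T_exp, h.log_a.D2, h.log_a.D_exp, mul_even_left h.log_a.even_exp,
    mul_even_left h.log_a.even_exp, ← mul_add, ← mul_add] at h1
  have h2 := congrArg Φ h1
  rw [map_mul, map_mul, h.map_a] at h2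
  have h3 := h.inj (h.w_mul_left_inj h2)
  simp only [map_smul, mul_smul_comm, smul_mul_assoc] at h3
  linear_combination (norm := module) (-2 : ℝ) • h3

/-- Integrability of the system `𝒟λ = w²`, `λ_t = Φ(R + …)` for the potential `λ = Φ Λ` in the old
variables.  It says `𝔻Λ = a` and `Λ_τ = R` in the new ones, so that `T a = D R` is its condition of
integrability there. -/
theorem integrable_potential (h : IsTransformation Φ l s a i w) {R : A} (hR : T a = D R) :
    D (Φ (R + aCoef l * D a + (1 / 2 : ℝ) • D (aCoef l) * a)) = T (w * w) := by
  have ha := even_aCoef h.log.even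
  have hb := odd_D ha
  have hb' : inv ((1 / 2 : ℝ) • D (aCoef l)) = -((1 / 2 : ℝ) • D (aCoef l)) := by
    rw [map_smul, hb, smul_neg]
  have h1 := h.flow_a
  have h2 : D (R + aCoef l * D a + (1 / 2 : ℝ) • D (aCoef l) * a)
      = (2 : ℝ) • (a * D ((1 / 2 : ℝ) • D (aCoef l))) := by
    rw [map_add, map_add, ← hR, D_mul_even ha, D_mul_odd hb', two_smul]
    nth_rw 1 [← h1]
    rw [← even_comm a _ h.log_a.even_exp, smul_mul_assoc]
    module
  have h3 : T w = w * Φ (D ((1 / 2 : ℝ) • D (aCoef l))) := by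
    rw [h.sol.T_w, ← h.map_D_aCoef, h.D_map]
  rw [h.D_map, h2, T_mul, ← even_comm w _ h.sol.log_w.even_exp, h3, map_smul, map_mul, h.map_a,
    two_smul, mul_add]

end IsTransformation

end Transformation

end SuperDiffAlg

/-! ### Taylor expansions in a nilpotent even element -/

/-- The sum `∑ sᵏ aₖ / k!`, truncated where the powers of an even nilpotent element vanish. -/
def taylorSum (s : Gr N) (a : ℕ → Gr N) : Gr N :=
  ∑ k ∈ Finset.range (N + 2), ((k ! : ℝ)⁻¹) • (s ^ k * a k)

theorem gEval_eq (f : ℝ → ℝ) (a : Gr N) :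
    gEval f a = taylorSum (soul a) fun k => algebraMap ℝ (Gr N) (iteratedDeriv k f (body a)) := by
  refine Finset.sum_congr rfl fun k _ => ?_
  rw [← Algebra.commutes, ← Algebra.smul_def, smul_smul, div_eq_inv_mul]

theorem pull_eq (Y R F : SField N) (p : ℝ × ℝ) :
    pull Y R F p = taylorSum (soul (Y p)) fun k => substTheta (R p) ((dX^[k] F) (bodyMap Y p)) :=
  rfl

/-- The product of two Taylor sums is the Taylor sum with the Leibniz coefficients. -/
theorem taylorSum_mul {s : Gr N} (hs : IsEven s) (h0 : s ^ (N + 2) = 0) (a b : ℕ → Gr N) :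
    taylorSum s a * taylorSum s b = taylorSum s fun k =>
      ∑ i ∈ Finset.range (k + 1), (k.choose i : ℝ) • (a i * b (k - i)) := by
  have hz : ∀ k, N + 2 ≤ k → s ^ k = 0 := fun k hk => pow_eq_zero_of_le hk h0
  set f : ℕ → ℕ → Gr N := fun i j => ((i ! : ℝ)⁻¹ * (j ! : ℝ)⁻¹) • (s ^ (i + j) * (a i * b j))
    with hf
  have h1 : taylorSum s a * taylorSum s b
      = ∑ i ∈ Finset.range (N + 2), ∑ j ∈ Finset.range (N + 2), f i j := by
    rw [taylorSum, taylorSum, Finset.sum_mul_sum]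
    refine Finset.sum_congr rfl fun i _ => Finset.sum_congr rfl fun j _ => ?_
    rw [smul_mul_smul_comm, mul_assoc, ← mul_assoc (a i), ← (hs.pow j).comm]
    simp only [mul_assoc, hf, pow_add]
  have h2 : ∀ i ∈ Finset.range (N + 2), ∑ j ∈ Finset.range (N + 2), f i j
      = ∑ j ∈ Finset.range (N + 2 - i), f i j := by
    intro i _
    refine (Finset.sum_subset (Finset.range_mono (Nat.sub_le _ _)) fun j _ hj => ?_).symm
    rw [Finset.mem_range] at hj
    simp only [hf, hz (i + j) (by omega), zero_mul, smul_zero]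
  rw [h1, Finset.sum_congr rfl h2, ← Finset.sum_range_diag_flip]
  refine Finset.sum_congr rfl fun k _ => ?_
  rw [Finset.mul_sum, Finset.smul_sum]
  refine Finset.sum_congr rfl fun i hi => ?_
  have hik : i ≤ k := Nat.lt_succ_iff.1 (Finset.mem_range.1 hi)
  simp only [hf, Nat.add_sub_cancel' hik, mul_smul_comm, smul_smul]
  congr 1
  rw [Nat.choose_eq_factorial_div_factorial hik,
    Nat.cast_div (Nat.factorial_mul_factorial_dvd_factorial hik) (by positivity)]
  push_cast
  field_simp

/-- Telescoping of the derivative of a Taylor sum: `s'` is the derivative of `s` and `b` the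
derivative of the point of expansion. -/
theorem taylorSum_telescope {s : Gr N} (h0 : s ^ (N + 1) = 0) (s' b : Gr N) (hb : s * b = b * s)
    (a : ℕ → Gr N) :
    ∑ k ∈ Finset.range (N + 2), ((k ! : ℝ)⁻¹) •
      ((k : ℝ) • (s' * s ^ (k - 1)) * a k + s ^ k * (b * a (k + 1)))
      = (s' + b) * taylorSum s fun k => a (k + 1) := by
  have h1 : ∑ k ∈ Finset.range (N + 2), ((k ! : ℝ)⁻¹) • ((k : ℝ) • (s' * s ^ (k - 1)) * a k)
      = s' * taylorSum s fun k => a (k + 1) := by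
    rw [Finset.sum_range_succ', taylorSum, Finset.sum_range_succ _ (N + 1), h0]
    simp only [Nat.cast_zero, zero_smul, zero_mul, smul_zero, add_zero, Finset.mul_sum]
    refine Finset.sum_congr rfl fun k _ => ?_
    rw [smul_mul_assoc, smul_smul, mul_assoc, mul_smul_comm, Nat.add_sub_cancel,
      Nat.factorial_succ]
    congr 1
    push_cast
    have : (k : ℝ) + 1 ≠ 0 := by positivity
    field_simp
  have h2 : ∑ k ∈ Finset.range (N + 2), ((k ! : ℝ)⁻¹) • (s ^ k * (b * a (k + 1)))
      = b * taylorSum s fun k => a (k + 1) := by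
    rw [taylorSum, Finset.mul_sum]
    refine Finset.sum_congr rfl fun k _ => ?_
    have : s ^ k * b = b * s ^ k := (Commute.pow_left hb k)
    rw [← mul_assoc, this, mul_assoc, mul_smul_comm]
  simp only [smul_add, Finset.sum_add_distrib, h1, h2, add_mul]

/-! ### Functions of even elements -/

theorem gEval_congr {f g : ℝ → ℝ} {a : Gr N} (h : f =ᶠ[nhds (body a)] g) :
    gEval f a = gEval g a := by
  refine Finset.sum_congr rfl fun k _ => ?_
  rw [h.iteratedDeriv_eq k]

/-- By the Leibniz formula, the Taylor expansion is multiplicative in the function. -/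
theorem gEval_mul {f g : ℝ → ℝ} {a : Gr N} (ha : IsEven a) (hf : ContDiffAt ℝ ∞ f (body a))
    (hg : ContDiffAt ℝ ∞ g (body a)) :
    gEval f a * gEval g a = gEval (fun s => f s * g s) a := by
  have h0 : soul a ^ (N + 2) = 0 := pow_eq_zero_of_le (Nat.le_succ _) ha.soul_pow_eq_zero
  rw [gEval_eq, gEval_eq, gEval_eq, taylorSum_mul (isEven_soul ha) h0]
  congr 1
  funext k
  rw [iteratedDeriv_fun_mul (hf.of_le (by exact_mod_cast le_top))
    (hg.of_le (by exact_mod_cast le_top)), map_sum]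
  refine Finset.sum_congr rfl fun i _ => ?_
  rw [mul_assoc, map_mul, map_mul, map_natCast, Algebra.smul_def, map_natCast]

theorem gEval_const (c : ℝ) (a : Gr N) : gEval (fun _ => c) a = algebraMap ℝ (Gr N) c := by
  rw [gEval, Finset.sum_range_succ', Finset.sum_eq_zero]
  · simp [Algebra.algebraMap_eq_smul_one]
  · intro k _
    simp [iteratedDeriv_const]

theorem gEval_id (a : Gr N) : gEval (fun s => s) a = a := by
  rw [gEval, Finset.sum_range_succ', Finset.sum_range_succ', Finset.sum_eq_zero]
  · simp [iteratedDeriv_one, iteratedDeriv_zero]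
    rw [← Algebra.algebraMap_eq_smul_one, add_comm]
    exact body_add_soul a
  · intro k _
    simp [show (fun s : ℝ => s) = id from rfl, iteratedDeriv_id]

theorem isEven_gEval (f : ℝ → ℝ) {a : Gr N} (ha : IsEven a) : IsEven (gEval f a) :=
  Submodule.sum_mem _ fun k _ => ((isEven_soul ha).pow k).smul _

theorem body_gEval (f : ℝ → ℝ) (a : Gr N) : body (gEval f a) = f (body a) := by
  rw [body_eq, gEval, map_sum, Finset.sum_eq_single 0]
  · simp
  · intro k _ hk
    simp [hk]
  · simp

section
variable {V : Set (ℝ × ℝ)} {F : SField N} {q : ℝ × ℝ}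

theorem dDir_pow {s : SField N} (hs : DifferentiableAt ℝ s q) (he : IsEven (s q)) (v : ℝ × ℝ)
    (k : ℕ) : dDir v (fun z => s z ^ k) q = (k : ℝ) • (dDir v s q * s q ^ (k - 1)) := by
  induction k with
  | zero => simp [dDir]
  | succ k ih =>
    have h := dDir_mul (hs.fun_pow k) hs v
    simp only [pow_succ]
    rw [h, ih, (he.pow k).comm, Nat.add_sub_cancel, Nat.cast_succ, add_smul, one_smul]
    congr 1
    rcases k with _ | k
    · simp
    · rw [Nat.add_sub_cancel, smul_mul_assoc, mul_assoc, ← pow_succ]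

theorem dTheta_pow {s : Gr N} (he : IsEven s) (k : ℕ) :
    dTheta (s ^ k) = (k : ℝ) • (dTheta s * s ^ (k - 1)) := by
  induction k with
  | zero => simp
  | succ k ih =>
    rw [pow_succ, dTheta_mul, ih, isEven_iff.1 (he.pow k), (he.pow k).comm, Nat.add_sub_cancel,
      Nat.cast_succ, add_smul, one_smul]
    congr 1
    rcases k with _ | k
    · simp
    · rw [Nat.add_sub_cancel, smul_mul_assoc, mul_assoc, ← pow_succ]

theorem dDir_taylorSum {s : SField N} {A : ℕ → SField N} (hs : DifferentiableAt ℝ s q)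
    (he : IsEven (s q)) (hA : ∀ k, DifferentiableAt ℝ (A k) q) (v : ℝ × ℝ) :
    dDir v (fun z => taylorSum (s z) fun k => A k z) q
      = ∑ k ∈ Finset.range (N + 2), ((k ! : ℝ)⁻¹) •
        ((k : ℝ) • (dDir v s q * s q ^ (k - 1)) * A k q + s q ^ k * dDir v (A k) q) := by
  have h : ∀ k ∈ Finset.range (N + 2),
      DifferentiableAt ℝ (fun z => ((k ! : ℝ)⁻¹) • (s z ^ k * A k z)) q := fun k _ =>
    ((hs.fun_pow k).fun_mul (hA k)).fun_const_smul _
  simp only [taylorSum, dDir]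
  rw [fderiv_fun_sum h, sum_apply]
  refine Finset.sum_congr rfl fun k _ => ?_
  have h1 := dDir_smul ((k ! : ℝ)⁻¹) ((hs.fun_pow k).fun_mul (hA k)) v
  rw [dDir_mul (hs.fun_pow k) (hA k), dDir_pow hs he] at h1
  exact h1

theorem dTheta_taylorSum {s : Gr N} (he : IsEven s) (a : ℕ → Gr N) :
    dTheta (taylorSum s a) = ∑ k ∈ Finset.range (N + 2), ((k ! : ℝ)⁻¹) •
        ((k : ℝ) • (dTheta s * s ^ (k - 1)) * a k + s ^ k * dTheta (a k)) := by
  rw [taylorSum, dTheta_eq, map_sum]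
  refine Finset.sum_congr rfl fun k _ => ?_
  rw [map_smul, ← dTheta_eq, dTheta_mul, dTheta_pow he, isEven_iff.1 (he.pow k)]

theorem differentiableAt_soul (hF : DifferentiableAt ℝ F q) :
    DifferentiableAt ℝ (fun z => soul (F z)) q :=
  hF.fun_sub ((LinearMap.toContinuousLinearMap ((Algebra.linearMap ℝ (Gr N)).comp
    (bodyHom N).toLinearMap)).differentiableAt.comp q hF)

theorem differentiableAt_body (hF : DifferentiableAt ℝ F q) :
    DifferentiableAt ℝ (fun z => body (F z)) q :=
  (LinearMap.toContinuousLinearMap (bodyHom N).toLinearMap).differentiableAt.comp q hF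

theorem dDir_soul (hF : DifferentiableAt ℝ F q) (v : ℝ × ℝ) :
    dDir v (fun z => soul (F z)) q = soul (dDir v F q) :=
  dDir_linear (LinearMap.id - (Algebra.linearMap ℝ (Gr N)).comp (bodyHom N).toLinearMap) hF v

theorem contDiffOn_iteratedDeriv {f : ℝ → ℝ} {I : Set ℝ} (hI : IsOpen I)
    (hf : ContDiffOn ℝ ∞ f I) (k : ℕ) : ContDiffOn ℝ ∞ (iteratedDeriv k f) I := by
  induction k with
  | zero => rwa [iteratedDeriv_zero]
  | succ k ih => rw [iteratedDeriv_succ]; exact ih.deriv_of_isOpen hI (by simp)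

theorem contDiffOn_gEval {f : ℝ → ℝ} {I : Set ℝ} (hI : IsOpen I) (hf : ContDiffOn ℝ ∞ f I)
    (hF : ContDiffOn ℝ ∞ F V) (hFI : ∀ q ∈ V, body (F q) ∈ I) :
    ContDiffOn ℝ ∞ (fun q => gEval f (F q)) V := by
  unfold gEval
  exact ContDiffOn.sum fun k _ =>
    (((contDiffOn_iteratedDeriv hI hf k).comp (contDiffOn_body hF) hFI).div_const _).smul
      ((contDiffOn_soul hF).pow k)

variable {f : ℝ → ℝ} {I : Set ℝ}

/-- The chain rule for derivatives in the even variables. -/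
theorem dDir_gEval (hI : IsOpen I) (hf : ContDiffOn ℝ ∞ f I) (hF : DifferentiableAt ℝ F q)
    (he : IsEven (F q)) (hq : body (F q) ∈ I) (v : ℝ × ℝ) :
    dDir v (fun z => gEval f (F z)) q = dDir v F q * gEval (deriv f) (F q) := by
  have hd : ∀ k, HasDerivAt (iteratedDeriv k f) (iteratedDeriv (k + 1) f (body (F q)))
      (body (F q)) := by
    intro k
    rw [iteratedDeriv_succ]
    exact (((contDiffOn_iteratedDeriv hI hf k).contDiffAt (hI.mem_nhds hq)).differentiableAt
      (by simp)).hasDerivAt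
  have hb := (differentiableAt_body hF).hasFDerivAt
  have hA : ∀ k, HasFDerivAt (fun z => algebraMap ℝ (Gr N) (iteratedDeriv k f (body (F z))))
      ((LinearMap.toContinuousLinearMap (Algebra.linearMap ℝ (Gr N))).comp
        (iteratedDeriv (k + 1) f (body (F q)) • fderiv ℝ (fun z => body (F z)) q)) q := by
    intro k
    have h1 := HasDerivAt.comp_hasFDerivAt (f := fun z => body (F z)) q (hd k) hb
    exact (LinearMap.toContinuousLinearMap (Algebra.linearMap ℝ (Gr N))).hasFDerivAt.comp q h1
  simp only [gEval_eq]
  rw [dDir_taylorSum (differentiableAt_soul hF) (isEven_soul he)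
    (fun k => (hA k).differentiableAt), dDir_soul hF]
  have hA' : ∀ k, dDir v (fun z => algebraMap ℝ (Gr N) (iteratedDeriv k f (body (F z)))) q
      = algebraMap ℝ (Gr N) (body (dDir v F q))
        * algebraMap ℝ (Gr N) (iteratedDeriv (k + 1) f (body (F q))) := by
    intro k
    refine (congrArg (fun L => L v) (hA k).fderiv).trans ?_
    rw [← map_mul, mul_comm, ← fderiv_body hF]
    rfl
  simp only [hA']
  rw [taylorSum_telescope he.soul_pow_eq_zero _ _ ((isEven_soul he).comm _)]
  have hbs := body_add_soul (dDir v F q)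
  rw [add_comm] at hbs
  rw [hbs]
  simp only [iteratedDeriv_succ']

/-- The chain rule for the derivative in the odd variable. -/
theorem dTheta_gEval (he : IsEven (F q)) :
    dTheta (gEval f (F q)) = dTheta (F q) * gEval (deriv f) (F q) := by
  have h := taylorSum_telescope he.soul_pow_eq_zero (dTheta (soul (F q))) 0 (by simp)
    fun k => algebraMap ℝ (Gr N) (iteratedDeriv k f (body (F q)))
  rw [gEval_eq, gEval_eq, dTheta_taylorSum (isEven_soul he)]
  simp only [dTheta_algebraMap]
  simp only [zero_mul, add_zero] at h
  simp only [mul_zero, add_zero] at h ⊢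
  rw [h]
  simp only [iteratedDeriv_succ', soul, dTheta_sub, dTheta_algebraMap, sub_zero]

/-- The chain rule for the superderivative. -/
theorem sD_gEval (hI : IsOpen I) (hf : ContDiffOn ℝ ∞ f I) (hF : DifferentiableAt ℝ F q)
    (he : IsEven (F q)) (hq : body (F q) ∈ I) :
    sD (fun z => gEval f (F z)) q = gEval (deriv f) (F q) * sD F q := by
  rw [(isEven_gEval (deriv f) he).comm]
  simp only [sD, dX_eq_dDir, dDir_gEval hI hf hF he hq, dTheta_gEval he, add_mul, mul_assoc]

theorem gPow_mul {a : Gr N} (ha : IsEven a) (hp : 0 < body a) (r s : ℝ) :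
    gPow a r * gPow a s = gPow a (r + s) := by
  rw [gPow, gPow, gEval_mul ha (Real.contDiffAt_rpow_const_of_ne hp.ne')
    (Real.contDiffAt_rpow_const_of_ne hp.ne')]
  refine gEval_congr ?_
  filter_upwards [lt_mem_nhds hp] with x hx
  rw [Real.rpow_add hx]

theorem gPow_zero (a : Gr N) : gPow a 0 = 1 := by
  simp only [gPow, Real.rpow_zero]
  rw [gEval_const, map_one]

theorem gPow_one (a : Gr N) : gPow a 1 = a := by
  simp only [gPow, Real.rpow_one]
  exact gEval_id a

theorem body_gPow (a : Gr N) (r : ℝ) : body (gPow a r) = body a ^ r := body_gEval _ a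

theorem body_gPow_pos {a : Gr N} (hp : 0 < body a) (r : ℝ) : 0 < body (gPow a r) := by
  rw [body_gPow]; exact Real.rpow_pos_of_pos hp r

theorem contDiffOn_rpow (r : ℝ) : ContDiffOn ℝ ∞ (fun s : ℝ => s ^ r) (Set.Ioi 0) := fun _ hx =>
  (Real.contDiffAt_rpow_const_of_ne (ne_of_gt hx)).contDiffWithinAt

theorem contDiffOn_log : ContDiffOn ℝ ∞ Real.log (Set.Ioi 0) := fun _ hx =>
  (Real.contDiffAt_log.2 (ne_of_gt hx)).contDiffWithinAt

theorem gEval_deriv_rpow {a : Gr N} (hp : 0 < body a) (r : ℝ) :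
    gEval (deriv fun s => s ^ r) a = r • gPow a (r - 1) := by
  have h : (deriv fun s : ℝ => s ^ r) =ᶠ[nhds (body a)] fun s => r * s ^ (r - 1) := by
    filter_upwards [lt_mem_nhds hp] with x hx
    exact (Real.hasDerivAt_rpow_const (Or.inl hx.ne')).deriv
  rw [gEval_congr h, gPow, gEval, gEval, Finset.smul_sum]
  refine Finset.sum_congr rfl fun k _ => ?_
  rw [iteratedDeriv_const_mul_field, mul_div_assoc, mul_smul]

theorem gEval_deriv_log (a : Gr N) : gEval (deriv Real.log) a = gPow a (-1) := by
  rw [gPow, Real.deriv_log']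
  congr 1
  funext x
  rw [Real.rpow_neg_one]

end

/-! ### Substitution of superfields -/

section iterate
variable {V : Set (ℝ × ℝ)} {F G : SField N} {q : ℝ × ℝ}

theorem contDiffOn_iterate_dX (hV : IsOpen V) (hF : ContDiffOn ℝ ∞ F V) (k : ℕ) :
    ContDiffOn ℝ ∞ (dX^[k] F) V := by
  induction k with
  | zero => exact hF
  | succ k ih => rw [Function.iterate_succ_apply']; exact contDiffOn_dX hV ih

theorem iterate_dX_congr (hV : IsOpen V) (h : Set.EqOn F G V) (k : ℕ) :
    Set.EqOn (dX^[k] F) (dX^[k] G) V := by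
  induction k with
  | zero => exact h
  | succ k ih =>
    intro q hq
    rw [Function.iterate_succ_apply', Function.iterate_succ_apply']
    exact dDir_congr hV ih hq _

theorem iterate_dX_add (hV : IsOpen V) (hF : ContDiffOn ℝ ∞ F V) (hG : ContDiffOn ℝ ∞ G V)
    (k : ℕ) : Set.EqOn (dX^[k] fun z => F z + G z) (fun z => dX^[k] F z + dX^[k] G z) V := by
  induction k with
  | zero => exact fun _ _ => rfl
  | succ k ih =>
    intro q hq
    simp only [Function.iterate_succ_apply']
    exact (dDir_congr hV ih hq _).trans (dDir_add (diffAt hV (contDiffOn_iterate_dX hV hF k) hq)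
      (diffAt hV (contDiffOn_iterate_dX hV hG k) hq) _)

theorem iterate_dX_linear (l : Gr N →ₗ[ℝ] Gr N) (hV : IsOpen V) (hF : ContDiffOn ℝ ∞ F V)
    (k : ℕ) : Set.EqOn (dX^[k] fun z => l (F z)) (fun z => l (dX^[k] F z)) V := by
  induction k with
  | zero => exact fun _ _ => rfl
  | succ k ih =>
    intro q hq
    simp only [Function.iterate_succ_apply']
    exact (dDir_congr hV ih hq _).trans (dDir_linear l
      (diffAt hV (contDiffOn_iterate_dX hV hF k) hq) _)

theorem iterate_dX_dDir (hV : IsOpen V) (hF : ContDiffOn ℝ ∞ F V) (v : ℝ × ℝ) (k : ℕ) :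
    Set.EqOn (dX^[k] (dDir v F)) (dDir v (dX^[k] F)) V := by
  induction k with
  | zero => exact fun _ _ => rfl
  | succ k ih =>
    intro q hq
    simp only [Function.iterate_succ_apply']
    exact (dDir_congr hV ih hq _).trans (dDir_comm hV (contDiffOn_iterate_dX hV hF k) hq _ _)

theorem iterate_dX_const (a : Gr N) (k : ℕ) : dX^[k + 1] (fun _ => a) = fun _ => 0 := by
  induction k with
  | zero => funext q; simp [dX]
  | succ k ih => rw [Function.iterate_succ_apply', ih]; funext q; simp [dX]

/-- The Leibniz formula. -/
theorem iterate_dX_mul (hV : IsOpen V) (hF : ContDiffOn ℝ ∞ F V) (hG : ContDiffOn ℝ ∞ G V)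
    (k : ℕ) : Set.EqOn (dX^[k] fun z => F z * G z) (fun z => ∑ i ∈ Finset.range (k + 1),
      (k.choose i : ℝ) • (dX^[i] F z * dX^[k - i] G z)) V := by
  have hd : ∀ i z, z ∈ V → DifferentiableAt ℝ (dX^[i] F) z := fun i z hz =>
    diffAt hV (contDiffOn_iterate_dX hV hF i) hz
  have hd' : ∀ i z, z ∈ V → DifferentiableAt ℝ (dX^[i] G) z := fun i z hz =>
    diffAt hV (contDiffOn_iterate_dX hV hG i) hz
  have key : Set.EqOn (dX^[k] fun z => F z * G z) (fun z =>
      ∑ ij ∈ Finset.HasAntidiagonal.antidiagonal k, k.choose ij.1 • (dX^[ij.1] F z * dX^[ij.2] G z)) V := by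
    induction k with
    | zero => intro q _; simp
    | succ k ih =>
      intro q hq
      rw [Function.iterate_succ_apply']
      refine (dDir_congr hV ih hq _).trans ?_
      simp only [Finset.sum_antidiagonal_choose_succ_nsmul
        (fun i j => dX^[i] F q * dX^[j] G q) k]
      have h1 : ∀ ij ∈ Finset.HasAntidiagonal.antidiagonal k, DifferentiableAt ℝ
          (fun z => k.choose ij.1 • (dX^[ij.1] F z * dX^[ij.2] G z)) q := fun ij _ =>
        ((hd _ q hq).fun_mul (hd' _ q hq)).fun_const_smul _
      rw [← Finset.sum_add_distrib, dDir, fderiv_fun_sum h1, sum_apply]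
      refine Finset.sum_congr rfl fun ij hij => ?_
      rw [fderiv_fun_const_smul ((hd _ q hq).fun_mul (hd' _ q hq)), smul_apply]
      have := dDir_mul (hd ij.1 q hq) (hd' ij.2 q hq) (1, 0)
      rw [dDir] at this
      rw [this, Function.iterate_succ_apply', Function.iterate_succ_apply', smul_add,
        Nat.choose_symm_of_eq_add (Finset.HasAntidiagonal.mem_antidiagonal.1 hij).symm, add_comm]
      rfl
  intro q hq
  refine (key hq).trans ?_
  simp only
  rw [Finset.Nat.sum_antidiagonal_eq_sum_range_succ_mk]
  simp only [Nat.cast_smul_eq_nsmul]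

end iterate

theorem taylorSum_congr {s : Gr N} {a b : ℕ → Gr N} (h : ∀ k, a k = b k) :
    taylorSum s a = taylorSum s b := by rw [funext h]

/-- The derivative of a Taylor sum whose coefficients also depend on the variables explicitly. -/
theorem taylorSum_telescope_add {s : Gr N} (hs : IsEven s) (h0 : s ^ (N + 1) = 0) (s' b r : Gr N)
    (c : ℝ) (a d e : ℕ → Gr N) :
    ∑ k ∈ Finset.range (N + 2), ((k ! : ℝ)⁻¹) • ((k : ℝ) • (s' * s ^ (k - 1)) * a k
        + s ^ k * (b * a (k + 1) + (c • d k + r * e k)))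
      = (s' + b) * taylorSum s (fun k => a (k + 1)) + (c • taylorSum s d + r * taylorSum s e) := by
  rw [← taylorSum_telescope h0 s' b (hs.comm b), taylorSum, taylorSum, Finset.mul_sum,
    Finset.smul_sum, ← Finset.sum_add_distrib, ← Finset.sum_add_distrib]
  refine Finset.sum_congr rfl fun k _ => ?_
  have h : s ^ k * (r * e k) = r * (s ^ k * e k) := by
    rw [← mul_assoc, (hs.pow k).comm, mul_assoc]
  rw [mul_add, mul_add, mul_smul_comm, h, ← add_assoc, smul_add, smul_add, smul_comm c,
    mul_smul_comm, smul_add]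

section pull
variable {V : Set (ℝ × ℝ)} {Y R F G : SField N} {p : ℝ × ℝ}

theorem pull_congr (hV : IsOpen V) (hp : bodyMap Y p ∈ V) (h : Set.EqOn F G V) :
    pull Y R F p = pull Y R G p :=
  taylorSum_congr fun k => by rw [iterate_dX_congr hV h k hp]

theorem pull_add (hV : IsOpen V) (hp : bodyMap Y p ∈ V) (hF : ContDiffOn ℝ ∞ F V)
    (hG : ContDiffOn ℝ ∞ G V) :
    pull Y R (fun z => F z + G z) p = pull Y R F p + pull Y R G p := by
  simp only [pull, iterate_dX_add hV hF hG _ hp, substTheta_add, mul_add, smul_add,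
    Finset.sum_add_distrib]

theorem pull_const (a : Gr N) : pull Y R (fun _ => a) p = substTheta (R p) a := by
  rw [pull, Finset.sum_range_succ', Finset.sum_eq_zero]
  · simp
  · intro k _
    rw [iterate_dX_const]
    simp [substTheta]

/-- Substitution is multiplicative. -/
theorem pull_mul (hV : IsOpen V) (hp : bodyMap Y p ∈ V) (hY : IsEven (Y p)) (hR : IsOdd (R p))
    (hF : ContDiffOn ℝ ∞ F V) (hG : ContDiffOn ℝ ∞ G V) :
    pull Y R (fun z => F z * G z) p = pull Y R F p * pull Y R G p := by
  simp only [pull_eq]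
  rw [taylorSum_mul (isEven_soul hY) (pow_eq_zero_of_le (Nat.le_succ _) hY.soul_pow_eq_zero)]
  refine taylorSum_congr fun k => ?_
  rw [iterate_dX_mul hV hF hG k hp]
  simp only [← substTheta_mul hR, ← substTheta_smul]
  induction Finset.range (k + 1) using Finset.induction_on with
  | empty => simp [substTheta]
  | insert a s ha ih => rw [Finset.sum_insert ha, Finset.sum_insert ha, substTheta_add, ih]

theorem gradeInv_pull (hV : IsOpen V) (hp : bodyMap Y p ∈ V) (hY : IsEven (Y p))
    (hR : IsOdd (R p)) (hF : ContDiffOn ℝ ∞ F V) :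
    gradeInv N (pull Y R F p) = pull Y R (fun z => gradeInv N (F z)) p := by
  rw [pull, pull, map_sum]
  refine Finset.sum_congr rfl fun k _ => ?_
  rw [map_smul, map_mul, isEven_iff.1 ((isEven_soul hY).pow k), gradeInv_substTheta hR]
  congr 3
  exact (iterate_dX_linear (gradeInv N).toLinearMap hV hF k hp).symm

theorem body_pull (hR : IsOdd (R p)) : body (pull Y R F p) = body (F (bodyMap Y p)) := by
  rw [body_eq, pull, map_sum, Finset.sum_eq_single 0]
  · simp [bodyHom_substTheta hR, body_eq]
  · intro k _ hk
    simp [hk]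
  · simp

/-- The substitution of the superderivative, in terms of the left derivative in the odd variable. -/
theorem pull_sD (hV : IsOpen V) (hp : bodyMap Y p ∈ V) (hY : IsEven (Y p)) (hR : IsOdd (R p))
    (hF : ContDiffOn ℝ ∞ F V) : pull Y R (sD F) p
      = pull Y R (fun z => dTheta (F z)) p + R p * pull Y R (dX F) p := by
  have h := pull_mul hV hp hY hR (F := fun _ => theta) contDiffOn_const (contDiffOn_dX hV hF)
  rw [pull_const, substTheta_theta] at h
  rw [← h, ← pull_add hV hp (contDiffOn_dTheta hF) (contDiffOn_const.mul (contDiffOn_dX hV hF))]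
  rfl

theorem differentiableAt_bodyMap (hY : DifferentiableAt ℝ Y p) :
    DifferentiableAt ℝ (bodyMap Y) p :=
  (differentiableAt_body hY).prodMk differentiableAt_snd

theorem fderiv_bodyMap (hY : DifferentiableAt ℝ Y p) (v : ℝ × ℝ) :
    fderiv ℝ (bodyMap Y) p v = (body (dDir v Y p), v.2) := by
  have h := (differentiableAt_body hY).fderiv_prodMk (differentiableAt_snd (𝕜 := ℝ) (p := p))
  refine (congrArg (fun l => l v) h).trans ?_
  rw [ContinuousLinearMap.prod_apply, fderiv_body hY, fderiv_snd]
  rfl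

theorem dDir_comp_bodyMap (hY : DifferentiableAt ℝ Y p) (hF : DifferentiableAt ℝ F (bodyMap Y p))
    (v : ℝ × ℝ) : dDir v (fun z => F (bodyMap Y z)) p
      = body (dDir v Y p) • dX F (bodyMap Y p) + v.2 • dT F (bodyMap Y p) := by
  have h := fderiv_comp p hF (differentiableAt_bodyMap hY)
  refine (congrArg (fun l => l v) h).trans ?_
  rw [ContinuousLinearMap.comp_apply, fderiv_bodyMap hY, dX, dT, ← map_smul, ← map_smul, ← map_add]
  congr 1
  simp

theorem differentiableAt_substTheta (hR : DifferentiableAt ℝ R p) (hF : DifferentiableAt ℝ F p) :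
    DifferentiableAt ℝ (fun z => substTheta (R z) (F z)) p :=
  hF.fun_add ((hR.fun_sub (differentiableAt_const _)).fun_mul
    ((LinearMap.toContinuousLinearMap (dThetaL N)).differentiableAt.comp p hF))

theorem dDir_substTheta (hR : DifferentiableAt ℝ R p) (hF : DifferentiableAt ℝ F p) (v : ℝ × ℝ) :
    dDir v (fun z => substTheta (R z) (F z)) p
      = substTheta (R p) (dDir v F p) + dDir v R p * dTheta (F p) := by
  have hd : DifferentiableAt ℝ (fun z => dTheta (F z)) p :=
    (LinearMap.toContinuousLinearMap (dThetaL N)).differentiableAt.comp p hF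
  have hr : DifferentiableAt ℝ (fun z => R z - theta) p := hR.fun_sub (differentiableAt_const _)
  refine (dDir_add hF (hr.fun_mul hd) v).trans ?_
  rw [dDir_mul hr hd, dDir_dTheta hF, substTheta]
  have : dDir v (fun z => R z - theta) p = dDir v R p := by simp only [dDir, fderiv_sub_const]
  rw [this]
  abel

/-- The chain rule for derivatives in the even variables. -/
theorem dDir_pull (hV : IsOpen V) (hp : bodyMap Y p ∈ V) (hY : DifferentiableAt ℝ Y p)
    (hR : DifferentiableAt ℝ R p) (hYe : IsEven (Y p)) (hF : ContDiffOn ℝ ∞ F V) (v : ℝ × ℝ) :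
    dDir v (pull Y R F) p = dDir v Y p * pull Y R (dX F) p
      + dDir v R p * pull Y R (fun z => dTheta (F z)) p + v.2 • pull Y R (dT F) p := by
  have hse := isEven_soul hYe
  have hFk : ∀ k, DifferentiableAt ℝ (dX^[k] F) (bodyMap Y p) := fun k =>
    diffAt hV (contDiffOn_iterate_dX hV hF k) hp
  have hc : ∀ k, DifferentiableAt ℝ (fun z => dX^[k] F (bodyMap Y z)) p := fun k =>
    (hFk k).comp p (differentiableAt_bodyMap hY)
  have hA : ∀ k, dDir v (fun z => substTheta (R z) (dX^[k] F (bodyMap Y z))) p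
      = algebraMap ℝ (Gr N) (body (dDir v Y p)) * substTheta (R p) (dX^[k + 1] F (bodyMap Y p))
        + (v.2 • substTheta (R p) (dX^[k] (dT F) (bodyMap Y p))
        + dDir v R p * substTheta (R p) (dX^[k] (fun z => dTheta (F z)) (bodyMap Y p))) := by
    intro k
    rw [dDir_substTheta hR (hc k), dDir_comp_bodyMap hY (hFk k), substTheta_add, substTheta_smul,
      substTheta_smul, Function.iterate_succ_apply', ← Algebra.smul_def, add_assoc,
      dT_eq_dDir, iterate_dX_dDir hV hF _ _ hp]
    congr 3
    have h := iterate_dX_linear (dThetaL N) hV hF k hp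
    rw [← substTheta_dTheta (R p)]
    exact congrArg _ h.symm
  refine (dDir_taylorSum (differentiableAt_soul hY) hse
    (fun k => differentiableAt_substTheta hR (hc k)) v).trans ?_
  simp only [hA]
  rw [taylorSum_telescope_add hse hYe.soul_pow_eq_zero, dDir_soul hY,
    add_comm (soul (dDir v Y p))]
  have hbs := body_add_soul (dDir v Y p)
  rw [hbs, add_assoc, add_comm (dDir v R p * _)]
  rfl

/-- The chain rule for the derivative in the odd variable. -/
theorem dTheta_pull (hV : IsOpen V) (hp : bodyMap Y p ∈ V) (hYe : IsEven (Y p))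
    (hF : ContDiffOn ℝ ∞ F V) :
    dTheta (pull Y R F p) = dTheta (Y p) * pull Y R (dX F) p
      + dTheta (R p) * pull Y R (fun z => dTheta (F z)) p := by
  have hse := isEven_soul hYe
  have hA : ∀ k, dTheta (substTheta (R p) (dX^[k] F (bodyMap Y p)))
      = 0 * substTheta (R p) (dX^[k + 1] F (bodyMap Y p)) + ((0 : ℝ) • (0 : Gr N)
        + dTheta (R p) * substTheta (R p) (dX^[k] (fun z => dTheta (F z)) (bodyMap Y p))) := by
    intro k
    rw [dTheta_substTheta, zero_mul, zero_smul, zero_add, zero_add]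
    congr 1
    have h := iterate_dX_linear (dThetaL N) hV hF k hp
    rw [← substTheta_dTheta (R p)]
    exact congrArg _ h.symm
  rw [pull_eq, dTheta_taylorSum hse]
  simp only [hA]
  rw [taylorSum_telescope_add hse hYe.soul_pow_eq_zero, zero_smul, zero_add, add_zero]
  simp only [soul, dTheta_sub, dTheta_algebraMap, sub_zero]
  rfl

/-- The chain rule for the superderivative. -/
theorem sD_pull (hV : IsOpen V) (hp : bodyMap Y p ∈ V) (hY : DifferentiableAt ℝ Y p)
    (hR : DifferentiableAt ℝ R p) (hYe : IsEven (Y p)) (hF : ContDiffOn ℝ ∞ F V) :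
    sD (pull Y R F) p = sD Y p * pull Y R (dX F) p
      + sD R p * pull Y R (fun z => dTheta (F z)) p := by
  simp only [sD, dX_eq_dDir, dDir_pull hV hp hY hR hYe hF, dTheta_pull hV hp hYe hF, zero_smul,
    add_zero, add_mul, mul_add, mul_assoc]
  abel

end pull

section smooth
variable {Ω V : Set (ℝ × ℝ)} {Y R F G : SField N} {p q : ℝ × ℝ}

theorem contDiffOn_substTheta (hR : ContDiffOn ℝ ∞ R Ω) (hF : ContDiffOn ℝ ∞ F Ω) :
    ContDiffOn ℝ ∞ (fun z => substTheta (R z) (F z)) Ω :=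
  hF.add ((hR.sub contDiffOn_const).mul (contDiffOn_dTheta hF))

theorem contDiffOn_bodyMap (hY : ContDiffOn ℝ ∞ Y Ω) : ContDiffOn ℝ ∞ (bodyMap Y) Ω :=
  (contDiffOn_body hY).prodMk contDiffOn_snd

theorem contDiffOn_pull (hV : IsOpen V) (hm : Set.MapsTo (bodyMap Y) Ω V)
    (hY : ContDiffOn ℝ ∞ Y Ω) (hR : ContDiffOn ℝ ∞ R Ω) (hF : ContDiffOn ℝ ∞ F V) :
    ContDiffOn ℝ ∞ (pull Y R F) Ω :=
  ContDiffOn.sum fun k _ => (((contDiffOn_soul hY).pow k).mul (contDiffOn_substTheta hR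
    ((contDiffOn_iterate_dX hV hF k).comp (contDiffOn_bodyMap hY) hm))).const_smul _

/-- The derivative of a superfield with values in a subspace has values in this subspace. -/
theorem dDir_mem (hV : IsOpen V) (hF : ContDiffOn ℝ ∞ F V) {W : Submodule ℝ (Gr N)}
    (h : ∀ q ∈ V, F q ∈ W) (hq : q ∈ V) (v : ℝ × ℝ) : dDir v F q ∈ W := by
  obtain ⟨g, hg⟩ := LinearMap.exists_leftInverse_of_injective W.subtype
    (LinearMap.ker_eq_bot.2 W.injective_subtype)
  have hL : ∀ a, (LinearMap.id - W.subtype.comp g : Gr N →ₗ[ℝ] Gr N) a = 0 ↔ a ∈ W := by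
    intro a
    refine ⟨fun ha => ?_, fun ha => ?_⟩
    · have : a = W.subtype (g a) := sub_eq_zero.1 ha
      exact this ▸ (g a).2
    · have : g a = ⟨a, ha⟩ := LinearMap.congr_fun hg ⟨a, ha⟩
      simp [this]
  rw [← hL, ← dDir_linear _ (diffAt hV hF hq),
    dDir_congr (G := fun _ => 0) hV (fun z hz => (hL _).2 (h z hz)) hq]
  simp [dDir]

theorem iterate_dX_mem (hV : IsOpen V) (hF : ContDiffOn ℝ ∞ F V) {W : Submodule ℝ (Gr N)}
    (h : ∀ q ∈ V, F q ∈ W) (k : ℕ) : ∀ q ∈ V, dX^[k] F q ∈ W := by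
  induction k with
  | zero => exact h
  | succ k ih =>
    intro q hq
    rw [Function.iterate_succ_apply']
    exact dDir_mem hV (contDiffOn_iterate_dX hV hF k) ih hq _

/-- Up to terms of higher filtration the even variable is replaced by its body. -/
theorem pull_sub_mem_nilFil (hV : IsOpen V) (hp : bodyMap Y p ∈ V) (hY : IsEven (Y p))
    (hR : IsOdd (R p)) (hF : ContDiffOn ℝ ∞ F V) {k : ℕ} (h : ∀ q ∈ V, F q ∈ nilFil N k) :
    pull Y R F p - substTheta (R p) (F (bodyMap Y p)) ∈ nilFil N (k + 1) := by
  rw [pull, Finset.sum_range_succ']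
  simp only [Nat.factorial_zero, Nat.cast_one, inv_one, one_smul, pow_zero, one_mul,
    Function.iterate_zero, id, add_sub_cancel_right]
  refine Submodule.sum_mem _ fun j _ => Submodule.smul_mem _ _ ?_
  have := mul_mem_nilFil (pow_mem_nilFil hY.soul_mem_nilFil (j + 1))
    (substTheta_mem_nilFil hR (iterate_dX_mem hV hF h (j + 1) _ hp))
  exact nilFil_antitone (by omega) this

end smooth

/-! ### The inverse of a change of variables -/

/-- The odd element whose substitution is inverse to that of `r`.  If `r = α + θ c` with `α`, `c`
free of `θ`, then `θ = (r - α) c⁻¹`; exchanging the roles of `r` and `θ` gives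
`(θ - α) c⁻¹ = θ + (θ - r) c⁻¹`. -/
def oddInv (r : Gr N) : Gr N := theta + (theta - r) * Ring.inverse (dTheta r)

section oddInv
variable {r : Gr N}

theorem isEven_inverse {a : Gr N} (ha : IsEven a) (hu : IsUnit a) : IsEven (Ring.inverse a) := by
  have h := congrArg (gradeInv N) (Ring.mul_inverse_cancel a hu)
  rw [map_mul, isEven_iff.1 ha, map_one] at h
  rw [isEven_iff]
  exact hu.mul_left_cancel (h.trans (Ring.mul_inverse_cancel a hu).symm)

theorem isOdd_oddInv (hr : IsOdd r) (hu : IsUnit (dTheta r)) : IsOdd (oddInv r) :=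
  isOdd_theta.add ((isOdd_theta.sub hr).mul_even (isEven_inverse hr.dTheta hu))

theorem dTheta_oddInv (hu : IsUnit (dTheta r)) :
    dTheta (oddInv r) = Ring.inverse (dTheta r) := by
  have hc : dTheta (Ring.inverse (dTheta r)) = 0 := by
    have h := congrArg dTheta (Ring.inverse_mul_cancel _ hu)
    rw [dTheta_mul, dTheta_dTheta, mul_zero, add_zero, dTheta_one] at h
    exact hu.mul_right_cancel (h.trans (zero_mul _).symm)
  rw [oddInv, dTheta_add, dTheta_mul, hc, mul_zero, add_zero, dTheta_sub, dTheta_theta, sub_mul,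
    Ring.mul_inverse_cancel _ hu, one_mul, add_sub_cancel]

theorem substTheta_oddInv (hu : IsUnit (dTheta r)) (a : Gr N) :
    substTheta r (substTheta (oddInv r) a) = a := by
  rw [substTheta, dTheta_substTheta, dTheta_oddInv hu, substTheta, oddInv]
  simp only [add_sub_cancel_left, ← mul_assoc, add_assoc, ← add_mul]
  simp

theorem oddInv_substTheta (hu : IsUnit (dTheta r)) (a : Gr N) :
    substTheta (oddInv r) (substTheta r a) = a := by
  rw [substTheta, dTheta_substTheta, substTheta, oddInv]
  simp only [add_sub_cancel_left, add_assoc]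
  rw [mul_assoc, ← mul_assoc (Ring.inverse _), Ring.inverse_mul_cancel _ hu, one_mul, ← add_mul]
  simp

theorem contDiffOn_oddInv {Ω : Set (ℝ × ℝ)} {R : SField N} (hR : ContDiffOn ℝ ∞ R Ω)
    (hu : ∀ p ∈ Ω, IsUnit (dTheta (R p))) : ContDiffOn ℝ ∞ (fun p => oddInv (R p)) Ω := by
  have : CompleteSpace (Gr N) := FiniteDimensional.complete ℝ (Gr N)
  refine contDiffOn_const.add ((contDiffOn_const.sub hR).mul fun p hp => ?_)
  obtain ⟨u, h⟩ := hu p hp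
  have h2 : ContDiffAt ℝ ∞ Ring.inverse (dTheta (R p)) := h ▸ contDiffAt_ringInverse ℝ u
  exact h2.comp_contDiffWithinAt p (contDiffOn_dTheta hR p hp)

end oddInv

namespace IsSuperChange
variable {Ω : Set (ℝ × ℝ)} {Y R F : SField N}

theorem isUnit_dTheta (h : IsSuperChange Ω Y R) {p : ℝ × ℝ} (hp : p ∈ Ω) :
    IsUnit (dTheta (R p)) := isUnit_of_body_ne_zero (h.nondegR p hp)

/-- The derivative of the underlying map is triangular with diagonal entries
`∂ₓ(body of y)` and `1`. -/
theorem exists_hasFDerivAt (hΩ : IsOpen Ω) (h : IsSuperChange Ω Y R) {p : ℝ × ℝ}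
    (hp : p ∈ Ω) : ∃ e : (ℝ × ℝ) ≃L[ℝ] (ℝ × ℝ),
      HasFDerivAt (bodyMap Y) (e : (ℝ × ℝ) →L[ℝ] (ℝ × ℝ)) p := by
  have hd := differentiableAt_bodyMap (diffAt hΩ h.smoothY hp)
  have hinj : Function.Injective (fderiv ℝ (bodyMap Y) p).toLinearMap := by
    rw [← LinearMap.ker_eq_bot, LinearMap.ker_eq_bot']
    intro v hv
    have hv' : fderiv ℝ (bodyMap Y) p v = 0 := hv
    rw [fderiv_bodyMap (diffAt hΩ h.smoothY hp), Prod.mk_eq_zero] at hv'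
    obtain ⟨v1, v2⟩ := v
    obtain ⟨h1, h2⟩ := hv'
    simp only at h2
    subst h2
    have : dDir (v1, 0) Y p = v1 • dX Y p := by
      rw [dX, ← map_smul]; simp [dDir]
    rw [this, body_eq, map_smul, smul_eq_mul, ← body_eq] at h1
    rw [(mul_eq_zero.1 h1).resolve_right (h.nondegY p hp)]
    rfl
  refine ⟨(LinearEquiv.ofInjectiveEndo _ hinj).toContinuousLinearEquiv, ?_⟩
  convert hd.hasFDerivAt using 1
  ext <;> rfl

theorem isOpen_image (hΩ : IsOpen Ω) (h : IsSuperChange Ω Y R) : IsOpen (bodyMap Y '' Ω) := by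
  rw [isOpen_iff_mem_nhds]
  rintro _ ⟨p, hp, rfl⟩
  obtain ⟨e, he⟩ := h.exists_hasFDerivAt hΩ hp
  have hc := (contDiffOn_bodyMap h.smoothY).contDiffAt (hΩ.mem_nhds hp)
  have hs := hc.hasStrictFDerivAt' he (by simp)
  rw [← hs.map_nhds_eq_of_equiv]
  exact Filter.image_mem_map (hΩ.mem_nhds hp)

theorem contDiffOn_invFunOn (hΩ : IsOpen Ω) (h : IsSuperChange Ω Y R) :
    ContDiffOn ℝ ∞ (Function.invFunOn (bodyMap Y) Ω) (bodyMap Y '' Ω) := by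
  rintro _ ⟨p, hp, rfl⟩
  obtain ⟨e, he⟩ := h.exists_hasFDerivAt hΩ hp
  have hc := (contDiffOn_bodyMap h.smoothY).contDiffAt (hΩ.mem_nhds hp)
  have hs := hc.hasStrictFDerivAt' he (by simp)
  have hl := hc.to_localInverse he (by simp)
  refine ContDiffAt.contDiffWithinAt (hl.congr_of_eventuallyEq ?_)
  -- By injectivity the global inverse agrees with the local one of the inverse function theorem.
  have h1 := hs.eventually_right_inverse
  have h2 := hl.continuousAt.eventually
    (p := fun z => z ∈ Ω) (by
      have : hc.localInverse he (by simp) (bodyMap Y p) = p :=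
        hc.localInverse_apply_image he (by simp)
      rw [this]
      exact hΩ.mem_nhds hp)
  filter_upwards [h1, h2] with q hq1 hq2
  refine h.inj ?_ hq2 ?_
  · exact Function.invFunOn_mem ⟨_, hq2, hq1⟩
  · exact (Function.invFunOn_eq ⟨_, hq2, hq1⟩).trans hq1.symm

/-- If the substituted superfield vanishes, then by induction every value lies in every step of the
filtration, because to leading order substitution is invertible. -/
theorem pull_injective (hΩ : IsOpen Ω) (h : IsSuperChange Ω Y R)
    (hF : ContDiffOn ℝ ∞ F (bodyMap Y '' Ω)) (h0 : ∀ p ∈ Ω, pull Y R F p = 0) :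
    ∀ q ∈ bodyMap Y '' Ω, F q = 0 := by
  have key : ∀ k, ∀ q ∈ bodyMap Y '' Ω, F q ∈ nilFil N k := by
    intro k
    induction k with
    | zero => intro q _; rw [nilFil_zero]; trivial
    | succ k ih =>
      rintro _ ⟨p, hp, rfl⟩
      have h1 := pull_sub_mem_nilFil (h.isOpen_image hΩ) (Set.mem_image_of_mem _ hp) (h.evenY p hp)
        (h.oddR p hp) hF ih
      rw [h0 p hp, zero_sub, Submodule.neg_mem_iff] at h1
      have h2 := substTheta_mem_nilFil (isOdd_oddInv (h.oddR p hp) (h.isUnit_dTheta hp)) h1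
      rwa [oddInv_substTheta (h.isUnit_dTheta hp)] at h2
  intro q hq
  have := key (N + 2) q hq
  rwa [nilFil_eq_bot le_rfl, Submodule.mem_bot] at this

/-- A superfield of the old variables is a superfield of the new ones.  The solution is approximated
step by step along the filtration, inverting the leading order of the substitution each time. -/
theorem exists_pull_eq (hΩ : IsOpen Ω) (h : IsSuperChange Ω Y R) {G : SField N}
    (hG : ContDiffOn ℝ ∞ G Ω) :
    ∃ F, ContDiffOn ℝ ∞ F (bodyMap Y '' Ω) ∧ ∀ p ∈ Ω, pull Y R F p = G p := by
  have hV := h.isOpen_image hΩ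
  have hm : Set.MapsTo (bodyMap Y) Ω (bodyMap Y '' Ω) := Set.mapsTo_image _ _
  suffices key : ∀ j k, N + 2 ≤ j + k → ∀ G : SField N, ContDiffOn ℝ ∞ G Ω →
      (∀ p ∈ Ω, G p ∈ nilFil N k) →
      ∃ F, ContDiffOn ℝ ∞ F (bodyMap Y '' Ω) ∧ ∀ p ∈ Ω, pull Y R F p = G p from
    key (N + 2) 0 le_rfl G hG fun p _ => by rw [nilFil_zero]; trivial
  intro j
  induction j with
  | zero =>
    intro k hk G hG hGk
    refine ⟨fun _ => 0, contDiffOn_const, fun p hp => ?_⟩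
    have := hGk p hp
    rw [nilFil_eq_bot (by omega), Submodule.mem_bot] at this
    rw [this, pull_const]
    simp [substTheta]
  | succ j ih =>
    intro k hk G hG hGk
    set g := Function.invFunOn (bodyMap Y) Ω with hg
    have hgm : Set.MapsTo g (bodyMap Y '' Ω) Ω := fun q hq => Function.invFunOn_mem hq
    have hgl : ∀ p ∈ Ω, g (bodyMap Y p) = p := fun p hp => h.inj.leftInvOn_invFunOn hp
    have hgs := h.contDiffOn_invFunOn hΩ
    -- `F₀` solves the equation to leading order; the remainder is one step further down.
    set F₀ : SField N := fun q => substTheta (oddInv (R (g q))) (G (g q)) with hF₀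
    have hF₀s : ContDiffOn ℝ ∞ F₀ (bodyMap Y '' Ω) :=
      (contDiffOn_substTheta (contDiffOn_oddInv h.smoothR fun p hp => h.isUnit_dTheta hp) hG).comp
        hgs hgm
    have hF₀k : ∀ q ∈ bodyMap Y '' Ω, F₀ q ∈ nilFil N k := fun q hq =>
      substTheta_mem_nilFil (isOdd_oddInv (h.oddR _ (hgm hq)) (h.isUnit_dTheta (hgm hq)))
        (hGk _ (hgm hq))
    have hps := contDiffOn_pull hV hm h.smoothY h.smoothR hF₀s
    obtain ⟨F₁, hF₁, hF₁'⟩ := ih (k + 1) (by omega) (fun p => G p - pull Y R F₀ p)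
      (hG.sub hps) (fun p hp => by
        have h1 := pull_sub_mem_nilFil hV (hm hp) (h.evenY p hp) (h.oddR p hp) hF₀s hF₀k
        simp only [hF₀, hgl p hp, substTheta_oddInv (h.isUnit_dTheta hp)] at h1
        rw [← neg_sub]
        exact Submodule.neg_mem _ h1)
    refine ⟨fun q => F₀ q + F₁ q, hF₀s.add hF₁, fun p hp => ?_⟩
    rw [pull_add hV (hm hp) hF₀s hF₁, hF₁' p hp, add_sub_cancel]

end IsSuperChange

/-! ### A super Poincaré lemma -/

section poincare
variable {Ω : Set (ℝ × ℝ)} {A B G H : SField N}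

theorem dDir_eq_dX_add_dT (F : SField N) (q v : ℝ × ℝ) :
    dDir v F q = v.1 • dX F q + v.2 • dT F q := by
  rw [dDir, dX, dT, ← map_smul, ← map_smul, ← map_add]
  congr 1
  simp

/-- A closed one-form on a convex domain is exact. -/
theorem exists_dX_eq_dT_eq (hΩ : IsOpen Ω) (hc : Convex ℝ Ω) (hA : ContDiffOn ℝ ∞ A Ω)
    (hB : ContDiffOn ℝ ∞ B Ω) (h : ∀ p ∈ Ω, dT A p = dX B p) :
    ∃ F, ContDiffOn ℝ ∞ F Ω ∧ ∀ p ∈ Ω, dX F p = A p ∧ dT F p = B p := by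
  have : CompleteSpace (Gr N) := FiniteDimensional.complete ℝ (Gr N)
  set η : ℝ × ℝ → (ℝ × ℝ) →L[ℝ] Gr N := fun p =>
    (ContinuousLinearMap.fst ℝ ℝ ℝ).smulRight (A p)
      + (ContinuousLinearMap.snd ℝ ℝ ℝ).smulRight (B p) with hη
  have hηs : ContDiffOn ℝ ∞ η Ω :=
    (contDiffOn_const.smulRight hA).add (contDiffOn_const.smulRight hB)
  have hηd : ∀ p ∈ Ω, ∀ x y, fderiv ℝ η p x y
      = y.1 • dDir x A p + y.2 • dDir x B p := by
    intro p hp x y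
    have hd := ((hηs.contDiffAt (hΩ.mem_nhds hp)).differentiableAt (by simp)).hasFDerivAt
    have h1 := (hd.clm_apply (hasFDerivAt_const y p)).fderiv
    have h2 : fderiv ℝ η p x y = dDir x (fun q => y.1 • A q + y.2 • B q) p := by
      refine Eq.trans ?_ (congrArg (fun l => l x) h1).symm
      simp
    rw [h2, dDir_add ((diffAt hΩ hA hp).fun_const_smul _) ((diffAt hΩ hB hp).fun_const_smul _),
      dDir_smul _ (diffAt hΩ hA hp), dDir_smul _ (diffAt hΩ hB hp)]
  obtain ⟨F, hF⟩ := hc.exists_forall_hasFDerivAt_of_fderiv_symmetric hΩ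
    (hηs.differentiableOn (by simp)) (fun p hp x y => by
      simp only [hηd p hp, dDir_eq_dX_add_dT, h p hp]
      module)
  refine ⟨F, ?_, fun p hp => ?_⟩
  · refine (contDiffOn_infty_iff_fderiv_of_isOpen hΩ).2
      ⟨fun p hp => (hF p hp).differentiableAt.differentiableWithinAt, ?_⟩
    exact hηs.congr fun p hp => (hF p hp).fderiv
  · rw [dX, dT, (hF p hp).fderiv]
    simp [hη]

/-- The system `𝒟 F = H`, `∂ₜ F = G` is solvable over a convex domain if it is integrable. -/
theorem exists_sD_eq_dT_eq (hΩ : IsOpen Ω) (hc : Convex ℝ Ω) (hH : ContDiffOn ℝ ∞ H Ω)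
    (hG : ContDiffOn ℝ ∞ G Ω) (h : ∀ p ∈ Ω, sD G p = dT H p) :
    ∃ F, ContDiffOn ℝ ∞ F Ω ∧ ∀ p ∈ Ω, sD F p = H p ∧ dT F p = G p := by
  have hθ : ∀ {F : SField N} {p : ℝ × ℝ} (v : ℝ × ℝ), DifferentiableAt ℝ F p →
      dDir v (fun z => theta * F z) p = theta * dDir v F p := by
    intro F p v hF
    rw [dDir_mul (differentiableAt_const _) hF]
    simp [dDir]
  -- The component of `F` free of `θ` has derivatives `dTheta H` and `G - θ dTheta G`.  The
  -- condition of integrability says that these are compatible, and that adding `θ H` to the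
  -- component gives a superfield with the prescribed derivatives.
  have hHs := contDiffOn_dTheta hH
  have hGs := contDiffOn_dTheta hG
  have hBs : ContDiffOn ℝ ∞ (fun q => G q - theta * dTheta (G q)) Ω :=
    hG.sub (contDiffOn_const.mul hGs)
  have hsub : ∀ {F : SField N} {p : ℝ × ℝ} (v : ℝ × ℝ), DifferentiableAt ℝ F p →
      dDir v (fun z => F z - theta * dTheta (F z)) p
        = dDir v F p - theta * dTheta (dDir v F p) := by
    intro F p v hF
    have hd : DifferentiableAt ℝ (fun z => dTheta (F z)) p :=
      (LinearMap.toContinuousLinearMap (dThetaL N)).differentiableAt.comp p hF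
    rw [← dDir_dTheta hF, ← hθ v hd, dDir, fderiv_fun_sub hF
      ((differentiableAt_const _).fun_mul hd)]
    rfl
  obtain ⟨F₀, hF₀, hF₀'⟩ := exists_dX_eq_dT_eq hΩ hc hHs hBs fun p hp => by
    have h1 := congrArg dTheta (h p hp)
    have hHd := diffAt hΩ hH hp
    rw [sD, dTheta_add, dTheta_mul, dTheta_dTheta, dTheta_theta, gradeInv_theta, one_mul, zero_add,
      neg_mul, ← sub_eq_add_neg] at h1
    rw [dX_eq_dDir, hsub _ (diffAt hΩ hG hp), dT_eq_dDir, dDir_dTheta hHd]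
    exact h1.symm
  -- The primitive may contain `θ`; subtracting `θ dTheta F₀` removes it.
  have hF₁ : ContDiffOn ℝ ∞ (fun q => F₀ q - theta * dTheta (F₀ q)) Ω :=
    hF₀.sub (contDiffOn_const.mul (contDiffOn_dTheta hF₀))
  refine ⟨fun q => F₀ q - theta * dTheta (F₀ q) + theta * H q,
    hF₁.add (contDiffOn_const.mul hH), fun p hp => ?_⟩
  have hHd := diffAt hΩ hH hp
  have hd : ∀ v, dDir v (fun q => F₀ q - theta * dTheta (F₀ q) + theta * H q) p
      = dDir v F₀ p - theta * dTheta (dDir v F₀ p) + theta * dDir v H p := by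
    intro v
    rw [dDir_add (diffAt hΩ hF₁ hp) ((differentiableAt_const _).fun_mul hHd), hθ v hHd,
      hsub v (diffAt hΩ hF₀ hp)]
  obtain ⟨hX, hT⟩ := hF₀' p hp
  have hh := h p hp
  constructor
  · rw [sD, dX_eq_dDir, hd, ← dX_eq_dDir, hX, dTheta_dTheta, mul_zero, sub_zero, mul_add,
      ← mul_assoc, theta_mul_theta, zero_mul, add_zero, dTheta_add, dTheta_sub, dTheta_mul,
      dTheta_mul, dTheta_dTheta, dTheta_theta, gradeInv_theta, mul_zero, add_zero, one_mul,
      one_mul, sub_self, zero_add, neg_mul, neg_add_cancel_right]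
  · rw [dT_eq_dDir, hd, ← dT_eq_dDir, hT, ← hh, sD, dTheta_sub, dTheta_mul, dTheta_dTheta,
      dTheta_theta, gradeInv_theta, mul_zero, add_zero, one_mul, sub_self, mul_zero, sub_zero,
      mul_add, ← mul_assoc, theta_mul_theta, zero_mul, add_zero, sub_add_cancel]

end poincare

/-! ### Powers and logarithms in the algebra of smooth superfields -/

section powers
variable {V : Set (ℝ × ℝ)} {F : SField N}

theorem contDiffOn_gPow (hF : ContDiffOn ℝ ∞ F V) (hp : ∀ q ∈ V, 0 < body (F q)) (r : ℝ) :
    ContDiffOn ℝ ∞ (fun q => gPow (F q) r) V :=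
  contDiffOn_gEval isOpen_Ioi (contDiffOn_rpow r) hF hp

theorem contDiffOn_gLog (hF : ContDiffOn ℝ ∞ F V) (hp : ∀ q ∈ V, 0 < body (F q)) :
    ContDiffOn ℝ ∞ (fun q => gLog (F q)) V :=
  contDiffOn_gEval isOpen_Ioi contDiffOn_log hF hp

theorem IsEven.gPow {a : Gr N} (ha : IsEven a) (r : ℝ) : IsEven (gPow a r) := isEven_gEval _ ha

theorem gPow_neg_two {a : Gr N} (ha : IsEven a) (hp : 0 < body a) :
    gPow a (-2) = gPow a (-1) * gPow a (-1) := by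
  rw [gPow_mul ha hp]; norm_num

theorem gPow_neg_three {a : Gr N} (ha : IsEven a) (hp : 0 < body a) :
    gPow a (-3) = gPow a (-1) * gPow a (-1) * gPow a (-1) := by
  rw [gPow_mul ha hp, gPow_mul ha hp]; norm_num

theorem mul_gPow_neg_one {a : Gr N} (ha : IsEven a) (hp : 0 < body a) :
    a * gPow a (-1) = 1 := by
  nth_rw 1 [← gPow_one a]
  rw [gPow_mul ha hp, add_neg_cancel, gPow_zero]

theorem gPow_neg_half_mul_self {a : Gr N} (ha : IsEven a) (hp : 0 < body a) :
    gPow a (-1 / 2) * gPow a (-1 / 2) = gPow a (-1) := by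
  rw [gPow_mul ha hp]; norm_num

theorem gPow_three_halves {a : Gr N} (ha : IsEven a) (hp : 0 < body a) :
    gPow a (3 / 2) = a * a * gPow a (-1 / 2) := by
  have h : a * a * gPow a (-1 / 2) = gPow a 1 * gPow a 1 * gPow a (-1 / 2) := by rw [gPow_one]
  rw [h, gPow_mul ha hp, gPow_mul ha hp]; norm_num

theorem eq_of_mul_eq_one {a b c : Gr N} (ha : IsEven a) (hb : a * b = 1) (hc : a * c = 1) :
    b = c := by
  have hba : b * a = 1 := by rw [← ha.comm, hb]
  rw [← mul_one b, ← hc, ← mul_assoc, hba, one_mul]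

theorem gPow_neg_half_neg_two {a : Gr N} (ha : IsEven a) (hp : 0 < body a) :
    gPow (gPow a (-1 / 2)) (-2) = a := by
  have hb := ha.gPow (-1 / 2)
  have hbp := body_gPow_pos hp (-1 / 2)
  refine eq_of_mul_eq_one (ha.gPow (-1)) ?_ ?_
  · rw [← gPow_neg_half_mul_self ha hp]
    have h1 : ∀ b : Gr N, b * b * gPow b (-2) = gPow b 1 * gPow b 1 * gPow b (-2) := by
      simp only [gPow_one, implies_true]
    rw [h1, gPow_mul hb hbp, gPow_mul hb hbp]
    norm_num [gPow_zero]
  · rw [← ha.comm, mul_gPow_neg_one ha hp]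

/-- Square roots with positive body are unique. -/
theorem eq_of_mul_self_eq {a b : Gr N} (ha : IsEven a) (hap : 0 < body a)
    (hbp : 0 < body b) (h : a * a = b * b) : a = b := by
  have hu : IsUnit (a + b) := isUnit_of_body_ne_zero (by
    rw [body_eq] at hap hbp ⊢
    rw [map_add]
    positivity)
  rw [← sub_eq_zero]
  refine hu.mul_left_cancel ?_
  rw [mul_zero, add_mul, mul_sub, mul_sub, h, ha.comm b]
  abel

end powers

namespace SmoothField
open SuperDiffAlg
variable {V : TopologicalSpace.Opens (ℝ × ℝ)} {F G : SField N}

theorem res_pow (hF : ContDiffOn ℝ ∞ F V) (n : ℕ) :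
    res F hF ^ n = res (fun q => F q ^ n) (hF.pow n) := rfl

theorem res_sub (hF : ContDiffOn ℝ ∞ F V) (hG : ContDiffOn ℝ ∞ G V) :
    res F hF - res G hG = res (fun q => F q - G q) (hF.sub hG) := rfl

theorem isLog_gLog (hF : ContDiffOn ℝ ∞ F V) (he : ∀ q ∈ V, IsEven (F q))
    (hp : ∀ q ∈ V, 0 < body (F q)) :
    IsLog (res (fun q => gLog (F q)) (contDiffOn_gLog hF hp)) (res F hF) where
  even := (inv_res_eq_self _).2 fun q hq => isEven_gEval _ (he q hq)
  even_exp := (inv_res_eq_self _).2 he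
  D_exp := by
    rw [D_res, D_res, res_mul]
    refine res_eq_res.2 fun q hq => ?_
    have h := sD_gEval isOpen_Ioi contDiffOn_log (diffAt V.isOpen hF hq) (he q hq) (hp q hq)
    rw [gEval_deriv_log] at h
    change _ = F q * sD (fun z => gEval Real.log (F z)) q
    rw [h, ← mul_assoc, mul_gPow_neg_one (he q hq) (hp q hq), one_mul]
  T_exp := by
    rw [T_res, T_res, res_mul]
    refine res_eq_res.2 fun q hq => ?_
    have h := dDir_gEval isOpen_Ioi contDiffOn_log (diffAt V.isOpen hF hq) (he q hq) (hp q hq)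
      (0, 1)
    rw [gEval_deriv_log, ← ((he q hq).gPow (-1)).comm] at h
    change _ = F q * dDir (0, 1) (fun z => gEval Real.log (F z)) q
    rw [h, ← mul_assoc, mul_gPow_neg_one (he q hq) (hp q hq), one_mul]
    rfl

theorem isLog_gPow (hF : ContDiffOn ℝ ∞ F V) (he : ∀ q ∈ V, IsEven (F q))
    (hp : ∀ q ∈ V, 0 < body (F q)) (r : ℝ) :
    IsLog (r • res (fun q => gLog (F q)) (contDiffOn_gLog hF hp))
      (res (fun q => gPow (F q) r) (contDiffOn_gPow hF hp r)) where
  even := by rw [map_smul, (isLog_gLog hF he hp).even]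
  even_exp := (inv_res_eq_self _).2 fun q hq => (he q hq).gPow r
  D_exp := by
    rw [map_smul, D_res, D_res, res_smul, res_mul]
    refine res_eq_res.2 fun q hq => ?_
    have h := sD_gEval isOpen_Ioi contDiffOn_log (diffAt V.isOpen hF hq) (he q hq) (hp q hq)
    have h' := sD_gEval isOpen_Ioi (contDiffOn_rpow r) (diffAt V.isOpen hF hq) (he q hq) (hp q hq)
    rw [gEval_deriv_log] at h
    rw [gEval_deriv_rpow (hp q hq)] at h'
    refine h'.trans ?_
    change _ = gPow (F q) r * (r • sD (fun z => gEval Real.log (F z)) q)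
    rw [h, mul_smul_comm, ← mul_assoc, gPow_mul (he q hq) (hp q hq), smul_mul_assoc,
      sub_eq_add_neg]
  T_exp := by
    rw [map_smul, T_res, T_res, res_smul, res_mul]
    refine res_eq_res.2 fun q hq => ?_
    have h := dDir_gEval isOpen_Ioi contDiffOn_log (diffAt V.isOpen hF hq) (he q hq) (hp q hq)
      (0, 1)
    have h' := dDir_gEval isOpen_Ioi (contDiffOn_rpow r) (diffAt V.isOpen hF hq) (he q hq)
      (hp q hq) (0, 1)
    rw [gEval_deriv_log, ← ((he q hq).gPow _).comm] at h
    rw [gEval_deriv_rpow (hp q hq), mul_smul_comm, ← ((he q hq).gPow _).comm] at h'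
    refine h'.trans ?_
    change _ = gPow (F q) r * (r • dDir (0, 1) (fun z => gEval Real.log (F z)) q)
    rw [h, mul_smul_comm, ← mul_assoc, gPow_mul (he q hq) (hp q hq), sub_eq_add_neg]

end SmoothField

/-! ### The equations in the algebra of smooth superfields -/

namespace SmoothField
open SuperDiffAlg
variable {V : TopologicalSpace.Opens (ℝ × ℝ)} {F : SField N}

theorem susyHarryDym_iff (hF : ContDiffOn ℝ ∞ F V) : SusyHarryDym V F ↔
    T (res F hF) = (1 / 4 : ℝ) • (D (D (D (D (D (D (res F hF)))))) * res F hF ^ 3)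
      - (3 / 8 : ℝ) • (D (D (D (D (D (res F hF))))) * D (res F hF) * res F hF ^ 2) := by
  have h1 := contDiffOn_dX V.isOpen hF
  have h2 := contDiffOn_dX V.isOpen h1
  rw [← res_dX hF, ← res_dX h1, ← res_dX h2, D_res h2, D_res hF, T_res hF]
  simp only [res_mul, res_smul, res_pow, res_sub]
  exact res_eq_res.symm

theorem susySEquation_iff (hF : ContDiffOn ℝ ∞ F V) (he : ∀ q ∈ V, IsEven (F q))
    (hp : ∀ q ∈ V, 0 < body (F q)) {i : SmoothField N V}
    (hi : i = res (fun q => gPow (F q) (-1)) (contDiffOn_gPow hF hp (-1))) : SusySEquation V F ↔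
    T (res F hF) = (1 / 16 : ℝ) • ((4 : ℝ) • D (D (D (D (D (D (res F hF))))))
      - (12 : ℝ) • (D (D (D (D (res F hF)))) * D (D (res F hF)) * i)
      + (6 : ℝ) • (D (D (res F hF)) ^ 3 * (i * i))
      - (3 : ℝ) • (D (D (D (res F hF))) * D (res F hF) * D (D (res F hF)) * (i * i))) := by
  have h1 := contDiffOn_dX V.isOpen hF
  have h2 := contDiffOn_dX V.isOpen h1
  rw [hi, ← res_dX hF, ← res_dX h1, ← res_dX h2, D_res h1, D_res hF, T_res hF]
  simp only [res_mul, res_smul, res_pow, res_sub, res_add]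
  rw [res_eq_res]
  refine forall₂_congr fun q hq => ?_
  rw [gPow_neg_two (he q hq) (hp q hq)]

theorem susyMKdV_iff (hF : ContDiffOn ℝ ∞ F V) : SusyMKdV V F ↔
    T (res F hF) = (1 / 4 : ℝ) • D (D (D (D (D (D (res F hF))))))
      - (3 / 16 : ℝ) • (D (res F hF) * D (D (res F hF * D (res F hF)))) := by
  have h1 := contDiffOn_dX V.isOpen hF
  have h2 := contDiffOn_dX V.isOpen h1
  rw [← res_dX hF, ← res_dX h1, ← res_dX h2, D_res hF, T_res hF, res_mul, ← res_dX]
  simp only [res_mul, res_smul, res_sub]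
  exact res_eq_res.symm

theorem contDiffOn_schwarzianRHS (hF : ContDiffOn ℝ ∞ F V) (hp : ∀ q ∈ V, 0 < body (sD F q)) :
    ContDiffOn ℝ ∞ (schwarzianRHS F) V :=
  have h1 := contDiffOn_dX V.isOpen hF
  have h2 := contDiffOn_dX V.isOpen h1
  ((contDiffOn_dX V.isOpen h2).sub (((h2.mul (contDiffOn_sD V.isOpen h1)).mul
    (contDiffOn_gPow (contDiffOn_sD V.isOpen hF) hp (-1))).const_smul _)).const_smul _

theorem res_schwarzianRHS (hF : ContDiffOn ℝ ∞ F V) (hp : ∀ q ∈ V, 0 < body (sD F q)) :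
    res (schwarzianRHS F) (contDiffOn_schwarzianRHS hF hp)
    = (1 / 4 : ℝ) • (D (D (D (D (D (D (res F hF)))))) - (3 : ℝ) • (D (D (D (D (res F hF))))
      * D (D (D (res F hF)))
      * res (fun q => gPow (sD F q) (-1))
        (contDiffOn_gPow (contDiffOn_sD V.isOpen hF) hp (-1)))) := by
  have h1 := contDiffOn_dX V.isOpen hF
  have h2 := contDiffOn_dX V.isOpen h1
  rw [← res_dX hF, ← res_dX h1, ← res_dX h2, D_res h1]
  rfl

theorem susySchwarzianKdV_iff (hF : ContDiffOn ℝ ∞ F V) (hp : ∀ q ∈ V, 0 < body (sD F q))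
    :
    SusySchwarzianKdV V F ↔
      T (res F hF) = res (schwarzianRHS F) (contDiffOn_schwarzianRHS hF hp) := by
  rw [T_res]
  exact res_eq_res.symm

theorem sD_schwarzian_iff (hF : ContDiffOn ℝ ∞ F V) (hp : ∀ q ∈ V, 0 < body (sD F q)) :
    (∀ q ∈ V, sD (fun z => dT F z - schwarzianRHS F z) q = 0) ↔
    T (D (res F hF)) = D (res (schwarzianRHS F) (contDiffOn_schwarzianRHS hF hp)) := by
  have h : res (fun z => dT F z - schwarzianRHS F z)
      ((contDiffOn_dT V.isOpen hF).sub (contDiffOn_schwarzianRHS hF hp))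
      = T (res F hF) - res (schwarzianRHS F) (contDiffOn_schwarzianRHS hF hp) := by
    rw [T_res]; rfl
  rw [T_D, ← sub_eq_zero, ← map_sub, ← h, D_res]
  exact (res_eq_res (hG := contDiffOn_const (c := (0 : Gr N)))).symm

theorem contDiffOn_coefY (hF : ContDiffOn ℝ ∞ F V) : ContDiffOn ℝ ∞ (coefY F) V :=
  have h1 := contDiffOn_dX V.isOpen hF
  have h2 := contDiffOn_dX V.isOpen h1
  (((h2.mul hF).const_smul _).neg.add ((h1.pow 2).const_smul _)).add
    (((contDiffOn_sD V.isOpen h1).mul (contDiffOn_sD V.isOpen hF)).const_smul _)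

theorem res_coefY (hF : ContDiffOn ℝ ∞ F V) :
    res (coefY F) (contDiffOn_coefY hF) = oldCoefY (res F hF) := by
  have h1 := contDiffOn_dX V.isOpen hF
  rw [oldCoefY, ← res_dX hF, ← res_dX h1, D_res h1, D_res hF]
  rfl

theorem contDiffOn_coefD (hF : ContDiffOn ℝ ∞ F V) (hp : ∀ q ∈ V, 0 < body (F q)) :
    ContDiffOn ℝ ∞ (coefD F) V :=
  have h1 := contDiffOn_dX V.isOpen hF
  have h2 := contDiffOn_dX V.isOpen h1
  (((contDiffOn_sD V.isOpen h2).mul (contDiffOn_gPow hF hp _)).const_smul _).neg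

theorem contDiffOn_coefY' (hF : ContDiffOn ℝ ∞ F V) (hp : ∀ q ∈ V, 0 < body (F q)) :
    ContDiffOn ℝ ∞ (coefY' F) V :=
  have h1 := contDiffOn_dX V.isOpen hF
  have h2 := contDiffOn_dX V.isOpen h1
  ((((h2.mul (contDiffOn_gPow hF hp _)).const_smul _).neg.add
    (((h1.pow 2).mul (contDiffOn_gPow hF hp _)).const_smul _)).add
    (((contDiffOn_sD V.isOpen h1).mul (contDiffOn_sD V.isOpen hF)).mul
      (contDiffOn_gPow hF hp _))).const_smul _

theorem contDiffOn_coefD' (hF : ContDiffOn ℝ ∞ F V) (hp : ∀ q ∈ V, 0 < body (F q)) :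
    ContDiffOn ℝ ∞ (coefD' F) V :=
  have h0 := contDiffOn_sD V.isOpen hF
  have h1 := contDiffOn_dX V.isOpen hF
  have h2 := contDiffOn_dX V.isOpen h1
  (((((contDiffOn_sD V.isOpen h2).mul (contDiffOn_gPow hF hp _)).const_smul _).neg.add
    ((((contDiffOn_sD V.isOpen h1).mul h1).mul (contDiffOn_gPow hF hp _)).const_smul _)).add
    (((h0.mul h2).mul (contDiffOn_gPow hF hp _)).const_smul _)).sub
    (((h0.mul (h1.pow 2)).mul (contDiffOn_gPow hF hp _)).const_smul _) |>.const_smul _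

theorem res_mul_gPow_neg_one (hF : ContDiffOn ℝ ∞ F V) (he : ∀ q ∈ V, IsEven (F q))
    (hp : ∀ q ∈ V, 0 < body (F q)) :
    res F hF * res _ (contDiffOn_gPow hF hp (-1)) = 1 :=
  Subtype.ext (funext fun q => mul_gPow_neg_one (he q q.2) (hp q q.2))

theorem res_gPow_neg_half_mul_self (hF : ContDiffOn ℝ ∞ F V) (he : ∀ q ∈ V, IsEven (F q))
    (hp : ∀ q ∈ V, 0 < body (F q)) :
    res _ (contDiffOn_gPow hF hp (-1 / 2))
    * res _ (contDiffOn_gPow hF hp (-1 / 2)) = res _ (contDiffOn_gPow hF hp (-1)) :=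
  Subtype.ext (funext fun q => gPow_neg_half_mul_self (he q q.2) (hp q q.2))

theorem res_coefD (hF : ContDiffOn ℝ ∞ F V) (he : ∀ q ∈ V, IsEven (F q))
    (hp : ∀ q ∈ V, 0 < body (F q)) :
    res (coefD F) (contDiffOn_coefD hF hp)
    = oldCoefD (res F hF) (res _ (contDiffOn_gPow hF hp (-1 / 2))) := by
  have h1 := contDiffOn_dX V.isOpen hF
  rw [oldCoefD, ← res_dX hF, ← res_dX h1, D_res]
  simp only [res_mul, res_smul, res_neg]
  refine res_eq_res.2 fun q hq => ?_
  rw [coefD, gPow_three_halves (he q hq) (hp q hq)]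

theorem res_coefY' (hF : ContDiffOn ℝ ∞ F V) (he : ∀ q ∈ V, IsEven (F q))
    (hp : ∀ q ∈ V, 0 < body (F q)) :
    res (coefY' F) (contDiffOn_coefY' hF hp)
    = aCoef (res (fun q => gLog (F q)) (contDiffOn_gLog hF hp)) := by
  have h1 := contDiffOn_dX V.isOpen hF
  rw [← (isLog_gLog hF he hp).aCoef_eq (res_mul_gPow_neg_one hF he hp), ← res_dX hF, ← res_dX h1,
    D_res h1, D_res hF]
  simp only [res_mul, res_smul, res_neg, res_pow, res_add]
  refine res_eq_res.2 fun q hq => ?_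
  rw [coefY', gPow_neg_two (he q hq) (hp q hq)]

theorem res_coefD' (hF : ContDiffOn ℝ ∞ F V) (he : ∀ q ∈ V, IsEven (F q))
    (hp : ∀ q ∈ V, 0 < body (F q)) :
    res (coefD' F) (contDiffOn_coefD' hF hp)
    = (1 / 2 : ℝ) • D (aCoef (res (fun q => gLog (F q)) (contDiffOn_gLog hF hp))) := by
  have h1 := contDiffOn_dX V.isOpen hF
  have h2 := contDiffOn_dX V.isOpen h1
  rw [← (isLog_gLog hF he hp).D_aCoef_eq (res_mul_gPow_neg_one hF he hp), ← res_dX hF, ← res_dX h1,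
    D_res h2, D_res h1, D_res hF]
  simp only [res_mul, res_smul, res_neg, res_pow, res_add, res_sub]
  refine res_eq_res.2 fun q hq => ?_
  rw [coefD', gPow_neg_two (he q hq) (hp q hq), gPow_neg_three (he q hq) (hp q hq)]

theorem isHarryDym_of_map (hF : ContDiffOn ℝ ∞ F V) (he : ∀ q ∈ V, IsEven (F q))
    (hp : ∀ q ∈ V, 0 < body (F q))
    {l : SmoothField N V} (hl : IsLog l (res F hF))
    (hw : IsLog ((-1 / 2 : ℝ) • l) (res _ (contDiffOn_gPow hF hp (-1 / 2))))
    (h : SusyHarryDym V F) :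
    IsHarryDym l (res F hF) (res _ (contDiffOn_gPow hF hp (-1)))
      (res _ (contDiffOn_gPow hF hp (-1 / 2))) where
  log := hl
  log_w := hw
  mul_inv := res_mul_gPow_neg_one hF he hp
  w_mul_w := res_gPow_neg_half_mul_self hF he hp
  eqn := (susyHarryDym_iff hF).1 h

/-- The system `D f = h`, `T f = g` over a convex domain. -/
theorem exists_D_eq_T_eq (hc : Convex ℝ (V : Set (ℝ × ℝ))) {g h : SmoothField N V}
    (hgh : D g = T h) : ∃ f, D f = h ∧ T f = g := by
  obtain ⟨G, hG, rfl⟩ := res_surj g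
  obtain ⟨H, hH, rfl⟩ := res_surj h
  rw [D_res, T_res, res_eq_res] at hgh
  obtain ⟨F, hF, hF'⟩ := exists_sD_eq_dT_eq V.isOpen hc hH hG hgh
  refine ⟨res F hF, ?_, ?_⟩
  · rw [D_res]; exact res_eq_res.2 fun q hq => (hF' q hq).1
  · rw [T_res]; exact res_eq_res.2 fun q hq => (hF' q hq).2

theorem exists_odd_D_eq_T_eq (hc : Convex ℝ (V : Set (ℝ × ℝ))) {g h : SmoothField N V}
    (hgh : D g = T h) (hh : inv h = h) (hg : inv g = -g) :
    ∃ f, inv f = -f ∧ D f = h ∧ T f = g := by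
  obtain ⟨f, h1, h2⟩ := exists_D_eq_T_eq hc hgh
  have h3 : D (inv f) = -h := by rw [← hh, ← h1, inv_D, neg_neg]
  have h4 : T (inv f) = -g := by rw [← inv_T, h2, hg]
  refine ⟨(1 / 2 : ℝ) • (f - inv f), ?_, ?_, ?_⟩
  · rw [map_smul, map_sub, SuperDiffAlg.inv_inv, ← smul_neg, neg_sub]
  · rw [map_smul, map_sub, h1, h3]; module
  · rw [map_smul, map_sub, h2, h4]; module

theorem exists_even_D_eq_T_eq (hc : Convex ℝ (V : Set (ℝ × ℝ))) {g h : SmoothField N V}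
    (hgh : D g = T h) (hh : inv h = -h) (hg : inv g = g) :
    ∃ f, inv f = f ∧ D f = h ∧ T f = g := by
  obtain ⟨f, h1, h2⟩ := exists_D_eq_T_eq hc hgh
  have h3 : D (inv f) = h := by rw [← neg_neg h, ← hh, ← h1, inv_D, neg_neg]
  have h4 : T (inv f) = g := by rw [← inv_T, h2, hg]
  refine ⟨(1 / 2 : ℝ) • (f + inv f), ?_, ?_, ?_⟩
  · rw [map_smul, map_add, SuperDiffAlg.inv_inv, add_comm]
  · rw [map_smul, map_add, h1, h3]; module
  · rw [map_smul, map_add, h2, h4]; module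

end SmoothField

/-! ### The substitution homomorphism -/

namespace IsSuperChange
open SuperDiffAlg SmoothField
variable {Ω : TopologicalSpace.Opens (ℝ × ℝ)} {Y R F : SField N}

/-- The open set onto which the underlying map takes the domain. -/
def image (h : IsSuperChange Ω Y R) : TopologicalSpace.Opens (ℝ × ℝ) :=
  ⟨bodyMap Y '' Ω, h.isOpen_image Ω.isOpen⟩

theorem bodyMap_mem (h : IsSuperChange Ω Y R) {p : ℝ × ℝ} (hp : p ∈ Ω) :
    bodyMap Y p ∈ (h.image : Set (ℝ × ℝ)) := Set.mem_image_of_mem _ hp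

theorem contDiffOn_pull (h : IsSuperChange Ω Y R) (hF : ContDiffOn ℝ ∞ F h.image) :
    ContDiffOn ℝ ∞ (pull Y R F) Ω :=
  SusyHD.contDiffOn_pull h.image.isOpen (fun _ => h.bodyMap_mem) h.smoothY h.smoothR hF

theorem res_pull_ext (h : IsSuperChange Ω Y R) (hF : ContDiffOn ℝ ∞ F h.image) :
    res (pull Y R (SmoothField.ext (res F hF))) (h.contDiffOn_pull (contDiffOn_ext _))
      = res (pull Y R F) (h.contDiffOn_pull hF) :=
  res_eq_res.2 fun _ hp => pull_congr h.image.isOpen (h.bodyMap_mem hp) (ext_res hF)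

theorem pull_const_algebraMap (h : IsSuperChange Ω Y R) (r : ℝ) :
    res (pull Y R fun _ => algebraMap ℝ (Gr N) r) (h.contDiffOn_pull contDiffOn_const)
      = algebraMap ℝ _ r := by
  refine Subtype.ext (funext fun p => ?_)
  change pull Y R _ p = algebraMap ℝ (Gr N) r
  rw [pull_const, substTheta, dTheta_algebraMap, mul_zero, add_zero]

/-- The passage from the new variables to the old ones, as a homomorphism of algebras of smooth
superfields. -/
def pullHom (h : IsSuperChange Ω Y R) : SmoothField N h.image →ₐ[ℝ] SmoothField N Ω where
  toFun f := res (pull Y R (SmoothField.ext f)) (h.contDiffOn_pull (contDiffOn_ext f))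
  map_one' := by
    have h1 := (h.res_pull_ext contDiffOn_const).trans (h.pull_const_algebraMap 1)
    rw [map_one] at h1
    refine Eq.trans ?_ h1
    congr
  map_zero' := by
    have h1 := (h.res_pull_ext contDiffOn_const).trans (h.pull_const_algebraMap 0)
    rw [map_zero] at h1
    refine Eq.trans ?_ h1
    congr
  map_mul' f g := by
    obtain ⟨F, hF, rfl⟩ := res_surj f
    obtain ⟨G, hG, rfl⟩ := res_surj g
    rw [res_mul, res_pull_ext, res_pull_ext, res_pull_ext, res_mul]
    exact res_eq_res.2 fun p hp => pull_mul h.image.isOpen (h.bodyMap_mem hp) (h.evenY p hp)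
      (h.oddR p hp) hF hG
  map_add' f g := by
    obtain ⟨F, hF, rfl⟩ := res_surj f
    obtain ⟨G, hG, rfl⟩ := res_surj g
    rw [res_add, res_pull_ext, res_pull_ext, res_pull_ext, res_add]
    exact res_eq_res.2 fun p hp => pull_add h.image.isOpen (h.bodyMap_mem hp) hF hG
  commutes' r := (h.res_pull_ext contDiffOn_const).trans (h.pull_const_algebraMap r)

theorem pullHom_res (h : IsSuperChange Ω Y R) (hF : ContDiffOn ℝ ∞ F h.image) :
    h.pullHom (res F hF) = res (pull Y R F) (h.contDiffOn_pull hF) := h.res_pull_ext hF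

theorem inv_pullHom (h : IsSuperChange Ω Y R) (f : SmoothField N h.image) :
    inv (h.pullHom f) = h.pullHom (inv f) := by
  obtain ⟨F, hF, rfl⟩ := res_surj f
  rw [pullHom_res]
  change inv₀ _ = h.pullHom (inv₀ _)
  rw [inv₀_res, inv₀_res, pullHom_res]
  exact res_eq_res.2 fun p hp => gradeInv_pull h.image.isOpen (h.bodyMap_mem hp) (h.evenY p hp)
    (h.oddR p hp) hF

theorem pullHom_injective (h : IsSuperChange Ω Y R) : Function.Injective h.pullHom := by
  rw [injective_iff_map_eq_zero]
  intro f hf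
  obtain ⟨F, hF, rfl⟩ := res_surj f
  rw [pullHom_res] at hf
  have h0 := (res_eq_res (hG := contDiffOn_const (c := (0 : Gr N)))).1 hf
  exact (res_eq_res (hG := contDiffOn_const (c := (0 : Gr N)))).2 (h.pull_injective Ω.isOpen hF h0)

theorem pullHom_surjective (h : IsSuperChange Ω Y R) : Function.Surjective h.pullHom := by
  intro g
  obtain ⟨G, hG, rfl⟩ := res_surj g
  obtain ⟨F, hF, hFG⟩ := h.exists_pull_eq Ω.isOpen hG
  exact ⟨res F hF, (h.pullHom_res hF).trans (res_eq_res.2 hFG)⟩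

end IsSuperChange

namespace IsReciprocal
open SuperDiffAlg SmoothField
variable {Ω : TopologicalSpace.Opens (ℝ × ℝ)} {U Y R S F : SField N}

theorem D_pullHom (h : IsReciprocal Ω U Y R) (hU : ContDiffOn ℝ ∞ U Ω)
    (hUpos : ∀ p ∈ Ω, 0 < body (U p)) (f : SmoothField N h.image) :
    D (h.pullHom f) = res _ (contDiffOn_gPow hU hUpos (-1 / 2)) * h.pullHom (D f) := by
  obtain ⟨F, hF, rfl⟩ := res_surj f
  rw [h.pullHom_res, D_res, D_res, h.pullHom_res, res_mul]
  exact res_eq_res.2 (h.liouville F hF)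

theorem T_pullHom (h : IsReciprocal Ω U Y R) (hU : ContDiffOn ℝ ∞ U Ω)
    (hUeven : ∀ p ∈ Ω, IsEven (U p)) (hUpos : ∀ p ∈ Ω, 0 < body (U p))
    (f : SmoothField N h.image) :
    T (h.pullHom f) = h.pullHom (T f) + oldCoefY (res U hU) * h.pullHom (D (D f))
      + oldCoefD (res U hU) (res _ (contDiffOn_gPow hU hUpos (-1 / 2))) * h.pullHom (D f) := by
  obtain ⟨F, hF, rfl⟩ := res_surj f
  rw [← res_coefY, ← res_coefD hU hUeven hUpos, ← res_dX, h.pullHom_res, T_res, T_res, D_res,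
    h.pullHom_res, h.pullHom_res, h.pullHom_res]
  simp only [res_mul, res_add]
  exact res_eq_res.2 (h.time F hF)

theorem isEven_pos (h : IsReciprocal Ω U Y R) (hU : ContDiffOn ℝ ∞ U Ω)
    (hUeven : ∀ p ∈ Ω, IsEven (U p)) (hUpos : ∀ p ∈ Ω, 0 < body (U p))
    (hS : ContDiffOn ℝ ∞ S h.image) (hSU : ∀ p ∈ Ω, pull Y R S p = U p) :
    (∀ q ∈ h.image, IsEven (S q)) ∧ ∀ q ∈ h.image, 0 < body (S q) := by
  have hs : h.pullHom (res S hS) = res U hU := (h.pullHom_res hS).trans (res_eq_res.2 hSU)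
  constructor
  · rw [← inv_res_eq_self hS]
    apply h.pullHom_injective
    rw [← h.inv_pullHom, hs, (inv_res_eq_self hU).2 hUeven]
  · rintro _ ⟨p, hp, rfl⟩
    rw [← body_pull (h.oddR p hp), hSU p hp]
    exact hUpos p hp

/-- The substitution of a reciprocal transformation has the properties on which the algebraic
computations rest. -/
theorem isTransformation (h : IsReciprocal Ω U Y R) (hU : ContDiffOn ℝ ∞ U Ω)
    (hUeven : ∀ p ∈ Ω, IsEven (U p)) (hUpos : ∀ p ∈ Ω, 0 < body (U p))
    (hHD : SusyHarryDym Ω U) (hS : ContDiffOn ℝ ∞ S h.image)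
    (hSU : ∀ p ∈ Ω, pull Y R S p = U p) (he : ∀ q ∈ h.image, IsEven (S q))
    (hp : ∀ q ∈ h.image, 0 < body (S q)) :
    IsTransformation h.pullHom (res _ (contDiffOn_gLog hS hp)) (res S hS)
      (res _ (contDiffOn_gPow hS hp (-1 / 2))) (res _ (contDiffOn_gPow hU hUpos (-1)))
      (res _ (contDiffOn_gPow hU hUpos (-1 / 2))) := by
  have hs : h.pullHom (res S hS) = res U hU := (h.pullHom_res hS).trans (res_eq_res.2 hSU)
  have hlog := isLog_gLog hS he hp
  have hloga := isLog_gPow hS he hp (-1 / 2)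
  have hD := h.D_pullHom hU hUpos
  have hT := h.T_pullHom hU hUeven hUpos
  -- The substituted square root is the square root: both are even with positive body.
  have ha : h.pullHom (res _ (contDiffOn_gPow hS hp (-1 / 2)))
      = res _ (contDiffOn_gPow hU hUpos (-1 / 2)) := by
    have h1 : res S hS * (res _ (contDiffOn_gPow hS hp (-1 / 2))
        * res _ (contDiffOn_gPow hS hp (-1 / 2))) = 1 := by
      rw [res_gPow_neg_half_mul_self hS he hp, res_mul_gPow_neg_one hS he hp]
    have h2 := congrArg h.pullHom h1
    rw [map_mul, map_mul, hs, map_one] at h2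
    have h3 : inv (h.pullHom (res _ (contDiffOn_gPow hS hp (-1 / 2))))
        = h.pullHom (res _ (contDiffOn_gPow hS hp (-1 / 2))) := by
      rw [h.inv_pullHom, hloga.even_exp]
    rw [h.pullHom_res] at h2 h3 ⊢
    refine res_eq_res.2 fun p hpΩ => eq_of_mul_self_eq ((inv_res_eq_self _).1 h3 p hpΩ) ?_ ?_ ?_
    · rw [body_pull (h.oddR p hpΩ)]
      exact body_gPow_pos (hp _ (h.bodyMap_mem hpΩ)) _
    · exact body_gPow_pos (hUpos p hpΩ) _
    · refine eq_of_mul_eq_one (hUeven p hpΩ) (congrArg (fun f => f.1 ⟨p, hpΩ⟩) h2) ?_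
      rw [gPow_neg_half_mul_self (hUeven p hpΩ) (hUpos p hpΩ),
        mul_gPow_neg_one (hUeven p hpΩ) (hUpos p hpΩ)]
  have hmap : ∀ {l s : SmoothField N h.image}, IsLog l s →
      IsLog (h.pullHom l) (h.pullHom s) := by
    intro l s hl
    have hse : inv (h.pullHom s) = h.pullHom s := by rw [h.inv_pullHom, hl.even_exp]
    refine ⟨by rw [h.inv_pullHom, hl.even], hse, ?_, ?_⟩
    · rw [hD, hD, hl.D_exp, map_mul, mul_even_left hse]
    · rw [hT, hT, hl.T_exp, hl.D2, hl.D_exp]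
      simp only [map_mul, mul_add, mul_even_left hse]
  refine ⟨h.pullHom_injective, hlog, hloga, ha, ?_, h.inv_pullHom, hD, ?_⟩
  · rw [hs]
    refine isHarryDym_of_map hU hUeven hUpos ?_ ?_ hHD
    · rw [← hs]; exact hmap hlog
    · rw [← ha, ← map_smul]; exact hmap hloga
  · rw [hs]; exact hT

/-- The potential `Λ` with `𝔻Λ = S^{-1/2}`. -/
theorem exists_potential (h : IsReciprocal Ω U Y R) (hU : ContDiffOn ℝ ∞ U Ω)
    (hUeven : ∀ p ∈ Ω, IsEven (U p)) (hUpos : ∀ p ∈ Ω, 0 < body (U p))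
    (hHD : SusyHarryDym Ω U) (hS : ContDiffOn ℝ ∞ S h.image)
    (hSU : ∀ p ∈ Ω, pull Y R S p = U p) (he : ∀ q ∈ h.image, IsEven (S q))
    (hp : ∀ q ∈ h.image, 0 < body (S q)) (hc : Convex ℝ (Ω : Set (ℝ × ℝ))) :
    ∃ L : SField N, ContDiffOn ℝ ∞ L h.image ∧
      (∀ q ∈ h.image, IsOdd (L q) ∧ 0 < body (sD L q) ∧ S q = gPow (sD L q) (-2)) ∧
      SusySchwarzianKdV h.image L := by
  have ht := h.isTransformation hU hUeven hUpos hHD hS hSU he hp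
  set Φ := h.pullHom
  set l : SmoothField N h.image := res _ (contDiffOn_gLog hS hp)
  have ha0 := contDiffOn_gPow hS hp (-1 / 2)
  have hae : ∀ q ∈ h.image, IsEven (gPow (S q) (-1 / 2)) := fun q hq => (he q hq).gPow _
  have hap : ∀ q ∈ h.image, 0 < body (gPow (S q) (-1 / 2)) := fun q hq =>
    body_gPow_pos (hp q hq) _
  set a : SmoothField N h.image := res _ ha0
  set i' : SmoothField N h.image := res _ (contDiffOn_gPow ha0 hap (-1))
  have hai : a * i' = 1 := res_mul_gPow_neg_one ha0 hae hap
  set w : SmoothField N Ω := res _ (contDiffOn_gPow hU hUpos (-1 / 2))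
  -- `Q` is the right-hand side of the Schwarzian equation, in terms of `a = 𝔻Λ`.
  set Q : SmoothField N h.image :=
    (1 / 4 : ℝ) • (D (D (D (D (D a)))) - (3 : ℝ) • (D (D (D a)) * D (D a) * i')) with hQ
  have hl : l = (-2 : ℝ) • ((-1 / 2 : ℝ) • l) := by rw [smul_smul]; norm_num
  have hTa : T a = D Q := (IsLog.schwarzian_iff ht.log_a hai hl).2 ht.log_equation
  have hpot := ht.integrable_potential hTa
  have hw : inv (w * w) = w * w := by rw [map_mul, ht.sol.log_w.even_exp]
  set P : SmoothField N h.image := Q + aCoef l * D a + (1 / 2 : ℝ) • D (aCoef l) * a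
  have hae' : inv a = a := ht.log_a.even_exp
  have hi' : inv i' = i' := ht.log_a.even_inv hai
  have hQodd : inv Q = -Q := by
    have e2 := even_D_D hae'
    have o3 := odd_D e2
    have o5 := odd_D (even_D_D e2)
    rw [hQ]
    simp only [map_smul, map_sub, map_mul, o5, o3, e2, hi']
    simp only [neg_mul]
    module
  have hPodd : inv (Φ P) = -Φ P := by
    rw [ht.inv_map, ← map_neg]
    congr 1
    have ec := even_aCoef ht.log.even
    simp only [P, map_add, map_mul, map_smul, hQodd, ec, odd_D hae', odd_D ec, hae']
    simp only [smul_neg, neg_mul, mul_neg, neg_add_rev]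
    abel
  -- The potential is constructed over the convex domain of the old variables and carried over to
  -- the new ones, whose domain need not be convex.
  obtain ⟨lam, hlo, hlD, hlT⟩ := exists_odd_D_eq_T_eq hc hpot hw hPodd
  obtain ⟨Λ, rfl⟩ := h.pullHom_surjective lam
  change D (Φ Λ) = _ at hlD
  change T (Φ Λ) = _ at hlT
  have hDΛ : D Λ = a := by
    apply ht.inj
    apply ht.w_mul_left_inj
    rw [← ht.D_map, hlD, ht.map_a]
  have hTΛ : T Λ = Q := by
    rw [ht.T_map', hDΛ] at hlT
    have := ht.inj hlT
    exact add_right_cancel (add_right_cancel this)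
  have hΛo : inv Λ = -Λ := by
    apply ht.inj
    rw [← ht.inv_map, map_neg]
    exact hlo
  obtain ⟨L, hL, rfl⟩ := res_surj Λ
  have hDL := hDΛ
  rw [D_res] at hDL
  have hDL' : ∀ q ∈ h.image, sD L q = gPow (S q) (-1 / 2) := res_eq_res.1 hDL
  have hLp : ∀ q ∈ h.image, 0 < body (sD L q) := fun q hq => by rw [hDL' q hq]; exact hap q hq
  refine ⟨L, hL, fun q hq => ⟨(inv_res_eq_neg hL).1 hΛo q hq, hLp q hq, ?_⟩, ?_⟩
  · rw [hDL' q hq, gPow_neg_half_neg_two (he q hq) (hp q hq)]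
  · rw [susySchwarzianKdV_iff hL hLp, res_schwarzianRHS hL hLp, hTΛ, hDΛ]
    have : res (fun q => gPow (sD L q) (-1))
        (contDiffOn_gPow (contDiffOn_sD h.image.isOpen hL) hLp (-1)) = i' :=
      res_eq_res.2 fun q hq => by rw [hDL' q hq]
    rw [this]

end IsReciprocal

/-! ### Existence of the reciprocal transformation -/

section existence
variable {Ω : Set (ℝ × ℝ)} {U Y R : SField N}

/-- On each line of constant time the body of `y` is strictly increasing. -/
theorem injOn_bodyMap (hΩ : IsOpen Ω) (hc : Convex ℝ Ω) (hY : ContDiffOn ℝ ∞ Y Ω)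
    (hpos : ∀ p ∈ Ω, 0 < body (dX Y p)) : Set.InjOn (bodyMap Y) Ω := by
  rintro ⟨x, t⟩ hx ⟨x', t'⟩ hx' h
  obtain ⟨h1, h2⟩ := Prod.mk.inj h
  simp only at h2
  subst h2
  set g : ℝ → ℝ × ℝ := fun z => (z, t) with hg
  have hgd : ∀ z, HasDerivAt g (1, 0) z := fun z =>
    (hasDerivAt_id z).prodMk (hasDerivAt_const z t)
  have hs : Convex ℝ (g ⁻¹' Ω) := by
    intro a ha b hb c d hc0 hd0 hcd
    have := hc ha hb hc0 hd0 hcd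
    simp only [hg, Prod.smul_mk, Prod.mk_add_mk, ← add_smul, hcd, one_smul] at this
    exact this
  have hd : ∀ z ∈ g ⁻¹' Ω, HasDerivAt (fun z => body (Y (g z))) (body (dX Y (g z))) z := by
    intro z hz
    have hYd := diffAt hΩ hY hz
    have h3 := (differentiableAt_body hYd).hasFDerivAt.comp_hasDerivAt z (hgd z)
    rw [fderiv_body hYd] at h3
    exact h3
  have hmono : StrictMonoOn (fun z => body (Y (g z))) (g ⁻¹' Ω) := by
    refine strictMonoOn_of_deriv_pos hs
      (fun z hz => (hd z hz).continuousAt.continuousWithinAt) fun z hz => ?_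
    rw [(hd z (interior_subset hz)).deriv]
    exact hpos (g z) (interior_subset (s := g ⁻¹' Ω) hz)
  rw [hmono.injOn hx hx' h1]

/-- A change of variables is the reciprocal transformation if its components satisfy the linear
system that expresses the two operator identities on the coordinates. -/
theorem isReciprocal_of_system (hΩ : IsOpen Ω) (hc : Convex ℝ Ω) (hU : ContDiffOn ℝ ∞ U Ω)
    (hUpos : ∀ p ∈ Ω, 0 < body (U p)) (hY : ContDiffOn ℝ ∞ Y Ω) (hR : ContDiffOn ℝ ∞ R Ω)
    (hYe : ∀ p ∈ Ω, IsEven (Y p)) (hRo : ∀ p ∈ Ω, IsOdd (R p))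
    (hDR : ∀ p ∈ Ω, sD R p = gPow (U p) (-1 / 2)) (hTR : ∀ p ∈ Ω, dT R p = coefD U p)
    (hDY : ∀ p ∈ Ω, sD Y p = gPow (U p) (-1 / 2) * R p)
    (hTY : ∀ p ∈ Ω, dT Y p = coefY U p + coefD U p * R p) : IsReciprocal Ω U Y R := by
  have hW := contDiffOn_gPow hU hUpos (-1 / 2)
  -- `∂ₓ y = 𝒟(𝒟y)` has the body of `U⁻¹`, as the term with the odd factor `ϱ` has none.
  have hX : ∀ p ∈ Ω, 0 < body (dX Y p) := by
    intro p hp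
    have h1 : dX Y p = sD (fun z => gPow (U z) (-1 / 2)) p * R p
        + gradeInv N (gPow (U p) (-1 / 2)) * gPow (U p) (-1 / 2) := by
      rw [← sD_sD hΩ hY hp, sD_congr hΩ hDY hp, sD_mul (diffAt hΩ hW hp) (diffAt hΩ hR hp),
        hDR p hp]
    have h2 : ∀ a : Gr N, bodyHom N (gradeInv N a) = bodyHom N a := by
      intro a
      induction a using gr_induction with
      | h0 r => simp
      | hadd a b ha hb => simp only [map_add, ha, hb]
      | hmul v a _ => simp
    have h3 := body_gPow_pos (hUpos p hp) (-1 / 2)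
    rw [body_eq] at h3 ⊢
    rw [h1, map_add, map_mul, (hRo p hp).bodyHom_eq_zero, mul_zero, zero_add, map_mul, h2]
    positivity
  have hch : IsSuperChange Ω Y R :=
    { smoothY := hY
      smoothR := hR
      evenY := hYe
      oddR := hRo
      inj := injOn_bodyMap hΩ hc hY hX
      nondegY := fun p hp => (hX p hp).ne'
      nondegR := fun p hp => by
        have h1 := congrArg body (hDR p hp)
        have h2 := body_gPow_pos (hUpos p hp) (-1 / 2)
        rw [← h1, body_eq, sD, map_add, map_mul, bodyHom_theta, zero_mul, add_zero, ← body_eq] at h2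
        exact h2.ne' }
  have hV := hch.isOpen_image hΩ
  refine ⟨hch, fun F hF p hp => ?_, fun F hF p hp => ?_⟩
  · have hq := Set.mem_image_of_mem (bodyMap Y) hp
    rw [sD_pull hV hq (diffAt hΩ hY hp) (diffAt hΩ hR hp) (hYe p hp) hF, hDR p hp, hDY p hp,
      pull_sD hV hq (hYe p hp) (hRo p hp) hF, mul_add, mul_assoc, add_comm]
  · have hq := Set.mem_image_of_mem (bodyMap Y) hp
    have h1 := dDir_pull hV hq (diffAt hΩ hY hp) (diffAt hΩ hR hp) (hYe p hp) hF (0, 1)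
    rw [← dT_eq_dDir, hTY p hp, hTR p hp] at h1
    rw [h1, pull_sD hV hq (hYe p hp) (hRo p hp) hF, one_smul]
    simp only [mul_add, add_mul, mul_assoc]
    abel

end existence

open SuperDiffAlg SmoothField in
/-- First `ϱ` and then `y` is found by the super Poincaré lemma. -/
theorem exists_isReciprocal {Ω : TopologicalSpace.Opens (ℝ × ℝ)} {U : SField N}
    (hc : Convex ℝ (Ω : Set (ℝ × ℝ))) (hU : ContDiffOn ℝ ∞ U Ω)
    (hUeven : ∀ p ∈ Ω, IsEven (U p)) (hUpos : ∀ p ∈ Ω, 0 < body (U p))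
    (hHD : SusyHarryDym Ω U) : ∃ Y R : SField N, IsReciprocal Ω U Y R := by
  have h := isHarryDym_of_map hU hUeven hUpos (isLog_gLog hU hUeven hUpos)
    (isLog_gPow hU hUeven hUpos (-1 / 2)) hHD
  have hu := h.log.even_exp
  have hw := h.log_w.even_exp
  have ho := h.odd_oldCoefD
  obtain ⟨r, hr, hrD, hrT⟩ := exists_odd_D_eq_T_eq hc h.T_w.symm hw ho
  obtain ⟨y, hy, hyD, hyT⟩ := exists_even_D_eq_T_eq hc (h.integrable_y hrD hrT)
    (by rw [map_mul, hw, hr, mul_neg])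
    (by rw [map_add, map_mul, even_oldCoefY hu, ho, hr, neg_mul_neg])
  obtain ⟨R, hR, rfl⟩ := res_surj r
  obtain ⟨Y, hY, rfl⟩ := res_surj y
  rw [D_res, res_mul, res_eq_res] at hyD
  rw [T_res, ← res_coefY, ← res_coefD hU hUeven hUpos, res_mul, res_add, res_eq_res] at hyT
  rw [D_res, res_eq_res] at hrD
  rw [T_res, ← res_coefD hU hUeven hUpos, res_eq_res] at hrT
  exact ⟨Y, R, isReciprocal_of_system Ω.isOpen hc hU hUpos hY hR ((inv_res_eq_self hY).1 hy)
    ((inv_res_eq_neg hR).1 hr) hrD hrT hyD hyT⟩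

/-! ### The equations in the new variables -/

namespace IsReciprocal
open SuperDiffAlg SmoothField
variable {Ω : TopologicalSpace.Opens (ℝ × ℝ)} {U Y R S : SField N}

theorem pull_coef (h : IsReciprocal Ω U Y R) (hU : ContDiffOn ℝ ∞ U Ω)
    (hUeven : ∀ p ∈ Ω, IsEven (U p)) (hUpos : ∀ p ∈ Ω, 0 < body (U p))
    (hHD : SusyHarryDym Ω U) (hS : ContDiffOn ℝ ∞ S h.image)
    (hSU : ∀ p ∈ Ω, pull Y R S p = U p) (he : ∀ q ∈ h.image, IsEven (S q))
    (hp : ∀ q ∈ h.image, 0 < body (S q)) :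
    ∀ p ∈ Ω, pull Y R (coefY' S) p = coefY U p ∧ pull Y R (coefD' S) p = coefD U p := by
  have ht := h.isTransformation hU hUeven hUpos hHD hS hSU he hp
  have hs : h.pullHom (res S hS) = res U hU := (h.pullHom_res hS).trans (res_eq_res.2 hSU)
  have h1 := ht.map_aCoef
  have h2 := ht.map_D_aCoef
  rw [hs, ← res_coefY' hS he hp, h.pullHom_res, ← res_coefY, res_eq_res] at h1
  rw [hs, ← res_coefD' hS he hp, h.pullHom_res, ← res_coefD hU hUeven hUpos, res_eq_res] at h2
  exact fun p hpΩ => ⟨h1 p hpΩ, h2 p hpΩ⟩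

theorem susySEquation (h : IsReciprocal Ω U Y R) (hU : ContDiffOn ℝ ∞ U Ω)
    (hUeven : ∀ p ∈ Ω, IsEven (U p)) (hUpos : ∀ p ∈ Ω, 0 < body (U p))
    (hHD : SusyHarryDym Ω U) (hS : ContDiffOn ℝ ∞ S h.image)
    (hSU : ∀ p ∈ Ω, pull Y R S p = U p) (he : ∀ q ∈ h.image, IsEven (S q))
    (hp : ∀ q ∈ h.image, 0 < body (S q)) : SusySEquation h.image S := by
  have ht := h.isTransformation hU hUeven hUpos hHD hS hSU he hp
  rw [susySEquation_iff hS he hp rfl]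
  exact (ht.log.sEquation_iff (res_mul_gPow_neg_one hS he hp)).2 ht.log_equation

theorem susyMKdV (h : IsReciprocal Ω U Y R) (hU : ContDiffOn ℝ ∞ U Ω)
    (hUeven : ∀ p ∈ Ω, IsEven (U p)) (hUpos : ∀ p ∈ Ω, 0 < body (U p))
    (hHD : SusyHarryDym Ω U) (hS : ContDiffOn ℝ ∞ S h.image)
    (hSU : ∀ p ∈ Ω, pull Y R S p = U p) (he : ∀ q ∈ h.image, IsEven (S q))
    (hp : ∀ q ∈ h.image, 0 < body (S q)) :
    SusyMKdV h.image (fun q => -sD (fun z => gLog (S z)) q) := by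
  have ht := h.isTransformation hU hUeven hUpos hHD hS hSU he hp
  have hl := contDiffOn_gLog hS hp
  rw [susyMKdV_iff (contDiffOn_sD h.image.isOpen hl).neg,
    ← res_neg (contDiffOn_sD h.image.isOpen hl), ← D_res hl]
  exact IsLog.mkdv ht.log.even ht.log_equation

end IsReciprocal

/-! ### The Schwarzian KdV equation -/

section schwarzian
open SuperDiffAlg SmoothField
variable {V : TopologicalSpace.Opens (ℝ × ℝ)} {L : SField N}

/-- The equation for `(𝔻Λ)⁻²` and the derivative of the Schwarzian KdV equation for `Λ` are both
equivalent to the same equation for the logarithm. -/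
theorem sD_schwarzian_iff_log (hL : ContDiffOn ℝ ∞ L V) (hLe : ∀ q ∈ V, IsEven (sD L q))
    (hLp : ∀ q ∈ V, 0 < body (sD L q)) {s : SmoothField N V}
    (hs : s = (-2 : ℝ) • res _ (contDiffOn_gLog (contDiffOn_sD V.isOpen hL) hLp)) :
    (∀ q ∈ V, sD (fun z => dT L z - schwarzianRHS L z) q = 0) ↔
    T s = (1 / 16 : ℝ) • ((4 : ℝ) • D (D (D (D (D (D s)))))
      - (2 : ℝ) • (D (D s) * (D (D s) * D (D s)))
      - (3 : ℝ) • (D (D (D s)) * (D s * D (D s)))) := by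
  have hA := contDiffOn_sD V.isOpen hL
  rw [← IsLog.schwarzian_iff (isLog_gLog hA hLe hLp) (res_mul_gPow_neg_one hA hLe hLp) hs,
    sD_schwarzian_iff hL hLp, res_schwarzianRHS hL hLp, D_res hL]

theorem susySEquation_gPow_iff (hL : ContDiffOn ℝ ∞ L V) (hLe : ∀ q ∈ V, IsEven (sD L q))
    (hLp : ∀ q ∈ V, 0 < body (sD L q)) :
    SusySEquation V (fun q => gPow (sD L q) (-2)) ↔
      ∀ q ∈ V, sD (fun z => dT L z - schwarzianRHS L z) q = 0 := by
  have hA := contDiffOn_sD V.isOpen hL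
  have hS := contDiffOn_gPow hA hLp (-2)
  have hSe : ∀ q ∈ V, IsEven (gPow (sD L q) (-2)) := fun q hq => (hLe q hq).gPow _
  have hSp : ∀ q ∈ V, 0 < body (gPow (sD L q) (-2)) := fun q hq => body_gPow_pos (hLp q hq) _
  rw [susySEquation_iff hS hSe hSp rfl, sD_schwarzian_iff_log hL hLe hLp rfl]
  exact (isLog_gPow hA hLe hLp (-2)).sEquation_iff (res_mul_gPow_neg_one hS hSe hSp)

theorem susyMKdV_of_schwarzian (hL : ContDiffOn ℝ ∞ L V) (hLe : ∀ q ∈ V, IsEven (sD L q))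
    (hLp : ∀ q ∈ V, 0 < body (sD L q)) (h : SusySchwarzianKdV V L) :
    SusyMKdV V (fun q => (2 : ℝ) • sD (fun z => gLog (sD L z)) q) := by
  have hA := contDiffOn_sD V.isOpen hL
  have hl := contDiffOn_gLog hA hLp
  have h0 : ∀ q ∈ V, sD (fun z => dT L z - schwarzianRHS L z) q = 0 := by
    rw [sD_schwarzian_iff hL hLp, T_D, (susySchwarzianKdV_iff hL hLp).1 h]
  have h1 := IsLog.mkdv (by rw [map_smul, (isLog_gLog hA hLe hLp).even])
    ((sD_schwarzian_iff_log hL hLe hLp rfl).1 h0)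
  rw [susyMKdV_iff ((contDiffOn_sD V.isOpen hl).const_smul 2),
    ← res_smul _ (contDiffOn_sD V.isOpen hl), ← D_res hl]
  rwa [map_smul, ← neg_smul, neg_neg] at h1

end schwarzian

end SusyHD

end

theorem mainTheorem4 (N : ℕ) (Ω : Set (ℝ × ℝ)) (hΩ : IsOpen Ω) (U : SusyHD.SField N)
    (hU : ContDiffOn ℝ ∞ U Ω) (hUeven : ∀ p ∈ Ω, SusyHD.IsEven (U p))
    (hUpos : ∀ p ∈ Ω, 0 < SusyHD.body (U p)) (hHD : SusyHD.SusyHarryDym Ω U) :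
    -- the transformation exists
    (Convex ℝ Ω → ∃ Y R : SusyHD.SField N, SusyHD.IsReciprocal Ω U Y R) ∧
    -- and maps the solution `U` to solutions in the new variables
    (∀ Y R : SusyHD.SField N, SusyHD.IsReciprocal Ω U Y R →
      IsOpen (SusyHD.bodyMap Y '' Ω) ∧
      (∃ S : SusyHD.SField N, ContDiffOn ℝ ∞ S (SusyHD.bodyMap Y '' Ω) ∧
        ∀ p ∈ Ω, SusyHD.pull Y R S p = U p) ∧
      (∀ S : SusyHD.SField N, ContDiffOn ℝ ∞ S (SusyHD.bodyMap Y '' Ω) →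
        (∀ p ∈ Ω, SusyHD.pull Y R S p = U p) →
        (∀ q ∈ SusyHD.bodyMap Y '' Ω, SusyHD.IsEven (S q) ∧ 0 < SusyHD.body (S q)) ∧
        (∀ p ∈ Ω, SusyHD.pull Y R (SusyHD.coefY' S) p = SusyHD.coefY U p ∧
          SusyHD.pull Y R (SusyHD.coefD' S) p = SusyHD.coefD U p) ∧
        SusyHD.SusySEquation (SusyHD.bodyMap Y '' Ω) S ∧
        SusyHD.SusyMKdV (SusyHD.bodyMap Y '' Ω)
          (fun q => -SusyHD.sD (fun z => SusyHD.gLog (S z)) q) ∧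
        (Convex ℝ Ω → ∃ L : SusyHD.SField N, ContDiffOn ℝ ∞ L (SusyHD.bodyMap Y '' Ω) ∧
          (∀ q ∈ SusyHD.bodyMap Y '' Ω, SusyHD.IsOdd (L q) ∧ 0 < SusyHD.body (SusyHD.sD L q) ∧
            S q = SusyHD.gPow (SusyHD.sD L q) (-2)) ∧
          SusyHD.SusySchwarzianKdV (SusyHD.bodyMap Y '' Ω) L))) ∧
    -- relation with the Schwarzian KdV equation
    (∀ (V : Set (ℝ × ℝ)) (L : SusyHD.SField N), IsOpen V → ContDiffOn ℝ ∞ L V →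
      (∀ q ∈ V, SusyHD.IsOdd (L q) ∧ 0 < SusyHD.body (SusyHD.sD L q)) →
      (SusyHD.SusySEquation V (fun q => SusyHD.gPow (SusyHD.sD L q) (-2)) ↔
        ∀ q ∈ V, SusyHD.sD (fun z => SusyHD.dT L z - SusyHD.schwarzianRHS L z) q = 0) ∧
      (SusyHD.SusySchwarzianKdV V L →
        SusyHD.SusyMKdV V
          (fun q => (2 : ℝ) • SusyHD.sD (fun z => SusyHD.gLog (SusyHD.sD L z)) q))) := by
  obtain ⟨Ω, rfl⟩ : ∃ O : TopologicalSpace.Opens (ℝ × ℝ), Ω = O := ⟨⟨Ω, hΩ⟩, rfl⟩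
  refine ⟨fun hc => SusyHD.exists_isReciprocal hc hU hUeven hUpos hHD, fun Y R h => ?_, ?_⟩
  · refine ⟨h.isOpen_image Ω.isOpen, h.exists_pull_eq Ω.isOpen hU, fun S hS hSU => ?_⟩
    obtain ⟨he, hp⟩ := h.isEven_pos hU hUeven hUpos hS hSU
    exact ⟨fun q hq => ⟨he q hq, hp q hq⟩, h.pull_coef hU hUeven hUpos hHD hS hSU he hp,
      h.susySEquation hU hUeven hUpos hHD hS hSU he hp,
      h.susyMKdV hU hUeven hUpos hHD hS hSU he hp,
      h.exists_potential hU hUeven hUpos hHD hS hSU he hp⟩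
  · intro V L hV hL hLo
    obtain ⟨V, rfl⟩ : ∃ O : TopologicalSpace.Opens (ℝ × ℝ), V = O := ⟨⟨V, hV⟩, rfl⟩
    have hLe : ∀ q ∈ V, SusyHD.IsEven (SusyHD.sD L q) := by
      rw [← SusyHD.SmoothField.inv_res_eq_self (SusyHD.contDiffOn_sD hV hL),
        ← SusyHD.SmoothField.D_res hL]
      exact SusyHD.SuperDiffAlg.even_D
        ((SusyHD.SmoothField.inv_res_eq_neg hL).2 fun q hq => (hLo q hq).1)
    have hLp := fun q hq => (hLo q hq).2
    exact ⟨SusyHD.susySEquation_gPow_iff hL hLe hLp, SusyHD.susyMKdV_of_schwarzian hL hLe hLp⟩
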